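/- **Setting.** Let $\lambda$ be the security parameter. A data structure $\mathcal D$ keeps its data in an erasable memory $\mathcal D.\mathsf{em}$ and in a persistent storage; executing an operation produces an access pattern $\mathsf{acc}$: the sequence of locations of persistent storage that are read, and of locations and contents that are written. *History independence.* In the experiment with challenge bit $b$ and adversary $\mathcal A=(\mathcal A_1,\mathcal A_2)$, $\mathcal D$ is initialized for parameters $\lambda, n$, with access pattern $\mathsf{acc}_0$; $\mathcal A_1(1^\lambda,\mathsf{acc}_0)$ outputs two sequences of operations $\vec{\mathsf{op}}^{(0)},\vec{\mathsf{op}}^{(1)}$ and a state $\mathsf{st}$; $\vec{\mathsf{op}}^{(b)}$ is executed, with access patterns $\vec{\mathsf{acc}}$; and $\mathcal A_2(\mathsf{st},\vec{\mathsf{acc}},\mathcal D.\mathsf{em})$ outputs a bit. $\mathcal A$ is $\ell$-admissible if $\mathcal A_1$ always outputs two executable sequences of the same length which result in the same set of at most $n$ stored items and whose last $\ell$ operations are identical. The advantage of $\mathcal A$ is the absolute difference of the probabilities of output $1$ for $b=0$ and $b=1$. $\mathcal D$ provides history independence with leakage of $\ell=\ell(\lambda,n)$ operations if for every polynomially bounded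 $n=n(\lambda)\ge 1$ and every efficient $\ell(\lambda,n(\lambda))$-admissible adversary, the advantage is negligible in $\lambda$. Efficiency is meant in the non-uniform sense: $\mathcal A_2$ is a family of polynomial-size probabilistic Boolean circuits, and $\mathcal A_1$ is any randomized procedure that outputs polynomially many operations. *The vORAM.* Its parameters are the bucket size $Z\ge 2\lambda$ in bits (polynomially bounded), the collision parameter $\gamma=\gamma(\lambda)$ with $2^{-\gamma}$ negligible in $\lambda$, and a symmetric encryption scheme with uniformly random $\lambda$-bit keys under which the encryptions of any two polynomial-length messages of equal length, each under a fresh key, are indistinguishable for polynomial-size probabilistic circuits. Persistent storage holds a complete binary tree of height $T=\lceil\log_2 n\rceil$ of encrypted buckets, each with its own key. A bucket consists of the keys of its two children, followed by (possibly partial) blocks, each preceded by its identifier and its length, and is padded with zeros to $Z$ bits. Initially all buckets are empty. An identifier is a $1$ followed by $2T+\gamma$ random bits; its $T+1$ leading bits determine a root-to-leaf path. Erasable memory holds the root key, the stash (a set of partial blocks, without a size limit), and the table of the current identifiers of the stored blocks, indexed by user-chosen labels; the sets and tables are represented independently of their history. The procedure $\mathsf{evict}(id)$ decrypts the path of $id$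 and merges all its partial blocks into the stash; $\mathsf{writeback}(id)$ goes from the leaf to the root, fills each bucket of the path greedily with blocks from the stash whose own paths contain that bucket (a block that does not fit is split, its end going into the bucket), and re-encrypts it under a fresh key. The order in which the "arbitrary" next block is taken from the set of candidates is any fixed function of this set. The operations are: *insert* a block under a new label (evict a random path, put the block into the stash with a fresh random identifier, write back the evicted path); *remove* a stored block (evict the path of its identifier, delete it from the stash, write back); *update* a stored block with a callback function (evict the path of its identifier, apply the callback, put the result into the stash with a fresh identifier, write back the evicted path). **Theorem.** There is a function $\ell(\lambda,n)=O(n\log n+\lambda n)$, with the implied constant valid for all $\lambda,n$ and with $\ell$ independent of the encryption scheme and of all other parameters, such that the vORAM provides history independence with leakage of $\ell$ operations. -/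

import Mathlib

noncomputable section

/-! ### Asymptotic notions -/

/-- `f ∈ poly(λ)`. -/
def PolyBounded (f : ℕ → ℕ) : Prop :=
  ∃ p : Polynomial ℕ, ∀ sp, f sp ≤ p.eval sp

/-- `f` is negligible: it decays faster than every inverse polynomial. -/
def Negligible (f : ℕ → ℝ) : Prop :=
  Asymptotics.SuperpolynomialDecay Filter.atTop (fun sp : ℕ => (sp : ℝ)) f

/-! ### Probabilistic Boolean circuits

An input is a finite sequence of bit strings.  Wires are numbered in the order of the gates, and a
gate reads wires with smaller numbers. -/

inductive Gate where
  /-- a hard-wired bit -/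
  | const (b : Bool)
  /-- bit number `i` of the string number `j` of the input (`false` if there is no such bit) -/
  | bit (j i : ℕ)
  /-- is there a bit number `i` in the string number `j` of the input? -/
  | present (j i : ℕ)
  /-- a fresh fair coin -/
  | coin
  /-- the negated conjunction of two earlier wires -/
  | nand (a b : ℕ)

/-- The bit number `i` of the string number `j`. -/
def inputBit (x : List (List Bool)) (j i : ℕ) : Option Bool :=
  (x[j]?).bind fun s => s[i]?

/-- The (random) value of a gate, given the input and the values of the earlier wires. -/
def Gate.value (x : List (List Bool)) (wires : List Bool) : Gate → PMF Bool
  | .const b => PMF.pure b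
  | .bit j i => PMF.pure ((inputBit x j i).getD false)
  | .present j i => PMF.pure (inputBit x j i).isSome
  | .coin => PMF.uniformOfFintype Bool
  | .nand a b => PMF.pure (!(wires.getD a false && wires.getD b false))

/-- A circuit is the list of its gates; its size is the length of the list. -/
abbrev Circuit := List Gate

/-- All wire values of a circuit, the gates being evaluated one after the other. -/
def Circuit.wires (C : Circuit) (x : List (List Bool)) : PMF (List Bool) :=
  C.foldlM (fun ws g => (g.value x ws).map fun v => ws ++ [v]) []

/-- The output of a circuit is the value of its last gate. -/
def Circuit.run (C : Circuit) (x : List (List Bool)) : PMF Bool :=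
  (C.wires x).map fun ws => ws.getLastD false

/-! ### Symmetric encryption -/

/-- Keys are strings of `sp` bits, `sp` being the security parameter. -/
abbrev Key (sp : ℕ) := Fin sp → Bool

/-- A symmetric encryption scheme whose keys are drawn uniformly from the `sp`-bit strings. -/
structure SymEnc where
  enc : ∀ sp : ℕ, Key sp → List Bool → PMF (List Bool)
  dec : ∀ sp : ℕ, Key sp → List Bool → List Bool
  correct : ∀ sp k m, ∀ c ∈ (enc sp k m).support, dec sp k c = m

/-- Encryption of a message under a fresh key. -/
def SymEnc.fresh (E : SymEnc) (sp : ℕ) (m : List Bool) : PMF (List Bool) :=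
  (PMF.uniformOfFintype (Key sp)).bind fun k => E.enc sp k m

/-- Indistinguishability of the encryptions of two messages of the same, polynomially bounded,
length in the presence of an eavesdropper who sees one ciphertext, against polynomial-size
probabilistic circuits. -/
def SymEnc.Indistinguishable (E : SymEnc) : Prop :=
  ∀ (m₀ m₁ : ℕ → List Bool) (C : ℕ → Circuit),
    (∀ sp, (m₀ sp).length = (m₁ sp).length) →
    PolyBounded (fun sp => (m₀ sp).length) →
    PolyBounded (fun sp => (C sp).length) →
    Negligible fun sp =>
      |(((E.fresh sp (m₀ sp)).bind fun c => (C sp).run [c]) true).toReal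
        - (((E.fresh sp (m₁ sp)).bind fun c => (C sp).run [c]) true).toReal|

/-! ### Data structures with erasable memory and persistent storage -/

/-- One observable access to persistent storage.  What a read returns is known to an observer from
the last write to the same location. -/
inductive Access where
  | read (loc : ℕ)
  | write (loc : ℕ) (content : List Bool)

/-- A data structure.  `sp` is the security parameter and `n` the maximum number of items. -/
structure DataStructure where
  /-- the operations, with their operands -/
  Op : Type
  /-- the abstract contents: the finite set of stored items -/
  Data : Type
  empty : Data
  size : Data → ℕ
  /-- effect of an operation on the contents; `none` if the operation is not applicable -/
  effect : Data → Op → Option Data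
  /-- joint contents of erasable memory and persistent storage -/
  State : ℕ → ℕ → Type
  start : ∀ sp n, PMF (State sp n × List Access)
  exec : ∀ {sp n}, State sp n → Op → PMF (State sp n × List Access)
  /-- the contents of the erasable memory, written as a sequence of bit strings -/
  em : ∀ {sp n}, State sp n → List (List Bool)

namespace DataStructure

/-- Contents after a sequence of operations, `none` if one of them is not applicable. -/
def contents (D : DataStructure) (ops : List D.Op) : Option D.Data :=
  ops.foldlM D.effect D.empty

/-- Execute a sequence of operations and return the access pattern of each of them. -/
def execAll (D : DataStructure) {sp n : ℕ} :
    List D.Op → D.State sp n → PMF (D.State sp n × List (List Access))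
  | [], s => PMF.pure (s, [])
  | o :: os, s => do
      let (s₁, acc) ← D.exec s o
      let (s₂, accs) ← D.execAll os s₁
      return (s₂, acc :: accs)

end DataStructure

def Access.strings : Access → List (List Bool)
  | .read l => [false :: l.bits, []]
  | .write l c => [true :: l.bits, c]

/-- The access patterns of a sequence of operations, written as a sequence of bit strings. -/
def accessStrings (accs : List (List Access)) : List (List Bool) :=
  accs.length.bits :: accs.flatMap fun acc => acc.length.bits :: acc.flatMap Access.strings

/-- The adversary `(𝒜₁, 𝒜₂)`: `chooser` maps the security parameter and the access pattern of the
initialization to two sequences of operations and a state, `guesser` returns a bit. -/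
structure Adversary (D : DataStructure) where
  chooser : ℕ → List Access → PMF (List D.Op × List D.Op × List Bool)
  guesser : ℕ → Circuit

namespace Adversary

variable {D : DataStructure}

/-- `o` is an output of the chooser that occurs with positive probability. -/
def Outputs (A : Adversary D) (n : ℕ → ℕ) (sp : ℕ)
    (o : List D.Op × List D.Op × List Bool) : Prop :=
  ∃ x ∈ (D.start sp (n sp)).support, o ∈ (A.chooser sp x.2).support

/-- The guesser is a polynomial-size family of probabilistic circuits and the chooser outputs
polynomially many operations.  The chooser is not restricted otherwise. -/
def Efficient (A : Adversary D) (n : ℕ → ℕ) : Prop :=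
  PolyBounded (fun sp => (A.guesser sp).length) ∧
  ∃ q : ℕ → ℕ, PolyBounded q ∧
    ∀ sp o, A.Outputs n sp o → o.1.length ≤ q sp ∧ o.2.1.length ≤ q sp

/-- `ℓ`-admissibility: the two sequences have the same number of operations, they result in the
same contents with at most `n` items, and their last `ℓ` operations are identical. -/
def Admissible (A : Adversary D) (n ℓ : ℕ → ℕ) : Prop :=
  ∀ sp o, A.Outputs n sp o →
    o.1.length = o.2.1.length ∧
    (∃ d, D.contents o.1 = some d ∧ D.contents o.2.1 = some d ∧ D.size d ≤ n sp) ∧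
    o.1.drop (o.1.length - ℓ sp) = o.2.1.drop (o.2.1.length - ℓ sp)

/-- The experiment with challenge bit `b` in which the guesser sees the chooser's state, the access
patterns of all the operations and, at the end, the erasable memory. -/
def experiment (A : Adversary D) (sp n : ℕ) (b : Bool) : PMF Bool := do
  let (s₀, acc₀) ← D.start sp n
  let (ops₀, ops₁, st) ← A.chooser sp acc₀
  let (s, accs) ← D.execAll (if b then ops₁ else ops₀) s₀
  (A.guesser sp).run (st :: (accessStrings accs ++ D.em s))

def advantage (A : Adversary D) (sp n : ℕ) : ℝ :=
  |(A.experiment sp n false true).toReal - (A.experiment sp n true true).toReal|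

end Adversary

/-- History independence with leakage of `ℓ sp n` operations. -/
def HistoryIndependent (D : DataStructure) (ℓ : ℕ → ℕ → ℕ) : Prop :=
  ∀ n : ℕ → ℕ, PolyBounded n → (∀ sp, 1 ≤ n sp) →
    ∀ A : Adversary D, A.Efficient n → A.Admissible n (fun sp => ℓ sp (n sp)) →
      Negligible fun sp => A.advantage sp (n sp)

/-! ### The vORAM -/

namespace VORAM

/-- A finite set of (possibly partial) blocks: identifier `↦` bits of the block. -/
abbrev Blocks := Std.ExtTreeMap ℕ (List Bool)

/-- Parameters, as functions of the security parameter `sp` and the maximum number `n` of items. -/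
structure Params where
  /-- bucket size in bits -/
  Z : ℕ → ℕ → ℕ
  /-- block collision parameter -/
  γ : ℕ → ℕ
  /-- how the "arbitrary" element of a nonempty set of partial blocks is chosen -/
  pick : Blocks → ℕ
  pick_mem : ∀ W : Blocks, W ≠ ∅ → pick W ∈ W

/-- Height of the tree: its `2 ^ height n` leaves are at least `n`. -/
def height (n : ℕ) : ℕ := Nat.clog 2 n

/-- Number of random bits of an identifier; with the leading 1 it has one bit more. -/
def idBits (P : Params) (sp n : ℕ) : ℕ := 2 * height n + P.γ sp

/-- Number of bits of the length field of a partial block. -/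
def lenBits (P : Params) (sp n : ℕ) : ℕ := (P.Z sp n).size

/-- Identifier and length field. -/
def overhead (P : Params) (sp n : ℕ) : ℕ := idBits P sp n + 1 + lenBits P sp n

/-- `idgen`: a leading 1 followed by uniformly random bits. -/
def idgen (P : Params) (sp n : ℕ) : PMF ℕ :=
  (PMF.uniformOfFintype (Fin (2 ^ idBits P sp n))).map fun r => 2 ^ idBits P sp n + r.val

/-- `loc(id, t)`: the number formed by the `t + 1` most significant bits of `id`.  The root is node
1, and node `v` has the children `2 v` and `2 v + 1`. -/
def loc (P : Params) (sp n id t : ℕ) : ℕ := id / 2 ^ (idBits P sp n - t)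

/-- Big-endian binary notation with `w` digits. -/
def toBits (w x : ℕ) : List Bool := ((List.range w).map x.testBit).reverse

def ofBits (l : List Bool) : ℕ := l.foldl (fun x b => 2 * x + b.toNat) 0

/-- Plaintext of a bucket: the keys of its two children and a sequence of partial blocks. -/
structure Bucket (sp : ℕ) where
  left : Key sp
  right : Key sp
  blocks : List (ℕ × List Bool)

/-- The bits of a bucket: header, then identifier, length and data of each partial block, then
zeros up to the bucket size. -/
def Bucket.bits {sp : ℕ} (P : Params) (n : ℕ) (b : Bucket sp) : List Bool :=
  let l := List.ofFn b.left ++ List.ofFn b.right ++ b.blocks.flatMap fun p =>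
    toBits (idBits P sp n + 1) p.1 ++ toBits (lenBits P sp n) p.2.length ++ p.2
  l ++ List.replicate (P.Z sp n - l.length) false

/-- Read off the partial blocks until a zero bit stands in the place of the leading 1 of an
identifier, or the data area ends; the first argument bounds the number of partial blocks. -/
def parseBlocks (idLen lenLen : ℕ) : ℕ → List Bool → List (ℕ × List Bool)
  | fuel + 1, true :: l =>
      let rest := (true :: l).drop idLen
      let len := ofBits (rest.take lenLen)
      let body := rest.drop lenLen
      (ofBits ((true :: l).take idLen), body.take len) ::
        parseBlocks idLen lenLen fuel (body.drop len)
  | _, _ => []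

/-- Recover a bucket from its bits. -/
def Bucket.parse (P : Params) (sp n : ℕ) (l : List Bool) : Bucket sp where
  left := fun i => l.getD i false
  right := fun i => l.getD (sp + i) false
  blocks := parseBlocks (idBits P sp n + 1) (lenBits P sp n) l.length (l.drop (2 * sp))

/-- State of the vORAM.  Erasable memory holds the root key, the stash, and the current identifier
of each stored block, found through the label under which the user knows the block; persistent
storage holds the encrypted bucket of each node. -/
structure State (sp n : ℕ) where
  rootKey : Key sp
  stash : Blocks
  ids : Std.ExtTreeMap ℕ ℕ
  ps : ℕ → List Bool

/-- Add a partial block to the stash, behind the part of the same block that is there already. -/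
def merge (stash : Blocks) (p : ℕ × List Bool) : Blocks :=
  stash.insert p.1 (stash.getD p.1 [] ++ p.2)

/-- Decrypt the buckets at the levels `t, t + 1, …` (`k` of them) on the path of `id`, the first of
them with `key`. -/
def openPath (E : SymEnc) (P : Params) {sp : ℕ} (n : ℕ) (ps : ℕ → List Bool) (id : ℕ) :
    (k t : ℕ) → Key sp → List (Bucket sp)
  | 0, _, _ => []
  | k + 1, t, key =>
      let b := Bucket.parse P sp n (E.dec sp key (ps (loc P sp n id t)))
      b :: openPath E P n ps id k (t + 1)
        (if loc P sp n id (t + 1) % 2 = 0 then b.left else b.right)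

/-- `evict(id)`: the decrypted buckets of the path (root first), the stash with all their partial
blocks merged into it, and the access pattern. -/
def evict (E : SymEnc) (P : Params) {sp n : ℕ} (s : State sp n) (id : ℕ) :
    List (Bucket sp) × Blocks × List Access :=
  let path := openPath E P n s.ps id (height n + 1) 0 s.rootKey
  (path, (path.flatMap Bucket.blocks).foldl merge s.stash,
    (List.range (height n + 1)).map fun t => Access.read (loc P sp n id t))

/-- Fill a bucket with `space` free bits from the set `W`.  Return the partial blocks that go into
the bucket and the new stash.  The bucket is full when no further bit of data fits into it.  Of a
block that does not fit, the end goes into the bucket and the beginning stays in the stash.  The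
first argument bounds the number of rounds. -/
def fill (pick : Blocks → ℕ) (overhead : ℕ) :
    (fuel space : ℕ) → (W stash : Blocks) → List (ℕ × List Bool) × Blocks
  | 0, _, _, stash => ([], stash)
  | fuel + 1, space, W, stash =>
      if W.isEmpty ∨ space ≤ overhead then ([], stash)
      else
        let id := pick W
        let blk := W.getD id []
        let room := space - overhead
        if blk.length ≤ room then
          let r := fill pick overhead fuel (room - blk.length) (W.erase id) (stash.erase id)
          ((id, blk) :: r.1, r.2)
        else
          ([(id, blk.drop (blk.length - room))],
            stash.insert id (blk.take (blk.length - room)))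

/-- The part of `writeback(id)` that rewrites the levels `t - 1, …, 0` (in this order).  `path` is
the list of the evicted buckets and `child` the new key of the bucket on level `t` (`none` if
`t - 1` is the leaf level). Return the new root key, stash, persistent storage and the accesses. -/
def writeLevels (E : SymEnc) (P : Params) {sp : ℕ} (n id : ℕ) (path : List (Bucket sp)) :
    (t : ℕ) → Option (Key sp) → Blocks → (ℕ → List Bool) →
      PMF (Option (Key sp) × Blocks × (ℕ → List Bool) × List Access)
  | 0, child, stash, ps => PMF.pure (child, stash, ps, [])
  | t + 1, child, stash, ps => do
      let v := loc P sp n id t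
      let W := stash.filter fun i _ => decide (loc P sp n i t = v)
      let filled := fill P.pick (overhead P sp n) W.size (P.Z sp n - 2 * sp) W stash
      let nil : Key sp := fun _ => false
      let old := path.getD t ⟨nil, nil, []⟩
      let keys : Key sp × Key sp :=
        match child with
        | none => (nil, nil)
        | some k => if loc P sp n id (t + 1) % 2 = 0 then (k, old.right) else (old.left, k)
      let key ← PMF.uniformOfFintype (Key sp)
      let c ← E.enc sp key (Bucket.bits P n ⟨keys.1, keys.2, filled.1⟩)
      let (k, st, ps', acc) ←
        writeLevels E P n id path t (some key) filled.2 (Function.update ps v c)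
      return (k, st, ps', Access.write v c :: acc)

/-- `writeback(id)`, for given evicted buckets and stash, followed by the storage of the new table
of identifiers. -/
def writeback (E : SymEnc) (P : Params) {sp n : ℕ} (s : State sp n) (id : ℕ)
    (path : List (Bucket sp)) (stash : Blocks) (ids : Std.ExtTreeMap ℕ ℕ) :
    PMF (State sp n × List Access) :=
  (writeLevels E P n id path (height n + 1) none stash s.ps).map fun r =>
    (⟨r.1.getD s.rootKey, r.2.1, ids, r.2.2.1⟩, r.2.2.2)

/-- The operations.  The user refers to a block by a label, since the identifiers are chosen at
random during the execution. -/
inductive Op where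
  | insert (label : ℕ) (blk : List Bool)
  | remove (label : ℕ)
  | update (label : ℕ) (callback : List Bool → List Bool)

/-- Effect of an operation on the stored set of labelled blocks.  A block is inserted under a label
that is not in use, and only stored blocks are removed or updated. -/
def effect (d : Blocks) : Op → Option Blocks
  | .insert l blk => if l ∈ d then none else some (d.insert l blk)
  | .remove l => if l ∈ d then some (d.erase l) else none
  | .update l f => if l ∈ d then some (d.insert l (f (d.getD l []))) else none

/-- Execution of an operation.  (Operations on a label without a block are not applicable.) -/
def exec (E : SymEnc) (P : Params) {sp n : ℕ} (s : State sp n) :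
    Op → PMF (State sp n × List Access)
  | .insert l blk => do
      let id₀ ← idgen P sp n
      let (path, stash, acc) := evict E P s id₀
      let id ← idgen P sp n
      let (s', acc') ← writeback E P s id₀ path (stash.insert id blk) (s.ids.insert l id)
      return (s', acc ++ acc')
  | .remove l =>
      match s.ids[l]? with
      | none => return (s, [])
      | some id => do
          let (path, stash, acc) := evict E P s id
          let (s', acc') ← writeback E P s id path (stash.erase id) (s.ids.erase l)
          return (s', acc ++ acc')
  | .update l f =>
      match s.ids[l]? with
      | none => return (s, [])
      | some id => do
          let (path, stash, acc) := evict E P s id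
          let id' ← idgen P sp n
          let blk := f (stash.getD id [])
          let (s', acc') ← writeback E P s id path ((stash.erase id).insert id' blk)
            (s.ids.insert l id')
          return (s', acc ++ acc')

/-- Write the empty buckets of the listed nodes, with the given keys. -/
def writeEmpty (E : SymEnc) (P : Params) {sp : ℕ} (n : ℕ) (keys : ℕ → Key sp) :
    List ℕ → (ℕ → List Bool) → PMF ((ℕ → List Bool) × List Access)
  | [], ps => PMF.pure (ps, [])
  | v :: vs, ps => do
      let nil : Key sp := fun _ => false
      let b : Bucket sp :=
        if v < 2 ^ height n then ⟨keys (2 * v), keys (2 * v + 1), []⟩ else ⟨nil, nil, []⟩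
      let c ← E.enc sp (keys v) (b.bits P n)
      let (ps', acc) ← writeEmpty E P n keys vs (Function.update ps v c)
      return (ps', Access.write v c :: acc)

/-- Initialization: every node gets an independent uniformly random key and an empty bucket. -/
def start (E : SymEnc) (P : Params) (sp n : ℕ) : PMF (State sp n × List Access) := do
  let keys ← PMF.uniformOfFintype (Fin (2 ^ (height n + 1)) → Key sp)
  let keyOf : ℕ → Key sp := fun v =>
    if h : v < 2 ^ (height n + 1) then keys ⟨v, h⟩ else fun _ => false
  let nodes := List.range' 1 (2 ^ (height n + 1) - 1)
  let (ps, acc) ← writeEmpty E P n keyOf nodes (fun _ => [])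
  return (⟨keyOf 1, ∅, ∅, ps⟩, acc)

/-- The erasable memory as a sequence of strings.  The stash and the table of identifiers are
listed in increasing order of the identifiers and labels. -/
def emStrings {sp n : ℕ} (s : State sp n) : List (List Bool) :=
  List.ofFn s.rootKey :: s.stash.size.bits ::
    ((s.stash.toList.flatMap fun p => [p.1.bits, p.2]) ++
      (s.ids.toList.flatMap fun p => [p.1.bits, p.2.bits]))

end VORAM

/-- The vORAM with encryption scheme `E` and parameters `P`. -/
def vORAM (E : SymEnc) (P : VORAM.Params) : DataStructure where
  Op := VORAM.Op
  Data := VORAM.Blocks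
  empty := ∅
  size := fun d => d.size
  effect := VORAM.effect
  State := VORAM.State
  start := VORAM.start E P
  exec := VORAM.exec E P
  em := VORAM.emStrings

end

/-!
The leakage is `ℓ = 2 n (T + λ)`, where `T = height n`. Two admissible sequences of operations are
compared for a fixed initial state, in particular for fixed initial ciphertexts, which the
adversary knows when it chooses the operations.

*Common identifiers.* Every operation uses an identifier, whose path is rewritten, and assigns a
fresh one. Let labels that are not in use have random identifiers, too; an insertion then uses the
identifier of its label like the other operations. Replacing an entry of a random table by a fresh
random identifier makes the old entry independent of the new table (`sampleTable_swap`). Hence the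
list `xs` of the used identifiers and the final table `y` are independent and uniform, whatever
the operations are (`drawSteps_eq`, `execOps_eq`), and both executions can be run with the same
`xs` and `y`. They then touch the same paths, and the final operations that they have in common
get the same identifiers.

*Common placement.* For fixed identifiers, neither keys nor ciphertexts influence where the data
goes (`execSteps_eq`). Unless identifiers collide (`mean_not_distinct_le`), the pieces of each
block along its path, read from the root and preceded by what the stash holds of it, make up the
block (`Consistent`), so the beginning of a block is determined by the pieces further down
(`MakesUp.unique`). Call a node settled if all leaves below it have been visited by the common
final operations and the two executions agree on the blocks whose paths contain the node. By
induction the settled buckets agree in the two executions (`AgreeSettled.step`): when one is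
filled, what the settled buckets below it hold determines the candidates. By the coupon
collector's bound, `ℓ` random paths visit all of the at most `2 n` leaves except with probability
`2 ^ (-λ)` (`mean_missesLeaf_le`). In the end all nodes are settled, so the two executions have
the same final buckets, stash and table (`runPlacement_eq`, `final_eq`).

*Encryption.* It remains to replace each bucket that is overwritten later by zeros. The key of
such a bucket is stored only in earlier versions of its parent, which is rewritten whenever the
bucket is. So if overwritten buckets are replaced from the last one to the first one, the key of
the bucket at hand no longer occurs elsewhere (`playHidden_update`), and each replacement costs at
most the advantage of a circuit that has everything but one ciphertext built in
(`play_bind_close`). One negligible function bounds all these advantages, because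
indistinguishability is non-uniform (`SymEnc.Indistinguishable.uniform`). When the overwritten
buckets are hidden, the view depends on the written nodes and on the final contents alone
(`playHidden_congr`), which are the same in the two executions.
-/

open scoped ENNReal
noncomputable section

/-! ### Negligible functions -/

theorem Negligible.mono {f g : ℕ → ℝ} (hg : Negligible g) (h0 : ∀ k, 0 ≤ f k)
    (h : ∀ k, f k ≤ g k) : Negligible f :=
  Asymptotics.SuperpolynomialDecay.trans_abs_le hg fun k => by
    rw [abs_of_nonneg (h0 k), abs_of_nonneg ((h0 k).trans (h k))]
    exact h k

theorem Negligible.add {f g : ℕ → ℝ} (hf : Negligible f) (hg : Negligible g) :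
    Negligible fun k => f k + g k :=
  Asymptotics.SuperpolynomialDecay.add hf hg

theorem Negligible.polyBounded_mul {f : ℕ → ℝ} {q : ℕ → ℕ} (hf : Negligible f)
    (hq : PolyBounded q) (h0 : ∀ k, 0 ≤ f k) : Negligible fun k => q k * f k := by
  obtain ⟨p, hp⟩ := hq
  have h := Asymptotics.SuperpolynomialDecay.polynomial_mul hf (p.map (Nat.castRingHom ℝ))
  refine Negligible.mono h (fun k => mul_nonneg (Nat.cast_nonneg _) (h0 k)) fun k => ?_
  have : ((p.map (Nat.castRingHom ℝ)).eval (k : ℝ)) = ((p.eval k : ℕ) : ℝ) := by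
    simp [Polynomial.eval_map, Polynomial.eval₂_at_natCast]
  simp only [this]
  exact mul_le_mul_of_nonneg_right (by exact_mod_cast hp k) (h0 k)

theorem negligible_half_pow : Negligible fun k => (1 / 2 : ℝ) ^ k := fun m => by
  have := tendsto_pow_const_mul_const_pow_of_abs_lt_one m (r := (1 / 2 : ℝ))
    (by rw [abs_of_pos] <;> norm_num)
  simpa using this

theorem PolyBounded.mul {f g : ℕ → ℕ} (hf : PolyBounded f) (hg : PolyBounded g) :
    PolyBounded fun k => f k * g k := by
  obtain ⟨p, hp⟩ := hf
  obtain ⟨r, hr⟩ := hg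
  exact ⟨p * r, fun k => by rw [Polynomial.eval_mul]; exact Nat.mul_le_mul (hp k) (hr k)⟩

theorem PolyBounded.add {f g : ℕ → ℕ} (hf : PolyBounded f) (hg : PolyBounded g) :
    PolyBounded fun k => f k + g k := by
  obtain ⟨p, hp⟩ := hf
  obtain ⟨r, hr⟩ := hg
  exact ⟨p + r, fun k => by rw [Polynomial.eval_add]; exact Nat.add_le_add (hp k) (hr k)⟩

theorem PolyBounded.mono {f g : ℕ → ℕ} (hg : PolyBounded g) (h : ∀ k, f k ≤ g k) :
    PolyBounded f := by
  obtain ⟨p, hp⟩ := hg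
  exact ⟨p, fun k => (h k).trans (hp k)⟩

theorem polyBounded_const (c : ℕ) : PolyBounded fun _ => c := ⟨Polynomial.C c, by simp⟩

/-! ### Uniform indistinguishability -/

/-- The advantage of the circuit `C` in telling encryptions of `m₀` and `m₁` apart. -/
def SymEnc.distance (E : SymEnc) (sp : ℕ) (m₀ m₁ : List Bool) (C : Circuit) : ℝ :=
  |(((E.fresh sp m₀).bind fun c => C.run [c]) true).toReal
    - (((E.fresh sp m₁).bind fun c => C.run [c]) true).toReal|

theorem PMF.toReal_apply_le_one {α : Type*} (p : PMF α) (a : α) : (p a).toReal ≤ 1 :=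
  ENNReal.toReal_le_of_le_ofReal zero_le_one (by simpa using p.coe_le_one a)

theorem SymEnc.distance_le_one (E : SymEnc) (sp : ℕ) (m₀ m₁ : List Bool) (C : Circuit) :
    E.distance sp m₀ m₁ C ≤ 1 := by
  rw [SymEnc.distance, abs_le]
  have h1 := PMF.toReal_apply_le_one ((E.fresh sp m₀).bind fun c => C.run [c]) true
  have h2 := PMF.toReal_apply_le_one ((E.fresh sp m₁).bind fun c => C.run [c]) true
  have h3 := ENNReal.toReal_nonneg (a := ((E.fresh sp m₀).bind fun c => C.run [c]) true)
  have h4 := ENNReal.toReal_nonneg (a := ((E.fresh sp m₁).bind fun c => C.run [c]) true)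
  constructor <;> linarith

/-- Against circuits and messages of bounded size, one negligible function bounds all the
advantages: for each security parameter take nearly optimal messages and a nearly optimal circuit,
which is possible since circuits are non-uniform. -/
theorem SymEnc.Indistinguishable.uniform {E : SymEnc} (hE : E.Indistinguishable) {L S : ℕ → ℕ}
    (hL : PolyBounded L) (hS : PolyBounded S) :
    ∃ ε : ℕ → ℝ, Negligible ε ∧ (∀ sp, 0 ≤ ε sp) ∧
      ∀ sp (m₀ m₁ : List Bool) (C : Circuit), m₀.length = L sp → m₁.length = L sp →
        C.length ≤ S sp → E.distance sp m₀ m₁ C ≤ ε sp := by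
  let A : ℕ → Set ℝ := fun sp => {a | ∃ (m₀ m₁ : List Bool) (C : Circuit),
    m₀.length = L sp ∧ m₁.length = L sp ∧ C.length ≤ S sp ∧ E.distance sp m₀ m₁ C = a}
  have hbdd : ∀ sp, BddAbove (A sp) := fun sp => ⟨1, by
    rintro a ⟨m₀, m₁, C, -, -, -, rfl⟩
    exact E.distance_le_one sp m₀ m₁ C⟩
  have hne : ∀ sp, (A sp).Nonempty := fun sp =>
    ⟨_, List.replicate (L sp) false, List.replicate (L sp) false, [], by simp, by simp, by simp,
      rfl⟩
  have hex : ∀ sp, ∃ (m₀ m₁ : List Bool) (C : Circuit), m₀.length = L sp ∧ m₁.length = L sp ∧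
      C.length ≤ S sp ∧ sSup (A sp) - (1 / 2 : ℝ) ^ sp < E.distance sp m₀ m₁ C := fun sp => by
    obtain ⟨a, ⟨m₀, m₁, C, h₀, h₁, hC, rfl⟩, ha⟩ :=
      exists_lt_of_lt_csSup (hne sp) (sub_lt_self (sSup (A sp)) (by positivity : 0 < (1/2:ℝ)^sp))
    exact ⟨m₀, m₁, C, h₀, h₁, hC, ha⟩
  choose m₀ m₁ C h₀ h₁ hC hlt using hex
  have hneg := hE m₀ m₁ C (fun sp => (h₀ sp).trans (h₁ sp).symm)
    (hL.mono fun sp => (h₀ sp).le) (hS.mono hC)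
  refine ⟨fun sp => sSup (A sp), ?_, ?_, ?_⟩
  · refine Negligible.mono (hneg.add negligible_half_pow) (fun sp => ?_) fun sp => ?_
    · exact (abs_nonneg _).trans (le_csSup (hbdd sp) ⟨m₀ sp, m₁ sp, C sp, h₀ sp, h₁ sp, hC sp, rfl⟩)
    · have := hlt sp
      rw [SymEnc.distance] at this
      linarith
  · intro sp
    exact (abs_nonneg _).trans (le_csSup (hbdd sp) ⟨m₀ sp, m₁ sp, C sp, h₀ sp, h₁ sp, hC sp, rfl⟩)
  · intro sp m m' D hm hm' hD
    exact le_csSup (hbdd sp) ⟨m, m', D, hm, hm', hD, rfl⟩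

/-! ### Averages over discrete distributions -/

namespace PMF

/-- The expected value of a nonnegative function. -/
def mean {α : Type*} (p : PMF α) (f : α → ℝ≥0∞) : ℝ≥0∞ := ∑' a, p a * f a

theorem mean_bind {α β : Type*} (p : PMF α) (g : α → PMF β) (f : β → ℝ≥0∞) :
    (p.bind g).mean f = p.mean fun a => (g a).mean f := by
  simp only [mean, bind_apply, ← ENNReal.tsum_mul_right, ← ENNReal.tsum_mul_left]
  rw [ENNReal.tsum_comm]
  simp only [mul_assoc]

theorem mean_pure {α : Type*} (a : α) (f : α → ℝ≥0∞) : (pure a).mean f = f a := by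
  rw [mean, tsum_eq_single a fun b hb => by rw [pure_apply_of_ne _ _ hb, zero_mul],
    pure_apply_self, one_mul]

theorem mean_const {α : Type*} (p : PMF α) (c : ℝ≥0∞) : (p.mean fun _ => c) = c := by
  rw [mean, ENNReal.tsum_mul_right, p.tsum_coe, one_mul]

theorem mean_add {α : Type*} (p : PMF α) (f g : α → ℝ≥0∞) :
    (p.mean fun a => f a + g a) = p.mean f + p.mean g := by
  simp only [mean, mul_add, ENNReal.tsum_add]

theorem mean_mono {α : Type*} (p : PMF α) {f g : α → ℝ≥0∞} (h : ∀ a ∈ p.support, f a ≤ g a) :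
    p.mean f ≤ p.mean g :=
  ENNReal.tsum_le_tsum fun a => by
    by_cases ha : a ∈ p.support
    · exact mul_le_mul_right (h a ha) _
    · rw [(p.apply_eq_zero_iff a).2 ha, zero_mul, zero_mul]

theorem bind_true {α : Type*} (p : PMF α) (f : α → PMF Bool) :
    (p.bind f) true = p.mean fun a => f a true := rfl

theorem bind_congr {α β : Type*} (p : PMF α) {f g : α → PMF β} (h : ∀ a ∈ p.support, f a = g a) :
    p.bind f = p.bind g := by
  ext b
  simp only [bind_apply]
  refine tsum_congr fun a => ?_
  by_cases ha : a ∈ p.support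
  · rw [h a ha]
  · rw [(p.apply_eq_zero_iff a).2 ha, zero_mul, zero_mul]

/-- If the outputs are close outside of a bad event, the mixtures are close up to the probability
of the bad event. -/
theorem bind_true_le {α : Type*} (p : PMF α) {f g : α → PMF Bool} {ε : ℝ≥0∞}
    (bad : α → ℝ≥0∞)
    (h : ∀ a ∈ p.support, f a true ≤ g a true + ε + bad a) :
    (p.bind f) true ≤ (p.bind g) true + ε + p.mean bad := by
  rw [bind_true, bind_true]
  refine (p.mean_mono h).trans ?_
  rw [mean_add, mean_add, mean_const]

theorem bind_true_le' {α : Type*} (p : PMF α) {f g : α → PMF Bool} {ε : ℝ≥0∞}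
    (h : ∀ a ∈ p.support, f a true ≤ g a true + ε) :
    (p.bind f) true ≤ (p.bind g) true + ε := by
  simpa [mean_const] using p.bind_true_le (fun _ => 0) (by simpa using h)

end PMF

/-! ### Hard-wiring all but one string of the input of a circuit -/

/-- A sequence of strings in which at most one string depends on `c`, and is then `c` itself. -/
def OneSlot (x : List Bool → List (List Bool)) : Prop :=
  (∃ y, ∀ c, x c = y) ∨ ∃ pre post, ∀ c, x c = pre ++ c :: post

theorem OneSlot.append_left {x : List Bool → List (List Bool)} (hx : OneSlot x)
    (u : List (List Bool)) : OneSlot fun c => u ++ x c := by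
  obtain ⟨y, hy⟩ | ⟨pre, post, h⟩ := hx
  · exact .inl ⟨u ++ y, fun c => by simp only [hy]⟩
  · exact .inr ⟨u ++ pre, post, fun c => by simp only [h, List.append_assoc]⟩

theorem OneSlot.append_right {x : List Bool → List (List Bool)} (hx : OneSlot x)
    (u : List (List Bool)) : OneSlot fun c => x c ++ u := by
  obtain ⟨y, hy⟩ | ⟨pre, post, h⟩ := hx
  · exact .inl ⟨y ++ u, fun c => by simp only [hy]⟩
  · exact .inr ⟨pre, post ++ u, fun c => by simp only [h, List.append_assoc, List.cons_append]⟩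

theorem OneSlot.inputBit {x : List Bool → List (List Bool)} (hx : OneSlot x) (j i : ℕ) :
    (∃ b, ∀ c, inputBit (x c) j i = b) ∨ ∀ c, inputBit (x c) j i = _root_.inputBit [c] 0 i := by
  obtain ⟨y, hy⟩ | ⟨pre, post, h⟩ := hx
  · exact .inl ⟨_root_.inputBit y j i, fun c => by rw [hy]⟩
  · rcases lt_trichotomy j pre.length with hj | rfl | hj
    · exact .inl ⟨_root_.inputBit pre j i, fun c => by
        simp only [h, _root_.inputBit, List.getElem?_append_left hj]⟩
    · exact .inr fun c => by simp [h, _root_.inputBit]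
    · refine .inl ⟨_root_.inputBit (pre ++ [] :: post) j i, fun c => ?_⟩
      have hj' : j - pre.length = (j - pre.length - 1) + 1 := by omega
      simp only [h, _root_.inputBit, List.getElem?_append_right hj.le]
      rw [hj', List.getElem?_cons_succ, List.getElem?_cons_succ]

/-- Input gates that read a fixed string become constants. -/
theorem Gate.exists_value_eq {x : List Bool → List (List Bool)} (hx : OneSlot x) (g : Gate) :
    ∃ g' : Gate, ∀ c ws, g.value (x c) ws = g'.value [c] ws := by
  cases g with
  | const b => exact ⟨.const b, fun _ _ => rfl⟩
  | coin => exact ⟨.coin, fun _ _ => rfl⟩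
  | nand a b => exact ⟨.nand a b, fun _ _ => rfl⟩
  | bit j i =>
    obtain ⟨b, hb⟩ | h := hx.inputBit j i
    · exact ⟨.const (b.getD false), fun c ws => by simp only [Gate.value, hb]⟩
    · exact ⟨.bit 0 i, fun c ws => by simp only [Gate.value, h]⟩
  | present j i =>
    obtain ⟨b, hb⟩ | h := hx.inputBit j i
    · exact ⟨.const b.isSome, fun c ws => by simp only [Gate.value, hb]⟩
    · exact ⟨.present 0 i, fun c ws => by simp only [Gate.value, h]⟩

/-- The strings that do not depend on `c` can be built into the circuit at no cost, since input gates
may be replaced by constants. -/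
theorem Circuit.exists_run_eq (C : Circuit) {x : List Bool → List (List Bool)} (hx : OneSlot x) :
    ∃ C' : Circuit, C'.length = C.length ∧ ∀ c, C.run (x c) = C'.run [c] := by
  choose f hf using Gate.exists_value_eq hx
  refine ⟨C.map f, List.length_map f, fun c => ?_⟩
  simp only [Circuit.run, Circuit.wires, List.foldlM_map, hf]

namespace VORAM

/-! ### Maps from numbers -/

theorem getElem?_insert_eq {β : Type} (m : Std.ExtTreeMap ℕ β) (k a : ℕ) (v : β) :
    (m.insert k v)[a]? = if a = k then some v else m[a]? := by
  rw [Std.ExtTreeMap.getElem?_insert]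
  exact if_congr (by rw [Std.LawfulEqCmp.compare_eq_iff_eq, eq_comm]) rfl rfl

theorem getElem?_erase_eq {β : Type} (m : Std.ExtTreeMap ℕ β) (k a : ℕ) :
    (m.erase k)[a]? = if a = k then none else m[a]? := by
  rw [Std.ExtTreeMap.getElem?_erase]
  exact if_congr (by rw [Std.LawfulEqCmp.compare_eq_iff_eq, eq_comm]) rfl rfl

theorem getElem?_filter_eq (m : Blocks) (f : ℕ → List Bool → Bool) (a : ℕ) :
    (m.filter f)[a]? = m[a]?.filter (f a) := by
  simp

theorem mem_iff_getElem? {β : Type} (m : Std.ExtTreeMap ℕ β) (a : ℕ) :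
    a ∈ m ↔ ∃ v, m[a]? = some v := by
  rw [Std.ExtTreeMap.mem_iff_isSome_getElem?, Option.isSome_iff_exists]

/-! ### Binary encoding of buckets -/

theorem length_toBits (w x : ℕ) : (toBits w x).length = w := by simp [toBits]

theorem toBits_succ (w x : ℕ) : toBits (w + 1) x = x.testBit w :: toBits w x := by
  simp [toBits, List.range_succ]

theorem ofBits_cons (b : Bool) (l : List Bool) :
    ofBits (b :: l) = b.toNat * 2 ^ l.length + ofBits l := by
  have key : ∀ (l : List Bool) (a : ℕ),
      l.foldl (fun x b => 2 * x + b.toNat) a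
        = a * 2 ^ l.length + l.foldl (fun x b => 2 * x + b.toNat) 0 := by
    intro l
    induction l with
    | nil => simp
    | cons c l ih =>
      intro a
      rw [List.foldl_cons, ih, List.foldl_cons, ih (2 * 0 + c.toNat), List.length_cons]
      ring
  rw [ofBits, List.foldl_cons, key]
  simp [ofBits]

theorem ofBits_toBits_mod (w x : ℕ) : ofBits (toBits w x) = x % 2 ^ w := by
  induction w with
  | zero => simp [toBits, ofBits, Nat.mod_one]
  | succ w ih =>
    rw [toBits_succ, ofBits_cons, ih, length_toBits, Nat.mod_pow_succ, Nat.toNat_testBit]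
    ring

theorem ofBits_toBits {w x : ℕ} (h : x < 2 ^ w) : ofBits (toBits w x) = x := by
  rw [ofBits_toBits_mod, Nat.mod_eq_of_lt h]

/-- The identifiers of `b` random bits behind a leading 1. -/
def IsId (b id : ℕ) : Prop := 2 ^ b ≤ id ∧ id < 2 ^ (b + 1)

theorem IsId.testBit {b id : ℕ} (h : IsId b id) : id.testBit b = true := by
  rw [Nat.testBit_eq_decide_div_mod_eq]
  have h1 : id / 2 ^ b = 1 := by
    refine Nat.div_eq_of_lt_le (by simpa using h.1) ?_
    have := h.2
    rw [pow_succ] at this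
    omega
  simp [h1]

/-- The bits of a sequence of partial blocks. -/
def blockBits (idLen lenLen : ℕ) (l : List (ℕ × List Bool)) : List Bool :=
  l.flatMap fun p => toBits idLen p.1 ++ toBits lenLen p.2.length ++ p.2

theorem length_blockBits (idLen lenLen : ℕ) (l : List (ℕ × List Bool)) :
    (blockBits idLen lenLen l).length = (l.map fun p => idLen + lenLen + p.2.length).sum := by
  simp [blockBits, List.length_flatMap, length_toBits]
  ring

/-- Parsing stops at the padding, because identifiers begin with the bit 1. -/
theorem parseBlocks_blockBits (b lenLen : ℕ) (l : List (ℕ × List Bool)) (z fuel : ℕ)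
    (hid : ∀ p ∈ l, IsId b p.1) (hlen : ∀ p ∈ l, p.2.length < 2 ^ lenLen)
    (hfuel : l.length ≤ fuel) :
    parseBlocks (b + 1) lenLen fuel (blockBits (b + 1) lenLen l ++ List.replicate z false) = l := by
  induction l generalizing fuel with
  | nil =>
    cases fuel <;> cases z <;> simp [parseBlocks, blockBits, List.replicate_succ]
  | cons p l ih =>
    obtain ⟨fuel, rfl⟩ : ∃ k, fuel = k + 1 := ⟨fuel - 1, by simp at hfuel; omega⟩
    have hp := hid p (by simp)
    set r := blockBits (b + 1) lenLen l ++ List.replicate z false with hr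
    have e : blockBits (b + 1) lenLen (p :: l) ++ List.replicate z false
        = toBits (b + 1) p.1 ++ (toBits lenLen p.2.length ++ (p.2 ++ r)) := by
      simp [blockBits, hr]
    have e' : toBits (b + 1) p.1 = true :: toBits b p.1 := by rw [toBits_succ, hp.testBit]
    rw [e, e', List.cons_append, parseBlocks, ← List.cons_append, ← e']
    have d1 : (toBits (b + 1) p.1 ++ (toBits lenLen p.2.length ++ (p.2 ++ r))).drop (b + 1)
        = toBits lenLen p.2.length ++ (p.2 ++ r) := List.drop_left' (length_toBits _ _)
    have t1 : (toBits (b + 1) p.1 ++ (toBits lenLen p.2.length ++ (p.2 ++ r))).take (b + 1)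
        = toBits (b + 1) p.1 := List.take_left' (length_toBits _ _)
    have d2 : (toBits lenLen p.2.length ++ (p.2 ++ r)).drop lenLen = p.2 ++ r :=
      List.drop_left' (length_toBits _ _)
    have t2 : (toBits lenLen p.2.length ++ (p.2 ++ r)).take lenLen = toBits lenLen p.2.length :=
      List.take_left' (length_toBits _ _)
    simp only [d1, t1, d2, t2, ofBits_toBits hp.2, ofBits_toBits (hlen p (by simp)),
      List.take_left, List.drop_left]
    rw [hr, ih fuel (fun q hq => hid q (by simp [hq])) (fun q hq => hlen q (by simp [hq]))
      (by simpa using hfuel)]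

variable (P : Params) (sp n : ℕ)

/-- The blocks of a bucket have proper identifiers and fit into the data area of a bucket. -/
def Fits (l : List (ℕ × List Bool)) : Prop :=
  (∀ p ∈ l, IsId (idBits P sp n) p.1) ∧
    (l.map fun p => overhead P sp n + p.2.length).sum ≤ P.Z sp n - 2 * sp

theorem fits_nil : Fits P sp n [] := ⟨by simp, by simp⟩

variable {P sp n}

theorem length_bits {b : Bucket sp} (hZ : 2 * sp ≤ P.Z sp n) (hb : Fits P sp n b.blocks) :
    (b.bits P n).length = P.Z sp n := by
  have h1 := length_blockBits (idBits P sp n + 1) (lenBits P sp n) b.blocks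
  have h2 := hb.2
  simp only [overhead] at h2
  rw [blockBits] at h1
  simp only [Bucket.bits, List.length_append, List.length_replicate, List.length_ofFn, h1]
  omega

theorem parse_bits {b : Bucket sp} (hZ : 2 * sp ≤ P.Z sp n) (hb : Fits P sp n b.blocks) :
    Bucket.parse P sp n (b.bits P n) = b := by
  have hl := length_bits hZ hb
  obtain ⟨left, right, blocks⟩ := b
  have e : ∃ z, Bucket.bits P n ⟨left, right, blocks⟩ = List.ofFn left ++ (List.ofFn right ++
      (blockBits (idBits P sp n + 1) (lenBits P sp n) blocks ++ List.replicate z false)) := by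
    simp only [Bucket.bits, blockBits, List.append_assoc]
    exact ⟨_, rfl⟩
  obtain ⟨z, hz⟩ := e
  have hsum := length_blockBits (idBits P sp n + 1) (lenBits P sp n) blocks
  have hlen : ∀ p ∈ blocks, p.2.length ≤ P.Z sp n := by
    intro p hp
    have h1 := List.single_le_sum (l := blocks.map fun p => overhead P sp n + p.2.length)
      (by simp) _ (List.mem_map_of_mem hp)
    have := hb.2
    simp only at this h1
    omega
  have hcount : blocks.length ≤ P.Z sp n := by
    have h1 : blocks.length ≤ (blocks.map fun p => overhead P sp n + p.2.length).sum := by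
      rw [← List.length_map (fun p : ℕ × List Bool => overhead P sp n + p.2.length)]
      refine List.length_le_sum_of_one_le _ ?_
      simp only [List.mem_map, overhead]
      rintro _ ⟨p, -, rfl⟩
      omega
    have := hb.2
    simp only at this
    omega
  rw [Bucket.parse, Bucket.mk.injEq]
  refine ⟨?_, ?_, ?_⟩
  · funext i
    rw [hz, List.getD_append _ _ _ _ (by simp)]
    simp [List.getD_eq_getElem?_getD]
  · funext i
    rw [hz, List.getD_append_right _ _ _ _ (by simp), List.getD_append _ _ _ _ (by simp)]
    simp [List.getD_eq_getElem?_getD]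
  · rw [hl, hz, ← List.append_assoc, List.drop_left' (by simp; ring)]
    refine parseBlocks_blockBits _ _ _ _ _ hb.1 (fun p hp => ?_) hcount
    exact (hlen p hp).trans_lt (Nat.lt_size_self _)

/-! ### Filling a bucket -/

/-- The pieces of the block `id` in a bucket. -/
def pieces (id : ℕ) (l : List (ℕ × List Bool)) : List (List Bool) :=
  l.filterMap fun p => if p.1 = id then some p.2 else none

theorem pieces_append (id : ℕ) (l l' : List (ℕ × List Bool)) :
    pieces id (l ++ l') = pieces id l ++ pieces id l' := List.filterMap_append

theorem pieces_flatMap {α : Type} (id : ℕ) (l : List α) (f : α → List (ℕ × List Bool)) :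
    pieces id (l.flatMap f) = l.flatMap fun a => pieces id (f a) := by
  induction l with
  | nil => rfl
  | cons a l ih => rw [List.flatMap_cons, List.flatMap_cons, pieces_append, ih]

theorem pieces_ne_nil {id : ℕ} {l : List (ℕ × List Bool)} (h : pieces id l ≠ []) :
    ∃ p ∈ l, p.1 = id := by
  obtain ⟨b, hb⟩ := List.exists_mem_of_ne_nil _ h
  simp only [pieces, List.mem_filterMap] at hb
  obtain ⟨p, hp, h⟩ := hb
  exact ⟨p, hp, by by_contra hne; simp [hne] at h⟩

/-- How filling a bucket divides what the stash holds of a block, `o`, into the new stash entry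
`o'` and the pieces `l` in the bucket: nothing moves, or all of it, or the end of it, both parts
being nonempty in the last case. -/
def Splits (o o' : Option (List Bool)) (l : List (List Bool)) : Prop :=
  (o' = o ∧ l = []) ∨ (∃ b, o = some b ∧ o' = none ∧ l = [b]) ∨
    ∃ a b, o = some (a ++ b) ∧ o' = some a ∧ l = [b] ∧ a ≠ [] ∧ b ≠ []

/-- What `fill` does to each block, which blocks it considers, and that the bucket does not
overflow. The candidates `W` are a part of the stash. -/
theorem fill_spec {pick : Blocks → ℕ} (hpick : ∀ W : Blocks, W ≠ ∅ → pick W ∈ W) (ov : ℕ)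
    (fuel space : ℕ) (W stash : Blocks) (hW : ∀ id ∈ W, stash[id]? = W[id]?) :
    (∀ id, Splits stash[id]? (fill pick ov fuel space W stash).2[id]?
      (pieces id (fill pick ov fuel space W stash).1)) ∧
    (∀ p ∈ (fill pick ov fuel space W stash).1, p.1 ∈ W) ∧
    ((fill pick ov fuel space W stash).1.map fun p => ov + p.2.length).sum ≤ space := by
  induction fuel generalizing space W stash with
  | zero => exact ⟨fun id => .inl ⟨rfl, rfl⟩, by simp [fill], by simp [fill]⟩
  | succ fuel ih =>
    by_cases hfull : W.isEmpty = true ∨ space ≤ ov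
    · rw [fill, if_pos hfull]
      exact ⟨fun id => .inl ⟨rfl, rfl⟩, by simp, by simp⟩
    rw [fill, if_neg hfull]
    obtain ⟨hne, hsp⟩ := not_or.1 hfull
    have hid : pick W ∈ W := hpick W fun h => hne (by rw [h]; simp)
    obtain ⟨blk, hblk⟩ := (mem_iff_getElem? _ _).1 hid
    have hst := (hW _ hid).trans hblk
    simp only [Std.ExtTreeMap.getD_eq_getD_getElem?, hblk, Option.getD_some]
    generalize pick W = i at *
    split_ifs with hfit
    · have hW' : ∀ id ∈ W.erase i, (stash.erase i)[id]? = (W.erase i)[id]? := by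
        intro id h
        obtain ⟨v, hv⟩ := (mem_iff_getElem? _ _).1 h
        rw [getElem?_erase_eq] at hv
        split_ifs at hv with hi
        rw [getElem?_erase_eq, getElem?_erase_eq, if_neg hi, if_neg hi]
        exact hW id ((mem_iff_getElem? _ _).2 ⟨v, hv⟩)
      obtain ⟨h1, h2, h3⟩ := ih (space - ov - blk.length) (W.erase i) (stash.erase i) hW'
      refine ⟨fun id => ?_, fun p hp => ?_, ?_⟩
      · have h := h1 id
        by_cases hi : id = i
        · subst hi
          rw [getElem?_erase_eq, if_pos rfl] at h
          obtain ⟨h, h'⟩ | ⟨b, h, -⟩ | ⟨a, b, h, -⟩ := h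
          · refine .inr (.inl ⟨blk, hst, h, ?_⟩)
            simpa [pieces] using h'
          · simp at h
          · simp at h
        · rw [getElem?_erase_eq, if_neg hi] at h
          simpa [pieces, Ne.symm hi] using h
      · obtain rfl | hp := List.mem_cons.1 hp
        · exact hid
        · obtain ⟨v, hv⟩ := (mem_iff_getElem? _ _).1 (h2 p hp)
          rw [getElem?_erase_eq] at hv
          split_ifs at hv
          exact (mem_iff_getElem? _ _).2 ⟨v, hv⟩
      · simp only [List.map_cons, List.sum_cons]
        omega
    · refine ⟨fun id => ?_, ?_, ?_⟩
      · by_cases hi : id = i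
        · subst hi
          refine .inr (.inr ⟨blk.take (blk.length - (space - ov)),
            blk.drop (blk.length - (space - ov)), by rw [List.take_append_drop, hst],
            by rw [getElem?_insert_eq, if_pos rfl], by simp [pieces], ?_, ?_⟩)
          · intro h
            have := congrArg List.length h
            simp at this
            omega
          · intro h
            have := congrArg List.length h
            simp at this
            omega
        · rw [getElem?_insert_eq, if_neg hi]
          exact .inl ⟨rfl, by simp [pieces, Ne.symm hi]⟩
      · simpa using hid
      · simp
        omega

end VORAM

namespace VORAM

variable {sp : ℕ} (E : SymEnc) (P : Params) (n : ℕ)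

/-! ### Sequences of encrypted writes -/

/-- A write of a bucket: the node and the partial blocks. -/
abbrev Write := ℕ × List (ℕ × List Bool)

/-- Perform writes with fresh keys, the keys of the children being taken from the current table of
keys.  Returns the ciphertexts and the new table of keys. -/
def play : List Write → (ℕ → Key sp) → PMF (List (List Bool) × (ℕ → Key sp))
  | [], K => PMF.pure ([], K)
  | w :: ws, K =>
      (PMF.uniformOfFintype (Key sp)).bind fun key =>
        (E.enc sp key (Bucket.bits P n ⟨K (2 * w.1), K (2 * w.1 + 1), w.2⟩)).bind fun c =>
          (play ws (Function.update K w.1 key)).map fun r => (c :: r.1, r.2)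

/-- Like `play`, except that the buckets that are overwritten later are replaced by zeros. -/
def playHidden : List Write → (ℕ → Key sp) → PMF (List (List Bool) × (ℕ → Key sp))
  | [], K => PMF.pure ([], K)
  | w :: ws, K =>
      (PMF.uniformOfFintype (Key sp)).bind fun key =>
        (E.enc sp key (if w.1 ∈ ws.map Prod.fst then List.replicate (P.Z sp n) false
          else Bucket.bits P n ⟨K (2 * w.1), K (2 * w.1 + 1), w.2⟩)).bind fun c =>
          (playHidden ws (Function.update K w.1 key)).map fun r => (c :: r.1, r.2)

/-- Each write to a node other than the root is followed by a write to its parent. -/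
def Upward : List ℕ → Prop
  | [] => True
  | v :: vs => 1 ≤ v ∧ (v = 1 ∨ v / 2 ∈ vs) ∧ Upward vs

theorem Upward.mem_half {vs : List ℕ} (h : Upward vs) {v : ℕ} (hv : v ∈ vs) (h1 : v ≠ 1) :
    v / 2 ∈ vs := by
  induction vs with
  | nil => simp at hv
  | cons u vs ih =>
    obtain rfl | hv := List.mem_cons.1 hv
    · exact List.mem_cons_of_mem _ (h.2.1.resolve_left h1)
    · exact List.mem_cons_of_mem _ (ih h.2.2 hv)

theorem Upward.append {vs vs' : List ℕ} (h : Upward vs) (h' : Upward vs') :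
    Upward (vs ++ vs') := by
  induction vs with
  | nil => exact h'
  | cons u vs ih =>
    exact ⟨h.1, h.2.1.imp_right fun h => List.mem_append_left _ h, ih h.2.2⟩

variable {E P n}

/-- The key of a bucket that is overwritten later plays no role for the other ciphertexts, once the
overwritten buckets are replaced by zeros: it occurs only in earlier versions of the parent. -/
theorem playHidden_update {ws : List Write} (hup : Upward (ws.map Prod.fst)) {v : ℕ}
    (hv : v ∈ ws.map Prod.fst) (K : ℕ → Key sp) (k : Key sp) :
    playHidden E P n ws (Function.update K v k) = playHidden E P n ws K := by
  induction ws generalizing K with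
  | nil => simp at hv
  | cons w ws ih =>
    obtain ⟨u, bl⟩ := w
    obtain ⟨hu1, -, hup'⟩ := hup
    have hmsg : (if u ∈ ws.map Prod.fst then List.replicate (P.Z sp n) false
        else Bucket.bits P n ⟨Function.update K v k (2 * u), Function.update K v k (2 * u + 1), bl⟩)
        = if u ∈ ws.map Prod.fst then List.replicate (P.Z sp n) false
          else Bucket.bits P n ⟨K (2 * u), K (2 * u + 1), bl⟩ := by
      split_ifs with hlive
      · rfl
      have hne : v / 2 ≠ u ∨ v = u := by
        by_cases hvu : v = u
        · exact .inr hvu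
        refine .inl fun h => hlive ?_
        have hv' : v ∈ ws.map Prod.fst := by
          simpa [hvu] using hv
        rw [← h]
        refine hup'.mem_half hv' ?_
        rintro rfl
        omega
      simp only at hu1
      rw [Function.update_of_ne (by omega), Function.update_of_ne (by omega)]
    have hrest : ∀ key, playHidden E P n ws (Function.update (Function.update K v k) u key)
        = playHidden E P n ws (Function.update K u key) := fun key => by
      by_cases hvu : v = u
      · rw [hvu, Function.update_idem]
      · rw [Function.update_comm (Ne.symm (Ne.symm hvu))]
        exact ih hup' (by simpa [hvu] using hv) _
    simp only [playHidden, hmsg, hrest]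

/-- Hiding the overwritten buckets costs at most the distinguishing advantage per write.  The
buckets are replaced from the last one to the first one. -/
theorem play_bind_close {ε : ℝ≥0∞} {S : ℕ} (hZ : 2 * sp ≤ P.Z sp n)
    (hε : ∀ (m₀ m₁ : List Bool) (C : Circuit), m₀.length = P.Z sp n → m₁.length = P.Z sp n →
      C.length ≤ S → ((E.fresh sp m₀).bind fun c => C.run [c]) true
        ≤ ((E.fresh sp m₁).bind fun c => C.run [c]) true + ε)
    (ws : List Write) (hup : Upward (ws.map Prod.fst)) (hfit : ∀ w ∈ ws, Fits P sp n w.2)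
    (K : ℕ → Key sp) (D : List (List Bool) × (ℕ → Key sp) → PMF Bool)
    (hD : ∀ pre post K', ∃ C : Circuit, C.length ≤ S ∧
      ∀ c, D (pre ++ c :: post, K') = C.run [c]) :
    ((play E P n ws K).bind D) true ≤ ((playHidden E P n ws K).bind D) true + ws.length * ε ∧
    ((playHidden E P n ws K).bind D) true ≤ ((play E P n ws K).bind D) true + ws.length * ε := by
  induction ws generalizing K D with
  | nil => simp [play, playHidden]
  | cons w ws ih =>
    have hup' := hup.2.2
    have ih' := fun K c => ih hup' (fun w hw => hfit w (List.mem_cons_of_mem _ hw)) K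
      (fun r => D (c :: r.1, r.2)) fun pre post K' => hD (c :: pre) post K'
    set m := Bucket.bits P n ⟨K (2 * w.1), K (2 * w.1 + 1), w.2⟩ with hm
    have hmlen : m.length = P.Z sp n := length_bits hZ (hfit w (by simp))
    -- the intermediate game, in which only the first bucket is not yet hidden
    let mid : List Bool → PMF Bool := fun m => (PMF.uniformOfFintype (Key sp)).bind fun key =>
      (E.enc sp key m).bind fun c =>
        (playHidden E P n ws (Function.update K w.1 key)).bind fun r => D (c :: r.1, r.2)
    have e1 : (play E P n (w :: ws) K).bind D = (PMF.uniformOfFintype (Key sp)).bind fun key =>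
        (E.enc sp key m).bind fun c =>
          (play E P n ws (Function.update K w.1 key)).bind fun r => D (c :: r.1, r.2) := by
      simp only [play, PMF.bind_bind, PMF.bind_map, Function.comp_def, hm]
    have e2 : (playHidden E P n (w :: ws) K).bind D
        = mid (if w.1 ∈ ws.map Prod.fst then List.replicate (P.Z sp n) false else m) := by
      simp only [playHidden, PMF.bind_bind, PMF.bind_map, Function.comp_def, hm, mid]
    have step1 : ((play E P n (w :: ws) K).bind D) true ≤ mid m true + ws.length * ε := by
      rw [e1]
      exact PMF.bind_true_le' _ fun key _ => PMF.bind_true_le' _ fun c _ => (ih' _ c).1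
    have step2 : mid m true ≤ ((play E P n (w :: ws) K).bind D) true + ws.length * ε := by
      rw [e1]
      exact PMF.bind_true_le' _ fun key _ => PMF.bind_true_le' _ fun c _ => (ih' _ c).2
    have hlen : (((w :: ws).length : ℕ) : ℝ≥0∞) * ε = ws.length * ε + ε := by
      rw [List.length_cons]
      push_cast
      ring
    rw [hlen, e2]
    split_ifs with hdead
    · have emid : ∀ m, mid m = (playHidden E P n ws K).bind fun r =>
          (E.fresh sp m).bind fun c => D (c :: r.1, r.2) := fun m => by
        simp only [mid, playHidden_update hup' hdead, SymEnc.fresh, PMF.bind_bind]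
        rw [PMF.bind_comm (playHidden E P n ws K)]
        congr 1
        funext key
        rw [PMF.bind_comm]
      have step3 : ∀ m m' : List Bool, m.length = P.Z sp n → m'.length = P.Z sp n →
          mid m true ≤ mid m' true + ε := fun m m' h h' => by
        rw [emid, emid]
        refine PMF.bind_true_le' _ fun r _ => ?_
        obtain ⟨C, hC, hr⟩ := hD [] r.1 r.2
        simp only [List.nil_append] at hr
        simp only [hr]
        exact hε m m' C h h' hC
      constructor
      · calc _ ≤ mid m true + ws.length * ε := step1
          _ ≤ (mid (List.replicate (P.Z sp n) false) true + ε) + ws.length * ε := by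
            gcongr
            exact step3 _ _ hmlen (by simp)
          _ = _ := by rw [add_assoc, add_comm ε]
      · calc _ ≤ mid m true + ε := step3 _ _ (by simp) hmlen
          _ ≤ _ := by
            rw [← add_assoc]
            gcongr
    · exact ⟨step1.trans (by rw [← add_assoc]; exact le_self_add),
        step2.trans (by rw [← add_assoc]; exact le_self_add)⟩

/-- The contents of the buckets after some writes. -/
def applyWrites (bk : ℕ → List (ℕ × List Bool)) (ws : List Write) : ℕ → List (ℕ × List Bool) :=
  ws.foldl (fun bk w => Function.update bk w.1 w.2) bk

theorem applyWrites_cons (bk : ℕ → List (ℕ × List Bool)) (w : Write) (ws : List Write) :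
    applyWrites bk (w :: ws) = applyWrites (Function.update bk w.1 w.2) ws := rfl

theorem applyWrites_append (bk : ℕ → List (ℕ × List Bool)) (ws ws' : List Write) :
    applyWrites bk (ws ++ ws') = applyWrites (applyWrites bk ws) ws' := List.foldl_append

theorem applyWrites_of_notMem (bk : ℕ → List (ℕ × List Bool)) {ws : List Write} {v : ℕ}
    (hv : v ∉ ws.map Prod.fst) : applyWrites bk ws v = bk v := by
  induction ws generalizing bk with
  | nil => rfl
  | cons w ws ih =>
    simp only [List.map_cons, List.mem_cons, not_or] at hv
    rw [applyWrites_cons, ih _ hv.2, Function.update_of_ne hv.1]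

theorem applyWrites_congr {bk bk' : ℕ → List (ℕ × List Bool)} {ws : List Write}
    (h : ∀ v, v ∉ ws.map Prod.fst → bk v = bk' v) : applyWrites bk ws = applyWrites bk' ws := by
  induction ws generalizing bk bk' with
  | nil => exact funext fun v => h v (by simp)
  | cons w ws ih =>
    rw [applyWrites_cons, applyWrites_cons]
    refine ih fun v hv => ?_
    by_cases hvw : v = w.1
    · rw [hvw, Function.update_self, Function.update_self]
    · rw [Function.update_of_ne hvw, Function.update_of_ne hvw]
      exact h v (by simp only [List.map_cons, List.mem_cons, not_or]; exact ⟨hvw, hv⟩)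

/-- The game with hidden buckets depends only on the written nodes and on the final contents of the
buckets. -/
theorem playHidden_congr {ws ws' : List Write} (hv : ws.map Prod.fst = ws'.map Prod.fst)
    {bk bk' : ℕ → List (ℕ × List Bool)}
    (h : ∀ v ∈ ws.map Prod.fst, applyWrites bk ws v = applyWrites bk' ws' v) (K : ℕ → Key sp) :
    playHidden E P n ws K = playHidden E P n ws' K := by
  induction ws generalizing ws' bk bk' K with
  | nil =>
    cases ws' with
    | nil => rfl
    | cons w' ws' => simp at hv
  | cons w ws ih =>
    cases ws' with
    | nil => simp at hv
    | cons w' ws' =>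
      simp only [List.map_cons, List.cons.injEq] at hv
      have hrest := fun K => ih hv.2 (bk := Function.update bk w.1 w.2)
        (bk' := Function.update bk' w'.1 w'.2)
        (fun v hv => h v (by rw [List.map_cons]; exact List.mem_cons_of_mem _ hv)) K
      have hmsg : (if w.1 ∈ ws.map Prod.fst then List.replicate (P.Z sp n) false
          else Bucket.bits P n ⟨K (2 * w.1), K (2 * w.1 + 1), w.2⟩)
          = if w'.1 ∈ ws'.map Prod.fst then List.replicate (P.Z sp n) false
            else Bucket.bits P n ⟨K (2 * w'.1), K (2 * w'.1 + 1), w'.2⟩ := by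
        rw [← hv.2, ← hv.1]
        split_ifs with hlive
        · rfl
        · have := h w.1 (by simp)
          rw [applyWrites_cons, applyWrites_cons, applyWrites_of_notMem _ hlive,
            Function.update_self, hv.1, applyWrites_of_notMem _ (by rwa [← hv.2, ← hv.1]),
            Function.update_self] at this
          rw [this]
      simp only [playHidden, hmsg, hrest]
      rw [hv.1]

theorem play_append (ws ws' : List Write) (K : ℕ → Key sp) :
    play E P n (ws ++ ws') K = (play E P n ws K).bind fun r =>
      (play E P n ws' r.2).map fun r' => (r.1 ++ r'.1, r'.2) := by
  induction ws generalizing K with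
  | nil =>
    simp only [List.nil_append, play, PMF.pure_bind]
    exact (PMF.map_id _).symm
  | cons w ws ih =>
    simp only [List.cons_append, play, ih, PMF.bind_bind, PMF.map_bind, PMF.map_comp,
      PMF.bind_map, Function.comp_def]

theorem length_of_mem_support_play {ws : List Write} {K : ℕ → Key sp}
    {r : List (List Bool) × (ℕ → Key sp)} (hr : r ∈ (play E P n ws K).support) :
    r.1.length = ws.length := by
  induction ws generalizing K r with
  | nil =>
    simp only [play, PMF.support_pure, Set.mem_singleton_iff] at hr
    simp [hr]
  | cons w ws ih =>
    simp only [play, PMF.mem_support_bind_iff, PMF.mem_support_map_iff] at hr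
    obtain ⟨key, -, c, -, r', hr', rfl⟩ := hr
    simp [ih hr']

/-! ### What persistent storage contains -/

/-- Store ciphertexts at the given nodes. -/
def store (ps : ℕ → List Bool) (l : List (ℕ × List Bool)) : ℕ → List Bool :=
  l.foldl (fun ps p => Function.update ps p.1 p.2) ps

variable (E P n) in
/-- Outside of the nodes `vs`, the keys `K` decrypt persistent storage to buckets with the contents
`bk`, which hold the keys of their children. -/
def Decodes (ps : ℕ → List Bool) (K : ℕ → Key sp) (bk : ℕ → List (ℕ × List Bool))
    (vs : List ℕ) : Prop :=
  ∀ v, 1 ≤ v → v < 2 ^ (height n + 1) → v ∉ vs →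
    Bucket.parse P sp n (E.dec sp (K v) (ps v)) = ⟨K (2 * v), K (2 * v + 1), bk v⟩

/-- A write makes the parent outdated until the parent is written, too. -/
theorem decodes_play (hZ : 2 * sp ≤ P.Z sp n) {ws : List Write} {K : ℕ → Key sp}
    {ps : ℕ → List Bool} {bk : ℕ → List (ℕ × List Bool)}
    {r : List (List Bool) × (ℕ → Key sp)} (hr : r ∈ (play E P n ws K).support)
    (hup : Upward (ws.map Prod.fst)) (hfit : ∀ w ∈ ws, Fits P sp n w.2)
    (h : Decodes E P n ps K bk (ws.map Prod.fst)) :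
    Decodes E P n (store ps ((ws.map Prod.fst).zip r.1)) r.2 (applyWrites bk ws) [] := by
  induction ws generalizing K r ps bk with
  | nil =>
    simp only [play, PMF.support_pure, Set.mem_singleton_iff] at hr
    subst hr
    exact h
  | cons w ws ih =>
    simp only [play, PMF.mem_support_bind_iff, PMF.mem_support_map_iff] at hr
    obtain ⟨key, -, c, hc, r', hr', rfl⟩ := hr
    obtain ⟨hw1, hpar, hup'⟩ := hup
    refine ih (ps := Function.update ps w.1 c) (bk := Function.update bk w.1 w.2) hr' hup'
      (fun w hw => hfit w (List.mem_cons_of_mem _ hw)) fun v hv1 hvT hv => ?_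
    by_cases hvw : v = w.1
    · subst hvw
      rw [Function.update_self, Function.update_self, Function.update_self,
        Function.update_of_ne (by omega), Function.update_of_ne (by omega), E.correct _ _ _ _ hc,
        parse_bits hZ (hfit w (by simp))]
    · have h2 : w.1 / 2 ≠ v ∨ w.1 = 1 := by
        rcases hpar with h1 | h1
        · exact .inr h1
        · exact .inl fun e => hv (e ▸ h1)
      rw [Function.update_of_ne hvw, Function.update_of_ne hvw, Function.update_of_ne hvw,
        Function.update_of_ne (by omega), Function.update_of_ne (by omega)]
      exact h v hv1 hvT (by simp only [List.map_cons, List.mem_cons, not_or]; exact ⟨hvw, hv⟩)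

theorem play_key_of_notMem {ws : List Write} {K : ℕ → Key sp} {v : ℕ}
    {r : List (List Bool) × (ℕ → Key sp)} (hr : r ∈ (play E P n ws K).support)
    (hv : v ∉ ws.map Prod.fst) : r.2 v = K v := by
  induction ws generalizing K r with
  | nil =>
    simp only [play, PMF.support_pure, Set.mem_singleton_iff] at hr
    rw [hr]
  | cons w ws ih =>
    simp only [play, PMF.mem_support_bind_iff, PMF.mem_support_map_iff] at hr
    obtain ⟨key, -, c, -, r', hr', rfl⟩ := hr
    simp only [List.map_cons, List.mem_cons, not_or] at hv
    rw [ih hr' hv.2, Function.update_of_ne hv.1]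

end VORAM

namespace VORAM

variable {E : SymEnc} {P : Params} {sp n : ℕ}

/-! ### Nodes of the tree -/

theorem height_le_idBits (P : Params) (sp n : ℕ) : height n ≤ idBits P sp n := by
  rw [idBits]
  omega

theorem loc_succ_half {t : ℕ} (ht : t < idBits P sp n) (id : ℕ) :
    loc P sp n id (t + 1) / 2 = loc P sp n id t := by
  rw [loc, loc, Nat.div_div_eq_div_mul, ← pow_succ]
  congr 2
  omega

theorem loc_bounds {t id : ℕ} (ht : t ≤ idBits P sp n) (hid : IsId (idBits P sp n) id) :
    2 ^ t ≤ loc P sp n id t ∧ loc P sp n id t < 2 ^ (t + 1) := by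
  have e : 2 ^ t * 2 ^ (idBits P sp n - t) = 2 ^ idBits P sp n := by
    rw [← pow_add]
    congr 1
    omega
  constructor
  · rw [loc, Nat.le_div_iff_mul_le (by positivity), e]
    exact hid.1
  · rw [loc, Nat.div_lt_iff_lt_mul (by positivity), pow_succ, mul_right_comm, e, ← pow_succ]
    exact hid.2

theorem loc_zero {id : ℕ} (hid : IsId (idBits P sp n) id) : loc P sp n id 0 = 1 := by
  have := loc_bounds (Nat.zero_le _) hid
  omega

theorem loc_inj_level {t t' id id' : ℕ} (ht : t ≤ idBits P sp n) (ht' : t' ≤ idBits P sp n)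
    (hid : IsId (idBits P sp n) id) (hid' : IsId (idBits P sp n) id')
    (h : loc P sp n id t = loc P sp n id' t') : t = t' := by
  have h1 := loc_bounds ht hid
  have h2 := loc_bounds ht' hid'
  rw [h] at h1
  rcases lt_trichotomy t t' with hlt | rfl | hlt
  · have := Nat.pow_le_pow_right (n := 2) (by norm_num) (Nat.succ_le_of_lt hlt)
    omega
  · rfl
  · have := Nat.pow_le_pow_right (n := 2) (by norm_num) (Nat.succ_le_of_lt hlt)
    omega

theorem loc_div (id : ℕ) {t t' : ℕ} (h : t ≤ t') (ht' : t' ≤ idBits P sp n) :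
    loc P sp n id t' / 2 ^ (t' - t) = loc P sp n id t := by
  rw [loc, loc, Nat.div_div_eq_div_mul, ← pow_add]
  congr 2
  omega

theorem loc_eq_of_le {id id' t t' : ℕ} (h : t ≤ t') (ht' : t' ≤ idBits P sp n)
    (he : loc P sp n id t' = loc P sp n id' t') : loc P sp n id t = loc P sp n id' t := by
  rw [← loc_div id h ht', ← loc_div id' h ht', he]

variable (P sp n) in
/-- The nodes of a path from level `k - 1` up to the root. -/
def pathUp (id k : ℕ) : List ℕ := (List.range k).reverse.map fun t => loc P sp n id t

theorem pathUp_succ (id k : ℕ) : pathUp P sp n id (k + 1) = loc P sp n id k :: pathUp P sp n id k := by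
  simp [pathUp, List.range_succ]

theorem mem_pathUp {id k v : ℕ} : v ∈ pathUp P sp n id k ↔ ∃ t < k, loc P sp n id t = v := by
  simp [pathUp]

theorem length_pathUp (id k : ℕ) : (pathUp P sp n id k).length = k := by simp [pathUp]

theorem upward_pathUp {id k : ℕ} (hid : IsId (idBits P sp n) id) (hk : k ≤ height n + 1) :
    Upward (pathUp P sp n id k) := by
  have hT := height_le_idBits P sp n
  induction k with
  | zero => trivial
  | succ k ih =>
    rw [pathUp_succ]
    have hb := loc_bounds (t := k) (by omega) hid
    refine ⟨(Nat.one_le_two_pow).trans hb.1, ?_, ih (by omega)⟩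
    cases k with
    | zero => exact .inl (loc_zero hid)
    | succ k =>
      refine .inr (mem_pathUp.2 ⟨k, by omega, ?_⟩)
      rw [loc_succ_half (by omega)]

/-! ### Placement of the data -/

/-- The partial blocks in the stash and in the buckets. -/
structure Placement where
  stash : Blocks
  buckets : ℕ → List (ℕ × List Bool)

variable (P sp n) in
/-- The candidates for the bucket at level `t` of the path of `x`. -/
def candidates (x t : ℕ) (stash : Blocks) : Blocks :=
  stash.filter fun i _ => decide (loc P sp n i t = loc P sp n x t)

variable (P sp n) in
/-- The bucket contents that `writeback` chooses for the levels below `t` of a path, and the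
remaining stash. -/
def plan (x : ℕ) : ℕ → Blocks → List Write × Blocks
  | 0, stash => ([], stash)
  | t + 1, stash =>
      let W := candidates P sp n x t stash
      let f := fill P.pick (overhead P sp n) W.size (P.Z sp n - 2 * sp) W stash
      ((loc P sp n x t, f.1) :: (plan x t f.2).1, (plan x t f.2).2)

theorem getElem?_candidates (x t : ℕ) (stash : Blocks) (id : ℕ) :
    (candidates P sp n x t stash)[id]?
      = if loc P sp n id t = loc P sp n x t then stash[id]? else none := by
  rw [candidates, getElem?_filter_eq]
  split_ifs with h
  · cases stash[id]? <;> simp [h]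
  · cases stash[id]? <;> simp [h]

theorem mem_candidates {x t : ℕ} {stash : Blocks} {id : ℕ}
    (h : id ∈ candidates P sp n x t stash) :
    id ∈ stash ∧ loc P sp n id t = loc P sp n x t := by
  obtain ⟨v, hv⟩ := (mem_iff_getElem? _ _).1 h
  rw [getElem?_candidates] at hv
  split_ifs at hv with hl
  exact ⟨(mem_iff_getElem? _ _).2 ⟨v, hv⟩, hl⟩

theorem candidates_fill_spec (x t : ℕ) (stash : Blocks) (fuel space : ℕ) :
    let W := candidates P sp n x t stash
    let f := fill P.pick (overhead P sp n) fuel space W stash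
    (∀ id, Splits stash[id]? f.2[id]? (pieces id f.1)) ∧ (∀ p ∈ f.1, p.1 ∈ W) ∧
      (f.1.map fun p => overhead P sp n + p.2.length).sum ≤ space :=
  fill_spec P.pick_mem _ _ _ _ _ fun id h => by
    rw [getElem?_candidates, if_pos (mem_candidates h).2]

theorem Splits.isSome {o o' : Option (List Bool)} {l : List (List Bool)} (h : Splits o o' l)
    (h' : o'.isSome) : o.isSome := by
  obtain ⟨rfl, -⟩ | ⟨b, rfl, -⟩ | ⟨a, b, rfl, -⟩ := h
  · exact h'
  · rfl
  · rfl

theorem map_fst_plan (x t : ℕ) (stash : Blocks) :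
    (plan P sp n x t stash).1.map Prod.fst = pathUp P sp n x t := by
  induction t generalizing stash with
  | zero => rfl
  | succ t ih => simp only [plan, List.map_cons, ih, pathUp_succ]

/-- The stash holds only blocks with proper identifiers. -/
def StashOk (b : ℕ) (stash : Blocks) : Prop := ∀ id ∈ stash, IsId b id

theorem plan_ok (x t : ℕ) {stash : Blocks} (h : StashOk (idBits P sp n) stash) :
    (∀ w ∈ (plan P sp n x t stash).1, Fits P sp n w.2) ∧
      StashOk (idBits P sp n) (plan P sp n x t stash).2 := by
  induction t generalizing stash with
  | zero => exact ⟨by simp [plan], h⟩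
  | succ t ih =>
    obtain ⟨h1, h2, h3⟩ := candidates_fill_spec (P := P) (sp := sp) (n := n) x t stash
      (candidates P sp n x t stash).size (P.Z sp n - 2 * sp)
    obtain ⟨ih1, ih2⟩ := ih (stash := (fill P.pick (overhead P sp n)
      (candidates P sp n x t stash).size (P.Z sp n - 2 * sp)
      (candidates P sp n x t stash) stash).2) fun id hid => h id <| by
        rw [Std.ExtTreeMap.mem_iff_isSome_getElem?] at hid ⊢
        exact (h1 id).isSome hid
    refine ⟨fun w hw => ?_, ih2⟩
    obtain rfl | hw := List.mem_cons.1 hw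
    · exact ⟨fun p hp => h _ (mem_candidates (h2 p hp)).1, h3⟩
    · exact ih1 w hw

/-- Given the keys `K` of all nodes, `writeLevels` performs the writes of `plan`. The bucket at each
level stores the current key of the child on the path, which has just been written, and the old key
of the other child, which was read from the path. -/
theorem writeLevels_eq (x : ℕ) (hx : IsId (idBits P sp n) x) (path : List (Bucket sp)) (t : ℕ)
    (ht : t ≤ height n + 1) (child : Option (Key sp)) (stash : Blocks) (ps : ℕ → List Bool)
    (K : ℕ → Key sp) (hK : ∀ v, 2 ^ (height n + 1) ≤ v → K v = fun _ => false)
    (hchild : (t = height n + 1 ∧ child = none) ∨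
      (t ≤ height n ∧ child = some (K (loc P sp n x t))))
    (hpath : ∀ t' < t,
      (2 * loc P sp n x t' ≠ loc P sp n x t ∨ t = height n + 1 →
        (path.getD t' ⟨fun _ => false, fun _ => false, []⟩).left = K (2 * loc P sp n x t')) ∧
      (2 * loc P sp n x t' + 1 ≠ loc P sp n x t ∨ t = height n + 1 →
        (path.getD t' ⟨fun _ => false, fun _ => false, []⟩).right
          = K (2 * loc P sp n x t' + 1))) :
    writeLevels E P n x path t child stash ps
      = (play E P n (plan P sp n x t stash).1 K).map fun r =>
        (if t = 0 then child else some (r.2 1), (plan P sp n x t stash).2,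
          store ps ((pathUp P sp n x t).zip r.1),
          ((pathUp P sp n x t).zip r.1).map fun p => Access.write p.1 p.2) := by
  induction t generalizing child stash ps K with
  | zero =>
    simp [writeLevels, play, plan, pathUp, store, PMF.pure_map]
  | succ t ih =>
    have hT := height_le_idBits P sp n
    have hb := loc_bounds (t := t) (by omega) hx
    have hv : loc P sp n x t < 2 ^ (height n + 1) :=
      hb.2.trans_le (Nat.pow_le_pow_right (by norm_num) ht)
    -- a child of a node further up has not been written yet
    have hchildren : ∀ t' < t, ∀ w, w / 2 = loc P sp n x t' →
        (w ≠ loc P sp n x (t + 1) ∨ t + 1 = height n + 1) := by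
      intro t' ht' w hw
      by_cases htT : t + 1 = height n + 1
      · exact .inr htT
      refine .inl ?_
      rintro rfl
      rw [loc_succ_half (by omega)] at hw
      have := loc_inj_level (by omega) (by omega) hx hx hw
      omega
    have hrec : ∀ (key : Key sp) (stash : Blocks) (ps : ℕ → List Bool),
        writeLevels E P n x path t (some key) stash ps
          = (play E P n (plan P sp n x t stash).1
              (Function.update K (loc P sp n x t) key)).map fun r =>
            (some (r.2 1), (plan P sp n x t stash).2,
              store ps ((pathUp P sp n x t).zip r.1),
              ((pathUp P sp n x t).zip r.1).map fun p => Access.write p.1 p.2) := by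
      intro key stash ps
      rw [ih (by omega) (some key) stash ps (Function.update K (loc P sp n x t) key)]
      · cases t with
        | zero =>
          simp [play, plan, PMF.pure_map, loc_zero hx]
        | succ t => simp
      · intro v hv'
        rw [Function.update_of_ne (by omega)]
        exact hK v hv'
      · exact .inr ⟨by omega, by rw [Function.update_self]⟩
      · intro t' ht'
        have h3 := hpath t' (by omega)
        refine ⟨fun h => ?_, fun h => ?_⟩
        · rw [Function.update_of_ne (by omega)]
          exact h3.1 (hchildren t' ht' _ (by omega))
        · rw [Function.update_of_ne (by omega)]
          exact h3.2 (hchildren t' ht' _ (by omega))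
    have main : ∀ keys : Key sp × Key sp, keys = (K (2 * loc P sp n x t), K (2 * loc P sp n x t + 1)) →
        ((PMF.uniformOfFintype (Key sp)).bind fun key =>
          (E.enc sp key (Bucket.bits P n ⟨keys.1, keys.2, (fill P.pick (overhead P sp n)
            (candidates P sp n x t stash).size (P.Z sp n - 2 * sp)
            (candidates P sp n x t stash) stash).1⟩)).bind fun c =>
          (writeLevels E P n x path t (some key) (fill P.pick (overhead P sp n)
            (candidates P sp n x t stash).size (P.Z sp n - 2 * sp)
            (candidates P sp n x t stash) stash).2
            (Function.update ps (loc P sp n x t) c)).bind fun r =>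
          PMF.pure (r.1, r.2.1, r.2.2.1, Access.write (loc P sp n x t) c :: r.2.2.2))
        = (play E P n (plan P sp n x (t + 1) stash).1 K).map fun r =>
          (if t + 1 = 0 then child else some (r.2 1), (plan P sp n x (t + 1) stash).2,
            store ps ((pathUp P sp n x (t + 1)).zip r.1),
            ((pathUp P sp n x (t + 1)).zip r.1).map fun p => Access.write p.1 p.2) := by
      rintro _ rfl
      simp only [plan, play, PMF.map_bind, PMF.map_comp, hrec, pathUp_succ, PMF.bind_map]
      rfl
    rcases hchild with ⟨h1, rfl⟩ | ⟨h1, rfl⟩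
    · refine main (fun _ => false, fun _ => false) ?_
      have h2 : 2 ^ (height n + 1) ≤ 2 * loc P sp n x t := by
        rw [← h1, pow_succ]
        omega
      rw [hK _ h2, hK _ (h2.trans (Nat.le_succ _))]
    · refine main (if loc P sp n x (t + 1) % 2 = 0 then
            (_, (path.getD t ⟨fun _ => false, fun _ => false, []⟩).right)
          else ((path.getD t ⟨fun _ => false, fun _ => false, []⟩).left, _)) ?_
      have h2 := loc_succ_half (P := P) (sp := sp) (n := n) (t := t) (by omega) x
      have h3 := hpath t (by omega)
      split_ifs with hpar
      · have h4 : loc P sp n x (t + 1) = 2 * loc P sp n x t := by omega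
        rw [h3.2 (.inl (by omega)), h4]
      · have h4 : loc P sp n x (t + 1) = 2 * loc P sp n x t + 1 := by omega
        rw [h3.1 (.inl (by omega)), h4]

end VORAM

namespace VORAM

variable {E : SymEnc} {P : Params} {sp n : ℕ}

/-! ### Operations with given identifiers -/

/-- The label of the block that an operation concerns. -/
def Op.label : Op → ℕ
  | .insert l _ => l
  | .remove l => l
  | .update l _ => l

/-- An operation, an identifier of the path that it rewrites, and the new identifier that it
assigns to its label (which plays no role if the operation is a removal). -/
abbrev Step := Op × ℕ × ℕ

/-- The change that an operation makes to the stash between eviction and writeback. -/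
def changeStash (x id : ℕ) (stash : Blocks) : Op → Blocks
  | .insert _ blk => stash.insert id blk
  | .remove _ => stash.erase x
  | .update _ f => (stash.erase x).insert id (f (stash.getD x []))

/-- The change that an operation makes to the table of identifiers. -/
def changeTable (id : ℕ) (ids : Std.ExtTreeMap ℕ ℕ) : Op → Std.ExtTreeMap ℕ ℕ
  | .insert l _ => ids.insert l id
  | .remove l => ids.erase l
  | .update l _ => ids.insert l id

variable (E P) in
/-- Execution of an operation when all identifiers are given. -/
def execStep (s : State sp n) (σ : Step) : PMF (State sp n × List Access) :=
  (writeback E P s σ.2.1 (evict E P s σ.2.1).1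
    (changeStash σ.2.1 σ.2.2 (evict E P s σ.2.1).2.1 σ.1) (changeTable σ.2.2 s.ids σ.1)).map
      fun r => (r.1, (evict E P s σ.2.1).2.2 ++ r.2)

variable (E P) in
/-- Execution of a sequence of operations when all identifiers are given: the final state and the
access patterns. -/
def execSteps : List Step → State sp n → PMF (State sp n × List (List Access))
  | [], s => PMF.pure (s, [])
  | σ :: τ, s => (execStep E P s σ).bind fun r =>
      (execSteps τ r.1).map fun r' => (r'.1, r.2 :: r'.2)

variable (P sp n) in
/-- The stash after the eviction of the path of `x`. -/
def gather (x : ℕ) (pl : Placement) : Blocks :=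
  ((List.range (height n + 1)).flatMap fun t => pl.buckets (loc P sp n x t)).foldl merge pl.stash

variable (P sp n) in
/-- The writes of an operation with given identifiers, and the stash that it leaves. -/
def stepPlan (σ : Step) (pl : Placement) : List Write × Blocks :=
  plan P sp n σ.2.1 (height n + 1) (changeStash σ.2.1 σ.2.2 (gather P sp n σ.2.1 pl) σ.1)

variable (P sp n) in
/-- The placement of the data after an operation. -/
def stepPlacement (σ : Step) (pl : Placement) : Placement :=
  ⟨(stepPlan P sp n σ pl).2, applyWrites pl.buckets (stepPlan P sp n σ pl).1⟩

variable (P sp n) in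
/-- The placement of the data after a sequence of operations. -/
def runPlacement (τ : List Step) (pl : Placement) : Placement :=
  τ.foldl (fun pl σ => stepPlacement P sp n σ pl) pl

variable (P sp n) in
/-- All writes of a sequence of operations. -/
def runWrites : List Step → Placement → List Write
  | [], _ => []
  | σ :: τ, pl => (stepPlan P sp n σ pl).1 ++ runWrites τ (stepPlacement P sp n σ pl)

variable (P sp n) in
/-- The access pattern of an operation that writes the ciphertexts `cs`. -/
def stepAccess (σ : Step) (cs : List (List Bool)) : List Access :=
  (List.range (height n + 1)).map (fun t => Access.read (loc P sp n σ.2.1 t)) ++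
    ((pathUp P sp n σ.2.1 (height n + 1)).zip cs).map fun p => Access.write p.1 p.2

variable (P sp n) in
/-- The access patterns of a sequence of operations, given the list of all new ciphertexts. -/
def accesses : List Step → List (List Bool) → List (List Access)
  | [], _ => []
  | σ :: τ, cs =>
      stepAccess P sp n σ (cs.take (height n + 1)) :: accesses τ (cs.drop (height n + 1))

/-- All identifiers in the placement are proper. -/
def PlacementOk (b : ℕ) (pl : Placement) : Prop :=
  StashOk b pl.stash ∧ ∀ v, ∀ p ∈ pl.buckets v, IsId b p.1

/-- The identifiers of a sequence of operations are proper. -/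
def StepsOk (b : ℕ) (τ : List Step) : Prop := ∀ σ ∈ τ, IsId b σ.2.1 ∧ IsId b σ.2.2

theorem stashOk_insert {b id : ℕ} {blk : List Bool} {stash : Blocks} (h : StashOk b stash)
    (hid : IsId b id) : StashOk b (stash.insert id blk) := fun i hi => by
  obtain ⟨v, hv⟩ := (mem_iff_getElem? _ _).1 hi
  rw [getElem?_insert_eq] at hv
  split_ifs at hv with hii
  · exact hii ▸ hid
  · exact h i ((mem_iff_getElem? _ _).2 ⟨v, hv⟩)

theorem stashOk_erase {b id : ℕ} {stash : Blocks} (h : StashOk b stash) :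
    StashOk b (stash.erase id) := fun i hi => by
  obtain ⟨v, hv⟩ := (mem_iff_getElem? _ _).1 hi
  rw [getElem?_erase_eq] at hv
  split_ifs at hv
  exact h i ((mem_iff_getElem? _ _).2 ⟨v, hv⟩)

theorem stashOk_changeStash {b : ℕ} {stash : Blocks} (h : StashOk b stash) {x id : ℕ}
    (hid : IsId b id) (o : Op) : StashOk b (changeStash x id stash o) := by
  cases o with
  | insert l blk => exact stashOk_insert h hid
  | remove l => exact stashOk_erase h
  | update l f => exact stashOk_insert (stashOk_erase h) hid

theorem stashOk_merge {b : ℕ} (l : List (ℕ × List Bool)) {stash : Blocks} (h : StashOk b stash)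
    (hl : ∀ p ∈ l, IsId b p.1) : StashOk b (l.foldl merge stash) := by
  induction l generalizing stash with
  | nil => exact h
  | cons p l ih =>
    exact ih (stashOk_insert h (hl p (by simp))) fun q hq => hl q (by simp [hq])

theorem stashOk_gather {pl : Placement} (h : PlacementOk (idBits P sp n) pl) (x : ℕ) :
    StashOk (idBits P sp n) (gather P sp n x pl) :=
  stashOk_merge _ h.1 fun p hp => by
    obtain ⟨t, -, ht⟩ := List.mem_flatMap.1 hp
    exact h.2 _ p ht

theorem applyWrites_induction {bk : ℕ → List (ℕ × List Bool)} {ws : List Write}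
    {Q : List (ℕ × List Bool) → Prop} (h : ∀ v, Q (bk v)) (hw : ∀ w ∈ ws, Q w.2) (v : ℕ) :
    Q (applyWrites bk ws v) := by
  induction ws generalizing bk with
  | nil => exact h v
  | cons w ws ih =>
    refine ih (bk := Function.update bk w.1 w.2) (fun u => ?_) fun w' hw' => hw w' (by simp [hw'])
    by_cases hu : u = w.1
    · rw [hu, Function.update_self]
      exact hw w (by simp)
    · rw [Function.update_of_ne hu]
      exact h u

theorem stepPlan_ok {pl : Placement} (h : PlacementOk (idBits P sp n) pl) {σ : Step}
    (hσ : IsId (idBits P sp n) σ.2.2) :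
    (∀ w ∈ (stepPlan P sp n σ pl).1, Fits P sp n w.2) ∧
      PlacementOk (idBits P sp n) (stepPlacement P sp n σ pl) := by
  obtain ⟨h1, h2⟩ := plan_ok (P := P) (sp := sp) (n := n) σ.2.1 (height n + 1)
    (stashOk_changeStash (stashOk_gather h σ.2.1) (x := σ.2.1) hσ σ.1)
  exact ⟨h1, h2, applyWrites_induction (Q := fun l => ∀ p ∈ l, IsId (idBits P sp n) p.1) h.2
    fun w hw => (h1 w hw).1⟩

theorem map_fst_stepPlan (σ : Step) (pl : Placement) :
    (stepPlan P sp n σ pl).1.map Prod.fst = pathUp P sp n σ.2.1 (height n + 1) := map_fst_plan _ _ _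

theorem length_stepPlan (σ : Step) (pl : Placement) :
    (stepPlan P sp n σ pl).1.length = height n + 1 := by
  rw [← List.length_map (f := Prod.fst), map_fst_stepPlan, length_pathUp]

variable (E P) in
/-- The relation between the state and the placement of the data, `K` being the table of the current
keys of the nodes. -/
structure Represents (s : State sp n) (K : ℕ → Key sp) (pl : Placement) : Prop where
  rootKey : s.rootKey = K 1
  stash : s.stash = pl.stash
  decodes : Decodes E P n s.ps K pl.buckets []
  outside : ∀ v, 2 ^ (height n + 1) ≤ v → K v = fun _ => false

theorem openPath_eq {ps : ℕ → List Bool} {K : ℕ → Key sp} {bk : ℕ → List (ℕ × List Bool)}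
    (h : Decodes E P n ps K bk []) {x : ℕ} (hx : IsId (idBits P sp n) x) (k t : ℕ)
    (hk : t + k ≤ height n + 1) :
    openPath E P n ps x k t (K (loc P sp n x t)) = (List.range' t k).map fun t =>
      ⟨K (2 * loc P sp n x t), K (2 * loc P sp n x t + 1), bk (loc P sp n x t)⟩ := by
  induction k generalizing t with
  | zero => rfl
  | succ k ih =>
    have hT := height_le_idBits P sp n
    have hb := loc_bounds (t := t) (by omega) hx
    have hdec := h (loc P sp n x t) (Nat.one_le_two_pow.trans hb.1)
      (hb.2.trans_le (Nat.pow_le_pow_right (by norm_num) (by omega))) (by simp)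
    rw [openPath, List.range'_succ, List.map_cons]
    simp only [hdec]
    congr 1
    cases k with
    | zero => rfl
    | succ k =>
      have h2 := loc_succ_half (P := P) (sp := sp) (n := n) (t := t) (by omega) x
      rw [← ih (t + 1) (by omega)]
      congr 1
      split_ifs with hpar
      · congr 1
        omega
      · congr 1
        omega

theorem Represents.evict_eq {s : State sp n} {K : ℕ → Key sp} {pl : Placement}
    (h : Represents E P s K pl) {x : ℕ} (hx : IsId (idBits P sp n) x) :
    evict E P s x = ((List.range (height n + 1)).map fun t =>
      ⟨K (2 * loc P sp n x t), K (2 * loc P sp n x t + 1), pl.buckets (loc P sp n x t)⟩,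
      gather P sp n x pl, (List.range (height n + 1)).map fun t => Access.read (loc P sp n x t)) := by
  have e := openPath_eq h.decodes hx (height n + 1) 0 (by omega)
  rw [loc_zero hx, ← h.rootKey, ← List.range_eq_range'] at e
  simp only [evict, e, gather, List.flatMap_map, h.stash]

/-- An operation with given identifiers performs the writes that the placement of the data dictates. -/
theorem Represents.execStep_eq {s : State sp n} {K : ℕ → Key sp} {pl : Placement}
    (h : Represents E P s K pl) {σ : Step} (hx : IsId (idBits P sp n) σ.2.1) :
    execStep E P s σ = (play E P n (stepPlan P sp n σ pl).1 K).map fun r =>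
      (⟨r.2 1, (stepPlacement P sp n σ pl).stash, changeTable σ.2.2 s.ids σ.1,
        store s.ps (((stepPlan P sp n σ pl).1.map Prod.fst).zip r.1)⟩,
        stepAccess P sp n σ r.1) := by
  rw [execStep, h.evict_eq hx]
  simp only [writeback]
  rw [writeLevels_eq σ.2.1 hx _ _ le_rfl none _ s.ps K h.outside (.inl ⟨rfl, rfl⟩)]
  · simp only [PMF.map_comp, map_fst_stepPlan]
    rfl
  · intro t ht
    simp [List.getD_eq_getElem?_getD, ht]

/-- The representation invariant is kept by the writes of an operation. -/
theorem Represents.step {s : State sp n} {K : ℕ → Key sp} {pl : Placement}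
    (h : Represents E P s K pl) (hZ : 2 * sp ≤ P.Z sp n) (hpl : PlacementOk (idBits P sp n) pl)
    {σ : Step} (hx : IsId (idBits P sp n) σ.2.1) (hid : IsId (idBits P sp n) σ.2.2)
    {r : List (List Bool) × (ℕ → Key sp)}
    (hr : r ∈ (play E P n (stepPlan P sp n σ pl).1 K).support) :
    Represents E P (n := n) ⟨r.2 1, (stepPlacement P sp n σ pl).stash, changeTable σ.2.2 s.ids σ.1,
        store s.ps (((stepPlan P sp n σ pl).1.map Prod.fst).zip r.1)⟩ r.2
      (stepPlacement P sp n σ pl) where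
  rootKey := rfl
  stash := rfl
  decodes := by
    refine decodes_play hZ hr ?_ (stepPlan_ok hpl hid).1 fun v h1 h2 _ => h.decodes v h1 h2 (by simp)
    rw [map_fst_stepPlan]
    exact upward_pathUp hx le_rfl
  outside := fun v hv => by
    rw [play_key_of_notMem hr, h.outside v hv]
    rw [map_fst_stepPlan, mem_pathUp]
    rintro ⟨t, ht, rfl⟩
    have hT := height_le_idBits P sp n
    have hb := (loc_bounds (t := t) (by omega) hx).2
    have := Nat.pow_le_pow_right (n := 2) (by norm_num) (show t + 1 ≤ height n + 1 by omega)
    omega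

/-- What is observable of an execution with given identifiers is determined by the ciphertexts and
by the placement of the data, and the latter depends on no key and no ciphertext. -/
theorem execSteps_eq (hZ : 2 * sp ≤ P.Z sp n) (τ : List Step) (hτ : StepsOk (idBits P sp n) τ)
    {s : State sp n} {K : ℕ → Key sp} {pl : Placement}
    (h : Represents E P s K pl) (hpl : PlacementOk (idBits P sp n) pl) :
    ((execSteps E P τ s).map fun r => (r.2, r.1.rootKey, r.1.stash, r.1.ids))
      = (play E P n (runWrites P sp n τ pl) K).map fun r =>
        (accesses P sp n τ r.1, r.2 1, (runPlacement P sp n τ pl).stash,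
          τ.foldl (fun ids σ => changeTable σ.2.2 ids σ.1) s.ids) := by
  induction τ generalizing s K pl with
  | nil =>
    simp [execSteps, runWrites, play, PMF.pure_map, accesses, runPlacement, h.rootKey, h.stash]
  | cons σ τ ih =>
    have hσ := hτ σ (by simp)
    have hτ' : StepsOk (idBits P sp n) τ := fun σ hσ => hτ σ (by simp [hσ])
    rw [execSteps, h.execStep_eq hσ.1, runWrites, play_append]
    simp only [PMF.map_bind, PMF.bind_map, PMF.map_comp, Function.comp_def]
    refine PMF.bind_congr _ fun r hr => ?_
    have hlen := (length_of_mem_support_play hr).trans (length_stepPlan σ pl)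
    have := congrArg (PMF.map fun q => (stepAccess P sp n σ r.1 :: q.1, q.2))
      (ih hτ' (h.step hZ hpl hσ.1 hσ.2 hr) (stepPlan_ok hpl hσ.2).2)
    simp only [PMF.map_comp, Function.comp_def] at this
    refine this.trans ?_
    congr 1
    funext q
    simp only [accesses, List.take_left' hlen, List.drop_left' hlen]
    rfl

theorem runWrites_ok (τ : List Step) (hτ : StepsOk (idBits P sp n) τ) {pl : Placement}
    (hpl : PlacementOk (idBits P sp n) pl) :
    (∀ w ∈ runWrites P sp n τ pl, Fits P sp n w.2) ∧
      Upward ((runWrites P sp n τ pl).map Prod.fst) := by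
  induction τ generalizing pl with
  | nil => exact ⟨by simp [runWrites], trivial⟩
  | cons σ τ ih =>
    have hσ := hτ σ (by simp)
    obtain ⟨h1, h2⟩ := stepPlan_ok hpl hσ.2
    obtain ⟨h3, h4⟩ := ih (fun σ hσ => hτ σ (by simp [hσ])) h2
    constructor
    · intro w hw
      rcases List.mem_append.1 hw with hw | hw
      · exact h1 w hw
      · exact h3 w hw
    · rw [runWrites, List.map_append, map_fst_stepPlan]
      exact (upward_pathUp hσ.1 le_rfl).append h4

theorem map_fst_runWrites (τ : List Step) (pl : Placement) :
    (runWrites P sp n τ pl).map Prod.fst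
      = τ.flatMap fun σ => pathUp P sp n σ.2.1 (height n + 1) := by
  induction τ generalizing pl with
  | nil => rfl
  | cons σ τ ih => simp only [runWrites, List.map_append, map_fst_stepPlan, ih, List.flatMap_cons]

theorem applyWrites_runWrites (τ : List Step) (pl : Placement) :
    applyWrites pl.buckets (runWrites P sp n τ pl) = (runPlacement P sp n τ pl).buckets := by
  induction τ generalizing pl with
  | nil => rfl
  | cons σ τ ih =>
    rw [runWrites, applyWrites_append]
    exact ih (stepPlacement P sp n σ pl)

theorem length_runWrites (τ : List Step) (pl : Placement) :
    (runWrites P sp n τ pl).length = τ.length * (height n + 1) := by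
  rw [← List.length_map (f := Prod.fst), map_fst_runWrites]
  simp [List.length_flatMap, length_pathUp]

theorem length_accesses (τ : List Step) (cs : List (List Bool)) :
    (accesses P sp n τ cs).length = τ.length := by
  induction τ generalizing cs with
  | nil => rfl
  | cons σ τ ih => simp [accesses, ih]

theorem oneSlot_zip_write (vs : List ℕ) (pre post : List (List Bool)) :
    OneSlot fun c => ((vs.zip (pre ++ c :: post)).map fun p => Access.write p.1 p.2).flatMap
      Access.strings := by
  induction vs generalizing pre with
  | nil => exact .inl ⟨[], fun _ => by simp⟩
  | cons v vs ih =>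
    cases pre with
    | nil =>
      exact .inr ⟨[true :: v.bits], ((vs.zip post).map fun p => Access.write p.1 p.2).flatMap
        Access.strings, fun c => by simp [Access.strings]⟩
    | cons a pre => exact (ih pre).append_left [true :: v.bits, a]

/-- One ciphertext is written once, so it is one of the strings that the guesser sees. -/
theorem oneSlot_accesses (τ : List Step) (pre post : List (List Bool)) :
    OneSlot fun c => (accesses P sp n τ (pre ++ c :: post)).flatMap fun acc =>
      acc.length.bits :: acc.flatMap Access.strings := by
  induction τ generalizing pre with
  | nil => exact .inl ⟨[], fun _ => by simp [accesses]⟩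
  | cons σ τ ih =>
    simp only [accesses, List.flatMap_cons]
    by_cases hpre : height n + 1 ≤ pre.length
    · simp only [List.take_append_of_le_length hpre, List.drop_append_of_le_length hpre]
      exact (ih _).append_left _
    · obtain ⟨k, hk⟩ : ∃ k, height n + 1 = pre.length + (k + 1) :=
        ⟨height n - pre.length, by omega⟩
      simp only [hk, List.take_length_add_append, List.drop_length_add_append, List.take_succ_cons,
        List.drop_succ_cons]
      refine OneSlot.append_right ?_ _
      simp only [stepAccess, List.flatMap_append]
      simp only [List.length_append, List.length_map, List.length_zip, List.length_cons]
      exact ((oneSlot_zip_write _ _ _).append_left _).append_left [_]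

end VORAM

namespace VORAM

variable {P : Params} {sp n : ℕ}

/-! ### The pieces of a block -/

/-- The pieces `L` make up the block, if there is one.  Only an empty block has an empty piece, and
only one. -/
def MakesUp (L : List (List Bool)) : Option (List Bool) → Prop
  | none => L = []
  | some B => L ≠ [] ∧ L.flatten = B ∧ (2 ≤ L.length → [] ∉ L)

theorem MakesUp.eq_nil {L : List (List Bool)} (h : MakesUp L none) : L = [] := h

theorem makesUp_singleton (b : List Bool) : MakesUp [b] (some b) := ⟨by simp, by simp, by simp⟩

/-- The beginning of a block is determined by the block and by the pieces that follow. -/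
theorem MakesUp.unique {o o' : Option (List Bool)} {D : List (List Bool)}
    {c : Option (List Bool)} (h : MakesUp (o.toList ++ D) c) (h' : MakesUp (o'.toList ++ D) c) :
    o = o' := by
  cases c with
  | none =>
    have h1 := h.eq_nil
    have h2 := h'.eq_nil
    cases o <;> cases o' <;> simp_all
  | some B =>
    obtain ⟨h1, h2, h3⟩ := h
    obtain ⟨h1', h2', h3'⟩ := h'
    have hf : o.toList.flatten = o'.toList.flatten := by
      rw [← h2', List.flatten_append, List.flatten_append] at h2
      exact List.append_cancel_right h2
    cases o with
    | none =>
      cases o' with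
      | none => rfl
      | some b =>
        simp only [Option.toList_none, List.flatten_nil, Option.toList_some, List.flatten_cons,
          List.append_nil, List.nil_append] at hf h1
        refine absurd (h3' ?_) (by simp [← hf])
        have := List.length_pos_iff.2 h1
        simp only [Option.toList_some, List.length_append, List.length_singleton]
        omega
    | some a =>
      cases o' with
      | some b => simpa using hf
      | none =>
        simp only [Option.toList_none, List.flatten_nil, Option.toList_some, List.flatten_cons,
          List.append_nil, List.nil_append] at hf h1'
        refine absurd (h3 ?_) (by simp [hf])
        have := List.length_pos_iff.2 h1'
        simp only [Option.toList_some, List.length_append, List.length_singleton]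
        omega

/-- The concatenation of some pieces, if there are any. -/
def joinPieces : List (List Bool) → Option (List Bool)
  | [] => none
  | a :: L => some (a :: L).flatten

theorem MakesUp.join {L D : List (List Bool)} {c : Option (List Bool)} (h : MakesUp (L ++ D) c) :
    MakesUp ((joinPieces L).toList ++ D) c := by
  cases L with
  | nil => exact h
  | cons a L =>
    cases c with
    | none => exact absurd h.eq_nil (by simp)
    | some B =>
      obtain ⟨-, h2, h3⟩ := h
      refine ⟨by simp [joinPieces], by simpa [joinPieces] using h2, fun hlen => ?_⟩
      have hD : 1 ≤ D.length := by simpa [joinPieces] using hlen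
      have h4 := h3 (by simp; omega)
      simp only [List.cons_append, List.mem_cons, List.mem_append, not_or] at h4
      simp only [joinPieces, Option.toList_some, List.flatten_cons, List.cons_append,
        List.nil_append, List.mem_cons, not_or]
      refine ⟨fun h => h4.1 ?_, h4.2.2⟩
      exact (List.append_eq_nil_iff.1 h.symm).1.symm

theorem MakesUp.splits {o o' : Option (List Bool)} {l D : List (List Bool)}
    {c : Option (List Bool)} (h : MakesUp (o.toList ++ D) c) (hs : Splits o o' l) :
    MakesUp (o'.toList ++ (l ++ D)) c := by
  obtain ⟨rfl, rfl⟩ | ⟨b, rfl, rfl, rfl⟩ | ⟨a, b, rfl, rfl, rfl, ha, hb⟩ := hs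
  · exact h
  · exact h
  · cases c with
    | none => exact absurd h.eq_nil (by simp)
    | some B =>
      obtain ⟨-, h2, h3⟩ := h
      refine ⟨by simp, by simpa using h2, fun _ => ?_⟩
      have hD : [] ∉ D := fun hmem => by
        have := List.length_pos_of_mem hmem
        exact h3 (by simp; omega) (by simp [hmem])
      simp [Ne.symm ha, Ne.symm hb, hD]

theorem getElem?_foldl_merge (l : List (ℕ × List Bool)) (stash : Blocks) (id : ℕ) :
    (l.foldl merge stash)[id]? = joinPieces (stash[id]?.toList ++ pieces id l) := by
  induction l generalizing stash with
  | nil => cases h : stash[id]? <;> simp [pieces, joinPieces, h]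
  | cons p l ih =>
    rw [List.foldl_cons, ih, merge, getElem?_insert_eq, Std.ExtTreeMap.getD_eq_getD_getElem?]
    by_cases hp : id = p.1
    · subst hp
      cases h : stash[p.1]? <;> simp [pieces, joinPieces]
    · simp [pieces, hp, Ne.symm hp]

/-! ### Consistency of a placement with the stored blocks -/

variable (P sp n) in
/-- The pieces of the block `id` on its path. -/
def pathPieces (bk : ℕ → List (ℕ × List Bool)) (id : ℕ) : List (List Bool) :=
  (List.range (height n + 1)).flatMap fun t => pieces id (bk (loc P sp n id t))

variable (P sp n) in
/-- The stash and the path of each block, from the root to the leaf, hold the successive parts of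
the block, and no other bucket holds a part of it.  Here `C` lists the stored blocks by
identifier. -/
structure Consistent (stash : Blocks) (bk : ℕ → List (ℕ × List Bool))
    (C : ℕ → Option (List Bool)) : Prop where
  makesUp : ∀ id, MakesUp (stash[id]?.toList ++ pathPieces P sp n bk id) (C id)
  onPath : ∀ id t v, t ≤ height n → 2 ^ t ≤ v → v < 2 ^ (t + 1) → pieces id (bk v) ≠ [] →
    loc P sp n id t = v
  proper : ∀ id, C id ≠ none → IsId (idBits P sp n) id

theorem flatMap_range_split {β : Type} (f : ℕ → List β) {t T : ℕ} (h : t ≤ T) :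
    (List.range (T + 1)).flatMap f
      = (List.range t).flatMap f ++ (f t ++ (List.range' (t + 1) (T - t)).flatMap f) := by
  obtain ⟨k, rfl⟩ := Nat.exists_eq_add_of_le h
  rw [List.range_eq_range', List.range_eq_range', show t + k + 1 = t + (1 + k) by ring,
    ← List.range'_append_1, Nat.zero_add, ← List.range'_append_1, List.range'_one,
    List.flatMap_append, List.flatMap_append]
  simp

theorem flatMap_range_partition {β : Type} (f : ℕ → List β) (e : ℕ → Prop) [DecidablePred e]
    (k : ℕ) (he : ∀ t t', t ≤ t' → t' < k → e t' → e t) :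
    (List.range k).flatMap f = (List.range k).flatMap (fun t => if e t then f t else []) ++
      (List.range k).flatMap fun t => if e t then [] else f t := by
  induction k with
  | zero => rfl
  | succ k ih =>
    have ih' := ih fun t t' h h' => he t t' h (by omega)
    simp only [List.range_succ, List.flatMap_append, List.flatMap_singleton]
    by_cases hk : e k
    · have h1 : (List.range k).flatMap (fun t => if e t then [] else f t) = [] := by
        simp only [List.flatMap_eq_nil_iff, List.mem_range]
        intro t ht
        rw [if_pos (he t k ht.le (by omega) hk)]
      rw [h1, List.append_nil] at ih'
      rw [if_pos hk, if_pos hk, h1, ← ih']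
      simp
    · rw [if_neg hk, if_neg hk, List.append_nil, ih', List.append_assoc]

theorem Consistent.eq_nil_of_none {stash : Blocks} {bk : ℕ → List (ℕ × List Bool)}
    {C : ℕ → Option (List Bool)} (h : Consistent P sp n stash bk C) {id : ℕ} (hid : C id = none) :
    stash[id]? = none ∧ ∀ t ≤ height n, pieces id (bk (loc P sp n id t)) = [] := by
  have h1 := h.makesUp id
  rw [hid] at h1
  obtain ⟨h2, h3⟩ := List.append_eq_nil_iff.1 h1.eq_nil
  refine ⟨by simpa using h2, fun t ht => ?_⟩
  rw [pathPieces, List.flatMap_eq_nil_iff] at h3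
  exact h3 t (List.mem_range.2 (by omega))

variable (P sp n) in
/-- The buckets during an operation on the path of `x`, before any of them is filled. -/
def clearPath (x : ℕ) (bk : ℕ → List (ℕ × List Bool)) (v : ℕ) : List (ℕ × List Bool) :=
  if v ∈ pathUp P sp n x (height n + 1) then [] else bk v

theorem clearPath_loc {x t : ℕ} (ht : t ≤ height n) (bk : ℕ → List (ℕ × List Bool)) :
    clearPath P sp n x bk (loc P sp n x t) = [] :=
  if_pos (mem_pathUp.2 ⟨t, by omega, rfl⟩)

/-- Evicting a path moves all pieces on it into the stash. As the path of each block shares an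
initial part with the evicted path, these are the first pieces of the block, and their order is
kept. -/
theorem Consistent.gather {pl : Placement} {C : ℕ → Option (List Bool)}
    (h : Consistent P sp n pl.stash pl.buckets C) {x : ℕ} (hx : IsId (idBits P sp n) x) :
    Consistent P sp n (gather P sp n x pl) (clearPath P sp n x pl.buckets) C where
  makesUp := fun id => by
    have hT := height_le_idBits P sp n
    rw [VORAM.gather, getElem?_foldl_merge, pieces_flatMap]
    -- what the path of `x` holds of the block is what the common part of the two paths holds
    have h1 : ((List.range (height n + 1)).flatMap fun t =>
        pieces id (pl.buckets (loc P sp n x t))) = (List.range (height n + 1)).flatMap fun t =>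
          if loc P sp n id t = loc P sp n x t then pieces id (pl.buckets (loc P sp n id t))
          else [] := by
      refine List.flatMap_congr fun t ht => ?_
      rw [List.mem_range] at ht
      split_ifs with he
      · rw [he]
      · by_contra hne
        have hb := loc_bounds (t := t) (by omega) hx
        exact he (h.onPath id t _ (by omega) hb.1 hb.2 hne)
    have h2 : pathPieces P sp n (clearPath P sp n x pl.buckets) id
        = (List.range (height n + 1)).flatMap fun t =>
          if loc P sp n id t = loc P sp n x t then []
          else pieces id (pl.buckets (loc P sp n id t)) := by
      refine List.flatMap_congr fun t ht => ?_
      rw [List.mem_range] at ht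
      rcases hc : C id with _ | B
      · have h3 := (h.eq_nil_of_none hc).2 t (by omega)
        rw [clearPath, h3]
        split_ifs <;> first | rfl | exact h3
      · have hid := h.proper id (by simp [hc])
        rw [clearPath]
        by_cases he : loc P sp n id t = loc P sp n x t
        · rw [if_pos he, if_pos (mem_pathUp.2 ⟨t, ht, he.symm⟩)]
          rfl
        · rw [if_neg he, if_neg]
          rw [mem_pathUp]
          rintro ⟨t', ht', he'⟩
          obtain rfl := loc_inj_level (by omega) (by omega) hx hid he'
          exact he he'.symm
    rw [h1, h2]
    refine MakesUp.join ?_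
    rw [List.append_assoc, ← flatMap_range_partition]
    · exact h.makesUp id
    · intro t t' htt ht' he
      exact loc_eq_of_le htt (by omega) he
  onPath := fun id t v ht h1 h2 h3 => by
    refine h.onPath id t v ht h1 h2 fun h4 => h3 ?_
    rw [clearPath]
    split_ifs
    · rfl
    · exact h4
  proper := h.proper

/-- The change that an operation makes to the stored blocks. -/
def changeContents (x id : ℕ) (C : ℕ → Option (List Bool)) : Op → ℕ → Option (List Bool)
  | .insert _ blk => Function.update C id (some blk)
  | .remove _ => Function.update C x none
  | .update _ f => Function.update (Function.update C x none) id (some (f ((C x).getD [])))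

/-- The new identifier is not in use, and removed and updated blocks are stored. -/
def StepValid (C : ℕ → Option (List Bool)) (σ : Step) : Prop :=
  C σ.2.2 = none ∧ match σ.1 with
    | .insert _ _ => True
    | .remove _ => C σ.2.1 ≠ none
    | .update _ _ => C σ.2.1 ≠ none

theorem Consistent.insert {stash : Blocks} {bk : ℕ → List (ℕ × List Bool)}
    {C : ℕ → Option (List Bool)} (h : Consistent P sp n stash bk C) {id : ℕ} (hid : C id = none)
    (hproper : IsId (idBits P sp n) id) (blk : List Bool) :
    Consistent P sp n (stash.insert id blk) bk (Function.update C id (some blk)) where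
  makesUp := fun i => by
    rw [getElem?_insert_eq]
    by_cases hi : i = id
    · subst hi
      have h1 := (h.eq_nil_of_none hid).2
      have h2 : pathPieces P sp n bk i = [] := by
        rw [pathPieces, List.flatMap_eq_nil_iff]
        exact fun t ht => h1 t (by rw [List.mem_range] at ht; omega)
      rw [if_pos rfl, Function.update_self, h2]
      exact makesUp_singleton blk
    · rw [if_neg hi, Function.update_of_ne hi]
      exact h.makesUp i
  onPath := h.onPath
  proper := fun i hi => by
    by_cases hii : i = id
    · exact hii ▸ hproper
    · rw [Function.update_of_ne hii] at hi
      exact h.proper i hi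

/-- A block whose path is cleared is completely in the stash. -/
theorem Consistent.getElem?_eq {stash : Blocks} {bk : ℕ → List (ℕ × List Bool)}
    {C : ℕ → Option (List Bool)} (h : Consistent P sp n stash bk C) {x : ℕ}
    (hclear : ∀ t ≤ height n, bk (loc P sp n x t) = []) : stash[x]? = C x := by
  have h1 := h.makesUp x
  have h2 : pathPieces P sp n bk x = [] := by
    rw [pathPieces, List.flatMap_eq_nil_iff]
    intro t ht
    rw [hclear t (by rw [List.mem_range] at ht; omega)]
    rfl
  rw [h2, List.append_nil] at h1
  cases ho : stash[x]? with
  | none =>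
    rw [ho] at h1
    cases hc : C x with
    | none => rfl
    | some B => rw [hc] at h1; exact absurd rfl h1.1
  | some b =>
    rw [ho] at h1
    cases hc : C x with
    | none => rw [hc] at h1; exact absurd h1.eq_nil (by simp)
    | some B => rw [hc] at h1; simpa using h1.2.1

theorem Consistent.erase {stash : Blocks} {bk : ℕ → List (ℕ × List Bool)}
    {C : ℕ → Option (List Bool)} (h : Consistent P sp n stash bk C) {x : ℕ}
    (hclear : ∀ t ≤ height n, bk (loc P sp n x t) = []) :
    Consistent P sp n (stash.erase x) bk (Function.update C x none) where
  makesUp := fun i => by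
    rw [getElem?_erase_eq]
    by_cases hi : i = x
    · subst hi
      have h2 : pathPieces P sp n bk i = [] := by
        rw [pathPieces, List.flatMap_eq_nil_iff]
        intro t ht
        rw [hclear t (by rw [List.mem_range] at ht; omega)]
        rfl
      rw [if_pos rfl, Function.update_self, h2]
      rfl
    · rw [if_neg hi, Function.update_of_ne hi]
      exact h.makesUp i
  onPath := h.onPath
  proper := fun i hi => by
    by_cases hii : i = x
    · rw [hii, Function.update_self] at hi
      exact absurd rfl hi
    · rw [Function.update_of_ne hii] at hi
      exact h.proper i hi

theorem Consistent.changeStash {stash : Blocks} {bk : ℕ → List (ℕ × List Bool)}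
    {C : ℕ → Option (List Bool)} (h : Consistent P sp n stash bk C) {σ : Step}
    (hclear : ∀ t ≤ height n, bk (loc P sp n σ.2.1 t) = []) (hσ : StepValid C σ)
    (hproper : IsId (idBits P sp n) σ.2.2) :
    Consistent P sp n (changeStash σ.2.1 σ.2.2 stash σ.1) bk
      (changeContents σ.2.1 σ.2.2 C σ.1) := by
  obtain ⟨o, x, id⟩ := σ
  cases o with
  | insert l blk => exact h.insert hσ.1 hproper blk
  | remove l => exact h.erase hclear
  | update l f =>
    have h1 := h.getElem?_eq hclear
    have hne : id ≠ x := by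
      rintro rfl
      exact hσ.2 hσ.1
    have h2 := (h.erase hclear).insert (id := id)
      (by rw [Function.update_of_ne hne]; exact hσ.1) hproper (f (stash.getD x []))
    rw [Std.ExtTreeMap.getD_eq_getD_getElem?, h1] at h2
    simpa only [VORAM.changeStash, changeContents, Std.ExtTreeMap.getD_eq_getD_getElem?, h1] using h2

variable (P sp n) in
/-- What `writeback` puts into the bucket at level `t` of the path of `x`, and the new stash. -/
def fillLevel (x t : ℕ) (stash : Blocks) : List (ℕ × List Bool) × Blocks :=
  fill P.pick (overhead P sp n) (candidates P sp n x t stash).size (P.Z sp n - 2 * sp)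
    (candidates P sp n x t stash) stash

/-- Filling buckets from the leaf to the root keeps the pieces of each block in order: the end of
what the stash holds goes into the lowest bucket that is still empty. -/
theorem Consistent.fillLevel {stash : Blocks} {bk : ℕ → List (ℕ × List Bool)}
    {C : ℕ → Option (List Bool)} (h : Consistent P sp n stash bk C) {x t : ℕ}
    (hx : IsId (idBits P sp n) x) (ht : t ≤ height n)
    (hclear : ∀ t' ≤ t, bk (loc P sp n x t') = []) :
    Consistent P sp n (fillLevel P sp n x t stash).2
      (Function.update bk (loc P sp n x t) (fillLevel P sp n x t stash).1) C := by
  have hT := height_le_idBits P sp n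
  obtain ⟨h1, h2, -⟩ := candidates_fill_spec (P := P) (sp := sp) (n := n) x t stash
    (candidates P sp n x t stash).size (P.Z sp n - 2 * sp)
  change ∀ id, Splits _ (VORAM.fillLevel P sp n x t stash).2[id]?
    (pieces id (VORAM.fillLevel P sp n x t stash).1) at h1
  change ∀ p ∈ (VORAM.fillLevel P sp n x t stash).1, _ at h2
  generalize VORAM.fillLevel P sp n x t stash = f at h1 h2
  have hcand : ∀ id, pieces id f.1 ≠ [] → loc P sp n id t = loc P sp n x t := by
    intro id hid
    obtain ⟨p, hp, rfl⟩ := pieces_ne_nil hid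
    exact (mem_candidates (h2 p hp)).2
  have hb := loc_bounds (t := t) (by omega) hx
  refine ⟨fun id => ?_, fun id t' v ht' hv1 hv2 hne => ?_, h.proper⟩
  · have hs := h1 id
    have hm := h.makesUp id
    -- nothing changes for a block of which nothing is moved
    have hsame : pieces id f.1 = [] → (∀ t' ≤ height n, loc P sp n id t' = loc P sp n x t →
          pieces id (bk (loc P sp n x t)) = []) →
        MakesUp (f.2[id]?.toList ++ pathPieces P sp n (Function.update bk (loc P sp n x t) f.1) id)
          (C id) := by
      intro hnil hold
      have ho : f.2[id]? = stash[id]? := by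
        obtain ⟨h, -⟩ | ⟨b, -, -, h⟩ | ⟨a, b, -, -, h, -⟩ := hs
        · exact h
        · simp [hnil] at h
        · simp [hnil] at h
      have hp : pathPieces P sp n (Function.update bk (loc P sp n x t) f.1) id
          = pathPieces P sp n bk id := by
        refine List.flatMap_congr fun t' ht' => ?_
        rw [List.mem_range] at ht'
        by_cases he : loc P sp n id t' = loc P sp n x t
        · rw [he, Function.update_self, hnil, hold t' (by omega) he]
        · rw [Function.update_of_ne he]
      rw [ho, hp]
      exact hm
    have hold : ∀ t' ≤ height n, loc P sp n id t' = loc P sp n x t →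
        pieces id (bk (loc P sp n x t)) = [] := fun _ _ _ => by
      rw [hclear t le_rfl]
      rfl
    by_cases hnil : pieces id f.1 = []
    · exact hsame hnil hold
    have he := hcand id hnil
    have hid : IsId (idBits P sp n) id := h.proper id fun hc => by
      have h3 := (h.eq_nil_of_none hc).1
      rw [h3] at hs
      obtain ⟨-, h⟩ | ⟨b, h, -⟩ | ⟨a, b, h, -⟩ := hs
      · exact hnil h
      · simp at h
      · simp at h
    rw [pathPieces, flatMap_range_split _ ht] at hm ⊢
    have hlow : ∀ t' < t, loc P sp n id t' = loc P sp n x t' := fun t' ht' =>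
      loc_eq_of_le ht'.le (by omega) he
    have e1 : ((List.range t).flatMap fun t' => pieces id (bk (loc P sp n id t'))) = [] := by
      rw [List.flatMap_eq_nil_iff]
      intro t' ht'
      rw [List.mem_range] at ht'
      rw [hlow t' ht', hclear t' ht'.le]
      rfl
    have hne : ∀ t' ≤ height n, t' ≠ t → loc P sp n id t' ≠ loc P sp n x t :=
      fun t' ht' hne h => hne (loc_inj_level (by omega) (by omega) hid hx h)
    have e1' : ((List.range t).flatMap fun t' => pieces id
        (Function.update bk (loc P sp n x t) f.1 (loc P sp n id t'))) = [] := by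
      rw [← e1]
      refine List.flatMap_congr fun t' ht' => ?_
      rw [List.mem_range] at ht'
      rw [Function.update_of_ne (hne t' (by omega) (by omega))]
    have e2 : ((List.range' (t + 1) (height n - t)).flatMap fun t' => pieces id
        (Function.update bk (loc P sp n x t) f.1 (loc P sp n id t')))
        = (List.range' (t + 1) (height n - t)).flatMap fun t' =>
          pieces id (bk (loc P sp n id t')) := by
      refine List.flatMap_congr fun t' ht' => ?_
      rw [List.mem_range'_1] at ht'
      rw [Function.update_of_ne (hne t' (by omega) (by omega))]
    rw [e1, he, hclear t le_rfl] at hm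
    rw [e1', e2, he, Function.update_self]
    have hsplit := MakesUp.splits hm hs
    exact hsplit
  · by_cases hv : v = loc P sp n x t
    · subst hv
      rw [Function.update_self] at hne
      have : t' = t := by
        rcases lt_trichotomy t' t with hlt | h | hlt
        · have := Nat.pow_le_pow_right (n := 2) (by norm_num) (Nat.succ_le_of_lt hlt)
          omega
        · exact h
        · have := Nat.pow_le_pow_right (n := 2) (by norm_num) (Nat.succ_le_of_lt hlt)
          omega
      subst this
      exact hcand id hne
    · rw [Function.update_of_ne hv] at hne
      exact h.onPath id t' v ht' hv1 hv2 hne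

theorem update_loc_clear {bk : ℕ → List (ℕ × List Bool)} {x t : ℕ}
    (hx : IsId (idBits P sp n) x) (ht : t ≤ height n)
    (hclear : ∀ t' ≤ t, bk (loc P sp n x t') = []) (l : List (ℕ × List Bool)) :
    ∀ t' < t, Function.update bk (loc P sp n x t) l (loc P sp n x t') = [] := fun t' ht' => by
  have hT := height_le_idBits P sp n
  rw [Function.update_of_ne, hclear t' ht'.le]
  intro h
  have := loc_inj_level (by omega) (by omega) hx hx h
  omega

theorem Consistent.plan {stash : Blocks} {bk : ℕ → List (ℕ × List Bool)}
    {C : ℕ → Option (List Bool)} (h : Consistent P sp n stash bk C) {x t : ℕ}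
    (hx : IsId (idBits P sp n) x) (ht : t ≤ height n + 1)
    (hclear : ∀ t' < t, bk (loc P sp n x t') = []) :
    Consistent P sp n (plan P sp n x t stash).2 (applyWrites bk (plan P sp n x t stash).1) C := by
  induction t generalizing stash bk with
  | zero => exact h
  | succ t ih =>
    have hclear' : ∀ t' ≤ t, bk (loc P sp n x t') = [] := fun t' ht' => hclear t' (by omega)
    exact ih (h.fillLevel hx (by omega) hclear') (by omega)
      (update_loc_clear hx (by omega) hclear' _)

theorem applyWrites_clearPath (σ : Step) (pl : Placement) (bk : ℕ → List (ℕ × List Bool)) :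
    applyWrites (clearPath P sp n σ.2.1 bk) (stepPlan P sp n σ pl).1
      = applyWrites bk (stepPlan P sp n σ pl).1 :=
  applyWrites_congr fun v hv => by
    rw [map_fst_stepPlan] at hv
    exact if_neg hv

theorem Consistent.prepared {pl : Placement} {C : ℕ → Option (List Bool)}
    (h : Consistent P sp n pl.stash pl.buckets C) {σ : Step} (hx : IsId (idBits P sp n) σ.2.1)
    (hid : IsId (idBits P sp n) σ.2.2) (hσ : StepValid C σ) :
    Consistent P sp n (VORAM.changeStash σ.2.1 σ.2.2 (VORAM.gather P sp n σ.2.1 pl) σ.1)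
      (clearPath P sp n σ.2.1 pl.buckets) (changeContents σ.2.1 σ.2.2 C σ.1) :=
  (h.gather hx).changeStash (fun _ ht => clearPath_loc ht _) hσ hid

theorem Consistent.step {pl : Placement} {C : ℕ → Option (List Bool)}
    (h : Consistent P sp n pl.stash pl.buckets C) {σ : Step} (hx : IsId (idBits P sp n) σ.2.1)
    (hid : IsId (idBits P sp n) σ.2.2) (hσ : StepValid C σ) :
    Consistent P sp n (stepPlacement P sp n σ pl).stash (stepPlacement P sp n σ pl).buckets
      (changeContents σ.2.1 σ.2.2 C σ.1) := by
  have h1 := (h.prepared hx hid hσ).plan hx le_rfl fun t ht => clearPath_loc (by omega) _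
  rw [← stepPlan, applyWrites_clearPath] at h1
  exact h1

end VORAM

namespace VORAM

variable {P : Params} {sp n : ℕ}

/-! ### Two executions with the same identifiers -/

/-- What goes into a bucket depends on the candidates only, not on the rest of the stash. -/
theorem fill_fst_congr (pick : Blocks → ℕ) (ov fuel space : ℕ) (W stash stash' : Blocks) :
    (fill pick ov fuel space W stash).1 = (fill pick ov fuel space W stash').1 := by
  induction fuel generalizing space W stash stash' with
  | zero => rfl
  | succ fuel ih =>
    rw [fill, fill]
    split_ifs
    · rfl
    · dsimp only
      split_ifs
      · simp only [ih _ _ (stash.erase (pick W)) (stash'.erase (pick W))]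
      · rfl

variable (P sp n) in
/-- The node `v` at level `t` is settled if all leaves below it have been visited and all blocks
whose paths go through it have the same contents in both executions. -/
def Settled (V : ℕ → Prop) (C C' : ℕ → Option (List Bool)) (t v : ℕ) : Prop :=
  (∀ u, 2 ^ height n ≤ u → u < 2 ^ (height n + 1) → u / 2 ^ (height n - t) = v → V u) ∧
    ∀ id, loc P sp n id t = v → C id = C' id

variable (P sp n) in
/-- Settled buckets have the same contents in both executions. -/
def AgreeSettled (V : ℕ → Prop) (C C' : ℕ → Option (List Bool))
    (bk bk' : ℕ → List (ℕ × List Bool)) : Prop :=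
  ∀ t v, t ≤ height n → 2 ^ t ≤ v → v < 2 ^ (t + 1) → Settled P sp n V C C' t v → bk v = bk' v

/-- The nodes below a settled node are settled. -/
theorem Settled.below {V : ℕ → Prop} {C C' : ℕ → Option (List Bool)} {t t' id : ℕ}
    (h : Settled P sp n V C C' t (loc P sp n id t)) (htt : t ≤ t') (ht' : t' ≤ height n) :
    Settled P sp n V C C' t' (loc P sp n id t') := by
  have hT := height_le_idBits P sp n
  refine ⟨fun u hu1 hu2 hu => h.1 u hu1 hu2 ?_, fun i hi => h.2 i ?_⟩
  · rw [← loc_div id htt (by omega), ← hu, Nat.div_div_eq_div_mul, ← pow_add]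
    congr 2
    omega
  · exact loc_eq_of_le htt (by omega) hi

/-- When the bucket of a settled node is filled, the candidates are the same in both executions:
they are what the settled buckets further down do not hold. -/
theorem AgreeSettled.candidates_eq {V : ℕ → Prop} {C C' : ℕ → Option (List Bool)}
    {bk bk' : ℕ → List (ℕ × List Bool)} {stash stash' : Blocks}
    (h : AgreeSettled P sp n V C C' bk bk') (hc : Consistent P sp n stash bk C)
    (hc' : Consistent P sp n stash' bk' C') {x t : ℕ} (ht : t ≤ height n)
    (hclear : ∀ t' ≤ t, bk (loc P sp n x t') = []) (hclear' : ∀ t' ≤ t, bk' (loc P sp n x t') = [])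
    (hs : Settled P sp n V C C' t (loc P sp n x t)) :
    candidates P sp n x t stash = candidates P sp n x t stash' := by
  have hT := height_le_idBits P sp n
  refine Std.ExtTreeMap.ext_getElem? fun id => ?_
  rw [getElem?_candidates, getElem?_candidates]
  split_ifs with he
  swap
  · rfl
  have hC : C id = C' id := hs.2 id he
  by_cases hnone : C id = none
  · rw [(hc.eq_nil_of_none hnone).1, (hc'.eq_nil_of_none (hC ▸ hnone)).1]
  have hid := hc.proper id hnone
  have hp : pathPieces P sp n bk id = pathPieces P sp n bk' id := by
    refine List.flatMap_congr fun t' ht' => ?_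
    rw [List.mem_range] at ht'
    rcases le_total t' t with hle | hle
    · rw [loc_eq_of_le hle (by omega) he, hclear t' hle, hclear' t' hle]
    · have hb := loc_bounds (t := t') (by omega) hid
      rw [h t' _ (by omega) hb.1 hb.2 ((he ▸ hs).below hle (by omega))]
  have h1 := hc.makesUp id
  have h2 := hc'.makesUp id
  rw [hp] at h1
  rw [← hC] at h2
  exact h1.unique h2

/-- Rewriting a cleared path makes all settled buckets on it agree, from the leaf to the root. -/
theorem AgreeSettled.plan {V : ℕ → Prop} {C C' : ℕ → Option (List Bool)}
    {bk bk' : ℕ → List (ℕ × List Bool)} {stash stash' : Blocks}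
    (h : AgreeSettled P sp n V C C' bk bk') (hc : Consistent P sp n stash bk C)
    (hc' : Consistent P sp n stash' bk' C') {x t : ℕ} (hx : IsId (idBits P sp n) x)
    (ht : t ≤ height n + 1) (hclear : ∀ t' < t, bk (loc P sp n x t') = [])
    (hclear' : ∀ t' < t, bk' (loc P sp n x t') = []) :
    AgreeSettled P sp n V C C' (applyWrites bk (plan P sp n x t stash).1)
      (applyWrites bk' (plan P sp n x t stash').1) := by
  have hT := height_le_idBits P sp n
  induction t generalizing stash stash' bk bk' with
  | zero => exact h
  | succ t ih =>
    have hcl : ∀ t' ≤ t, bk (loc P sp n x t') = [] := fun t' ht' => hclear t' (by omega)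
    have hcl' : ∀ t' ≤ t, bk' (loc P sp n x t') = [] := fun t' ht' => hclear' t' (by omega)
    refine ih (bk := Function.update bk (loc P sp n x t) (fillLevel P sp n x t stash).1)
      (bk' := Function.update bk' (loc P sp n x t) (fillLevel P sp n x t stash').1)
      ?_ (hc.fillLevel hx (by omega) hcl) (hc'.fillLevel hx (by omega) hcl') (by omega)
      (update_loc_clear hx (by omega) hcl _) (update_loc_clear hx (by omega) hcl' _)
    intro t' v ht' hv1 hv2 hs
    by_cases hv : v = loc P sp n x t
    · subst hv
      have hb := loc_bounds (t := t) (by omega) hx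
      have htt : t' = t := by
        rcases lt_trichotomy t' t with hlt | h | hlt
        · have := Nat.pow_le_pow_right (n := 2) (by norm_num) (Nat.succ_le_of_lt hlt)
          omega
        · exact h
        · have := Nat.pow_le_pow_right (n := 2) (by norm_num) (Nat.succ_le_of_lt hlt)
          omega
      subst htt
      rw [Function.update_self, Function.update_self, fillLevel, fillLevel,
        h.candidates_eq hc hc' ht' hcl hcl' hs]
      exact fill_fst_congr _ _ _ _ _ _ _
    · rw [Function.update_of_ne hv, Function.update_of_ne hv]
      exact h t' v ht' hv1 hv2 hs

theorem changeContents_of_ne {x id i : ℕ} (C : ℕ → Option (List Bool)) (o : Op) (hx : i ≠ x)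
    (hid : i ≠ id) : changeContents x id C o i = C i := by
  cases o with
  | insert l blk => exact Function.update_of_ne hid _ _
  | remove l => exact Function.update_of_ne hx _ _
  | update l f =>
    rw [changeContents, Function.update_of_ne hid, Function.update_of_ne hx]

/-- An operation on the same path settles this path as far as possible. A block that disappears
leaves its whole path to be rewritten, so no settled bucket depends on it. -/
theorem AgreeSettled.step {V : ℕ → Prop} {C C' : ℕ → Option (List Bool)} {pl pl' : Placement}
    (h : AgreeSettled P sp n V C C' pl.buckets pl'.buckets)
    (hc : Consistent P sp n pl.stash pl.buckets C)
    (hc' : Consistent P sp n pl'.stash pl'.buckets C') {σ : Step}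
    (hx : IsId (idBits P sp n) σ.2.1) (hid : IsId (idBits P sp n) σ.2.2)
    (hσ : StepValid C σ) (hσ' : StepValid C' σ) :
    AgreeSettled P sp n (fun u => V u ∨ u = loc P sp n σ.2.1 (height n))
      (changeContents σ.2.1 σ.2.2 C σ.1) (changeContents σ.2.1 σ.2.2 C' σ.1)
      (stepPlacement P sp n σ pl).buckets (stepPlacement P sp n σ pl').buckets := by
  have hT := height_le_idBits P sp n
  have h1 : AgreeSettled P sp n (fun u => V u ∨ u = loc P sp n σ.2.1 (height n))
      (changeContents σ.2.1 σ.2.2 C σ.1) (changeContents σ.2.1 σ.2.2 C' σ.1)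
      (clearPath P sp n σ.2.1 pl.buckets) (clearPath P sp n σ.2.1 pl'.buckets) := by
    intro t v ht hv1 hv2 hs
    rw [clearPath, clearPath]
    split_ifs with hmem
    · rfl
    have hne : loc P sp n σ.2.1 t ≠ v := fun he => hmem (mem_pathUp.2 ⟨t, by omega, he⟩)
    refine h t v ht hv1 hv2 ⟨fun u hu1 hu2 hu => ?_, fun i hi => ?_⟩
    · refine (hs.1 u hu1 hu2 hu).resolve_right ?_
      rintro rfl
      exact hne (by rw [← hu, loc_div _ ht hT])
    · by_cases hii : i = σ.2.2
      · rw [hii, hσ.1, hσ'.1]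
      · have hix : i ≠ σ.2.1 := by
          rintro rfl
          exact hne hi
        have := hs.2 i hi
        rwa [changeContents_of_ne _ _ hix hii, changeContents_of_ne _ _ hix hii] at this
  have h2 := h1.plan (hc.prepared hx hid hσ) (hc'.prepared hx hid hσ') hx le_rfl
    (fun t ht => clearPath_loc (by omega) _) (fun t ht => clearPath_loc (by omega) _)
  rw [← stepPlan, ← stepPlan, applyWrites_clearPath, applyWrites_clearPath] at h2
  exact h2

/-- The stored blocks after some operations. -/
def runContents (τ : List Step) (C : ℕ → Option (List Bool)) : ℕ → Option (List Bool) :=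
  τ.foldl (fun C σ => changeContents σ.2.1 σ.2.2 C σ.1) C

/-- Each operation is valid for the blocks that are stored when it is executed. -/
def StepsValid : List Step → (ℕ → Option (List Bool)) → Prop
  | [], _ => True
  | σ :: τ, C => StepValid C σ ∧ StepsValid τ (changeContents σ.2.1 σ.2.2 C σ.1)

theorem stepsValid_append {τ τ' : List Step} {C : ℕ → Option (List Bool)} :
    StepsValid (τ ++ τ') C ↔ StepsValid τ C ∧ StepsValid τ' (runContents τ C) := by
  induction τ generalizing C with
  | nil => simp [StepsValid, runContents]
  | cons σ τ ih =>
    rw [List.cons_append, StepsValid, StepsValid, ih, and_assoc]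
    rfl

theorem Consistent.run {τ : List Step} {pl : Placement} {C : ℕ → Option (List Bool)}
    (h : Consistent P sp n pl.stash pl.buckets C) (hτ : StepsOk (idBits P sp n) τ)
    (hv : StepsValid τ C) :
    Consistent P sp n (runPlacement P sp n τ pl).stash (runPlacement P sp n τ pl).buckets
      (runContents τ C) := by
  induction τ generalizing pl C with
  | nil => exact h
  | cons σ τ ih =>
    have hσ := hτ σ (by simp)
    exact ih (pl := stepPlacement P sp n σ pl) (h.step hσ.1 hσ.2 hv.1)
      (fun σ hσ => hτ σ (by simp [hσ])) hv.2

theorem AgreeSettled.run {τ : List Step} {V : ℕ → Prop} {pl pl' : Placement}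
    {C C' : ℕ → Option (List Bool)}
    (h : AgreeSettled P sp n V C C' pl.buckets pl'.buckets)
    (hc : Consistent P sp n pl.stash pl.buckets C)
    (hc' : Consistent P sp n pl'.stash pl'.buckets C') (hτ : StepsOk (idBits P sp n) τ)
    (hv : StepsValid τ C) (hv' : StepsValid τ C') :
    AgreeSettled P sp n (fun u => V u ∨ ∃ σ ∈ τ, u = loc P sp n σ.2.1 (height n))
      (runContents τ C) (runContents τ C') (runPlacement P sp n τ pl).buckets
      (runPlacement P sp n τ pl').buckets := by
  induction τ generalizing pl pl' C C' V with
  | nil => simpa [runContents, runPlacement] using h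
  | cons σ τ ih =>
    have hσ := hτ σ (by simp)
    have h1 := ih (h.step hc hc' hσ.1 hσ.2 hv.1 hv'.1) (hc.step hσ.1 hσ.2 hv.1)
      (hc'.step hσ.1 hσ.2 hv'.1) (fun σ hσ => hτ σ (by simp [hσ])) hv.2 hv'.2
    have hV : (fun u => V u ∨ ∃ σ' ∈ σ :: τ, u = loc P sp n σ'.2.1 (height n)) = fun u =>
        (V u ∨ u = loc P sp n σ.2.1 (height n)) ∨ ∃ σ' ∈ τ, u = loc P sp n σ'.2.1 (height n) := by
      funext u
      simp only [List.exists_mem_cons_iff, or_assoc]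
    rw [hV]
    exact h1

/-- If two executions end with the same operations, which visit all leaves, and with the same stored
blocks, the final placements are the same. -/
theorem runPlacement_eq {τ : List Step} {pl pl' : Placement} {C C' : ℕ → Option (List Bool)}
    (hc : Consistent P sp n pl.stash pl.buckets C)
    (hc' : Consistent P sp n pl'.stash pl'.buckets C') (hτ : StepsOk (idBits P sp n) τ)
    (hv : StepsValid τ C) (hv' : StepsValid τ C')
    (hvisit : ∀ u, 2 ^ height n ≤ u → u < 2 ^ (height n + 1) →
      ∃ σ ∈ τ, u = loc P sp n σ.2.1 (height n))
    (hC : runContents τ C = runContents τ C') :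
    (∀ v, 1 ≤ v → v < 2 ^ (height n + 1) →
      (runPlacement P sp n τ pl).buckets v = (runPlacement P sp n τ pl').buckets v) ∧
    (runPlacement P sp n τ pl).stash = (runPlacement P sp n τ pl').stash := by
  have hT := height_le_idBits P sp n
  have h0 : AgreeSettled P sp n (fun _ => False) C C' pl.buckets pl'.buckets := by
    intro t v ht hv1 hv2 hs
    -- before the first of these operations no node is settled
    refine absurd (hs.1 (v * 2 ^ (height n - t)) ?_ ?_ ?_) (by simp)
    · calc 2 ^ height n = 2 ^ t * 2 ^ (height n - t) := by rw [← pow_add]; congr 1; omega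
        _ ≤ _ := Nat.mul_le_mul_right _ hv1
    · calc v * 2 ^ (height n - t) < 2 ^ (t + 1) * 2 ^ (height n - t) :=
          Nat.mul_lt_mul_of_pos_right hv2 (by positivity)
        _ = _ := by rw [← pow_add]; congr 1; omega
    · exact Nat.mul_div_cancel _ (by positivity)
  have h1 := h0.run hc hc' hτ hv hv'
  have hbk : ∀ v, 1 ≤ v → v < 2 ^ (height n + 1) →
      (runPlacement P sp n τ pl).buckets v = (runPlacement P sp n τ pl').buckets v := by
    intro v hv1 hv2
    have hlog := Nat.lt_pow_succ_log_self (b := 2) (by norm_num) v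
    have hlog' := Nat.pow_log_le_self 2 (x := v) (by omega)
    refine h1 (Nat.log 2 v) v ?_ hlog' hlog ⟨fun u hu1 hu2 _ => .inr (hvisit u hu1 hu2),
      fun id _ => by rw [hC]⟩
    have := (Nat.pow_lt_pow_iff_right (a := 2) (by norm_num)).1 (hlog'.trans_lt hv2)
    omega
  refine ⟨hbk, Std.ExtTreeMap.ext_getElem? fun id => ?_⟩
  have hr := hc.run hτ hv
  have hr' := hc'.run hτ hv'
  by_cases hnone : runContents τ C id = none
  · rw [(hr.eq_nil_of_none hnone).1, (hr'.eq_nil_of_none (hC ▸ hnone)).1]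
  have hid := hr.proper id hnone
  have h2 := hr.makesUp id
  have h3 := hr'.makesUp id
  have hp : pathPieces P sp n (runPlacement P sp n τ pl).buckets id
      = pathPieces P sp n (runPlacement P sp n τ pl').buckets id := by
    refine List.flatMap_congr fun t ht => ?_
    rw [List.mem_range] at ht
    have hb := loc_bounds (t := t) (by omega) hid
    rw [hbk _ (Nat.one_le_two_pow.trans hb.1)
      (hb.2.trans_le (Nat.pow_le_pow_right (by norm_num) (by omega)))]
  rw [hp] at h2
  rw [← hC] at h3
  exact h2.unique h3

end VORAM

namespace VORAM

variable {E : SymEnc} {P : Params} {sp n : ℕ}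

/-! ### Sampling the identifiers in advance -/

variable (P sp n) in
/-- A table with independent random identifiers for the labels in the list, stored or not. -/
def sampleTable : List ℕ → PMF (ℕ → ℕ)
  | [] => PMF.pure fun _ => 0
  | l :: L => (sampleTable L).bind fun κ => (idgen P sp n).map fun id => Function.update κ l id

variable (P sp n) in
/-- A list of independent random identifiers. -/
def sampleList : ℕ → PMF (List ℕ)
  | 0 => PMF.pure []
  | k + 1 => (idgen P sp n).bind fun x => (sampleList k).map fun xs => x :: xs

/-- Replacing an entry of a random table by a fresh identifier makes the old entry independent of
the table. -/
theorem sampleTable_swap {β : Type} {L : List ℕ} {l : ℕ} (hl : l ∈ L)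
    (g : ℕ → (ℕ → ℕ) → PMF β) :
    ((sampleTable P sp n L).bind fun κ => (idgen P sp n).bind fun id =>
        g (κ l) (Function.update κ l id))
      = (idgen P sp n).bind fun x => (sampleTable P sp n L).bind fun κ => g x κ := by
  induction L generalizing g with
  | nil => simp at hl
  | cons m L ih =>
    simp only [sampleTable, PMF.bind_bind, PMF.bind_map, Function.comp_def]
    rw [PMF.bind_comm (idgen P sp n) (sampleTable P sp n L)]
    by_cases hlm : l = m
    · subst hlm
      simp only [Function.update_self, Function.update_idem]
    · have hl' : l ∈ L := by simpa [hlm] using hl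
      simp only [Function.update_of_ne hlm]
      have h := ih hl' fun x κ => (idgen P sp n).bind fun a => g x (Function.update κ m a)
      rw [PMF.bind_comm (idgen P sp n) (sampleTable P sp n L)] at h
      rw [← h]
      congr 1
      funext κ
      rw [PMF.bind_comm]
      simp only [Function.update_comm hlm]

variable (P sp n) in
/-- The operations use the identifiers of their labels in the table `κ` and assign new random
identifiers to these labels. -/
def drawSteps : List Op → (ℕ → ℕ) → PMF (List Step)
  | [], _ => PMF.pure []
  | o :: os, κ => (idgen P sp n).bind fun id =>
      (drawSteps os (Function.update κ o.label id)).map fun τ => (o, κ o.label, id) :: τ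

/-- The table of identifiers before some operations, given the identifiers `xs` that they use and
the final table `y`. -/
def tableBefore : List Op → List ℕ → (ℕ → ℕ) → ℕ → ℕ
  | o :: os, x :: xs, y => Function.update (tableBefore os xs y) o.label x
  | _, _, y => y

/-- The operations with their identifiers, given the identifiers `xs` that they use and the final
table `y`. -/
def schedule : List Op → List ℕ → (ℕ → ℕ) → List Step
  | o :: os, x :: xs, y => (o, x, tableBefore os xs y o.label) :: schedule os xs y
  | _, _, _ => []

theorem tableBefore_append {os os' : List Op} {xs xs' : List ℕ} (h : os.length = xs.length)
    (y : ℕ → ℕ) :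
    tableBefore (os ++ os') (xs ++ xs') y = tableBefore os xs (tableBefore os' xs' y) := by
  induction os generalizing xs with
  | nil =>
    obtain rfl : xs = [] := List.length_eq_zero_iff.1 h.symm
    simp [tableBefore]
  | cons o os ih =>
    cases xs with
    | nil => simp at h
    | cons x xs => simp only [List.cons_append, tableBefore, ih (Nat.succ.inj h)]

theorem schedule_append {os os' : List Op} {xs xs' : List ℕ} (h : os.length = xs.length)
    (y : ℕ → ℕ) :
    schedule (os ++ os') (xs ++ xs') y
      = schedule os xs (tableBefore os' xs' y) ++ schedule os' xs' y := by
  induction os generalizing xs with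
  | nil =>
    obtain rfl : xs = [] := List.length_eq_zero_iff.1 h.symm
    simp [schedule]
  | cons o os ih =>
    cases xs with
    | nil => simp at h
    | cons x xs =>
      simp only [List.cons_append, schedule, tableBefore_append (Nat.succ.inj h),
        ih (Nat.succ.inj h)]

theorem map_path_schedule {os : List Op} {xs : List ℕ} (h : os.length = xs.length) (y : ℕ → ℕ) :
    (schedule os xs y).map (fun σ => σ.2.1) = xs := by
  induction os generalizing xs with
  | nil =>
    obtain rfl : xs = [] := List.length_eq_zero_iff.1 h.symm
    rfl
  | cons o os ih =>
    cases xs with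
    | nil => simp at h
    | cons x xs => simp only [schedule, List.map_cons, ih (Nat.succ.inj h)]

/-- The identifiers used by the operations and those in the final table are independent, whatever
the operations are. -/
theorem drawSteps_eq {β : Type} {L : List ℕ} (os : List Op) (hL : ∀ o ∈ os, o.label ∈ L)
    (g : (ℕ → ℕ) → List Step → PMF β) :
    ((sampleTable P sp n L).bind fun κ => (drawSteps P sp n os κ).bind fun τ => g κ τ)
      = (sampleTable P sp n L).bind fun y => (sampleList P sp n os.length).bind fun xs =>
          g (tableBefore os xs y) (schedule os xs y) := by
  induction os generalizing g with
  | nil => simp [drawSteps, sampleList, tableBefore, schedule, PMF.pure_bind]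
  | cons o os ih =>
    simp only [drawSteps, PMF.bind_bind, PMF.bind_map, Function.comp_def, List.length_cons,
      sampleList, tableBefore, schedule]
    have h := sampleTable_swap (P := P) (sp := sp) (n := n) (hL o (by simp)) fun x κ =>
      (drawSteps P sp n os κ).bind fun τ =>
        g (Function.update κ o.label x) ((o, x, κ o.label) :: τ)
    simp only [Function.update_self, Function.update_idem, Function.update_eq_self] at h
    rw [h, PMF.bind_comm (sampleTable P sp n L)]
    congr 1
    funext x
    exact ih (fun o ho => hL o (by simp [ho])) fun κ τ =>
      g (Function.update κ o.label x) ((o, x, κ o.label) :: τ)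

/-- The current identifiers, and for labels that are not in use those of the table `κ`. -/
def override (κ : ℕ → ℕ) (ids : Std.ExtTreeMap ℕ ℕ) (l : ℕ) : ℕ := (ids[l]?).getD (κ l)

theorem override_insert (κ : ℕ → ℕ) (ids : Std.ExtTreeMap ℕ ℕ) (l id : ℕ) :
    override κ (ids.insert l id) = Function.update (override κ ids) l id := by
  funext m
  rw [override, getElem?_insert_eq]
  by_cases hm : m = l
  · rw [hm, if_pos rfl, Function.update_self]
    rfl
  · rw [if_neg hm, Function.update_of_ne hm]
    rfl

theorem override_erase (κ : ℕ → ℕ) (ids : Std.ExtTreeMap ℕ ℕ) (l id : ℕ) :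
    override (Function.update κ l id) (ids.erase l) = Function.update (override κ ids) l id := by
  funext m
  rw [override, getElem?_erase_eq]
  by_cases hm : m = l
  · rw [hm, if_pos rfl, Function.update_self, Function.update_self]
    rfl
  · rw [if_neg hm, Function.update_of_ne hm, Function.update_of_ne hm]
    rfl

theorem override_update (κ : ℕ → ℕ) (ids : Std.ExtTreeMap ℕ ℕ) (l z id : ℕ) :
    Function.update (override (Function.update κ l z) ids) l id
      = Function.update (override κ ids) l id := by
  funext m
  by_cases hm : m = l
  · rw [hm, Function.update_self, Function.update_self]
  · rw [Function.update_of_ne hm, Function.update_of_ne hm, override, override,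
      Function.update_of_ne hm]

theorem ids_of_mem_support_execStep {s : State sp n} {σ : Step} {r : State sp n × List Access}
    (hr : r ∈ (execStep E P s σ).support) : r.1.ids = changeTable σ.2.2 s.ids σ.1 := by
  simp only [execStep, writeback, PMF.mem_support_map_iff] at hr
  obtain ⟨r', ⟨r'', -, rfl⟩, rfl⟩ := hr
  rfl

theorem effect_label {d d' : Blocks} {o : Op} (h : effect d o = some d') :
    match o with
      | .insert l blk => l ∉ d ∧ d' = d.insert l blk
      | .remove l => l ∈ d ∧ d' = d.erase l
      | .update l f => l ∈ d ∧ d' = d.insert l (f (d.getD l [])) := by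
  cases o with
  | insert l blk =>
    rw [effect] at h
    split_ifs at h with hl
    exact ⟨hl, (Option.some.inj h).symm⟩
  | remove l =>
    rw [effect] at h
    split_ifs at h with hl
    exact ⟨hl, (Option.some.inj h).symm⟩
  | update l f =>
    rw [effect] at h
    split_ifs at h with hl
    exact ⟨hl, (Option.some.inj h).symm⟩

theorem mem_insert_iff {β : Type} (m : Std.ExtTreeMap ℕ β) (k a : ℕ) (v : β) :
    a ∈ m.insert k v ↔ a = k ∨ a ∈ m := by
  rw [mem_iff_getElem?, mem_iff_getElem?, getElem?_insert_eq]
  split_ifs with h <;> simp [h]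

theorem mem_erase_iff {β : Type} (m : Std.ExtTreeMap ℕ β) (k a : ℕ) :
    a ∈ m.erase k ↔ a ≠ k ∧ a ∈ m := by
  rw [mem_iff_getElem?, mem_iff_getElem?, getElem?_erase_eq]
  split_ifs with h <;> simp [h]

theorem mem_changeTable {d d' : Blocks} {o : Op} (h : effect d o = some d')
    {ids : Std.ExtTreeMap ℕ ℕ} (hids : ∀ l, l ∈ ids ↔ l ∈ d) (id l : ℕ) :
    l ∈ changeTable id ids o ↔ l ∈ d' := by
  have h' := effect_label h
  cases o with
  | insert l blk => simp only [changeTable, h'.2, mem_insert_iff, hids]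
  | remove l => simp only [changeTable, h'.2, mem_erase_iff, hids]
  | update l f => simp only [changeTable, h'.2, mem_insert_iff, hids]

variable (E P) in
/-- Execution of a sequence of operations of the vORAM. -/
def execOps (os : List Op) (s : State sp n) : PMF (State sp n × List (List Access)) :=
  (vORAM E P).execAll (sp := sp) (n := n) os s

theorem execOps_cons (o : Op) (os : List Op) (s : State sp n) :
    execOps E P (o :: os) s = (exec E P s o).bind fun r =>
      (execOps E P os r.1).map fun r' => (r'.1, r.2 :: r'.2) := rfl

/-- Drawing the identifiers when they are needed amounts to drawing a table for all labels first. -/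
theorem execOps_eq {L : List ℕ} (os : List Op) (hL : ∀ o ∈ os, o.label ∈ L) {d d' : Blocks}
    (hos : os.foldlM effect d = some d') (s : State sp n) (hs : ∀ l, l ∈ s.ids ↔ l ∈ d) :
    execOps E P os s
      = (sampleTable P sp n L).bind fun κ => (drawSteps P sp n os (override κ s.ids)).bind fun τ =>
          execSteps E P τ s := by
  induction os generalizing d s with
  | nil =>
    simp only [drawSteps, PMF.pure_bind, execSteps, PMF.bind_const]
    rfl
  | cons o os ih =>
    rw [List.foldlM_cons] at hos
    obtain ⟨d₁, hd₁, hos⟩ := Option.bind_eq_some_iff.1 hos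
    have hlab := effect_label hd₁
    have ho := hL o (by simp)
    let G : ℕ → ℕ → (ℕ → ℕ) → PMF (State sp n × List (List Access)) := fun x id κ =>
      (execStep E P s (o, x, id)).bind fun r => (drawSteps P sp n os κ).bind fun τ =>
        (execSteps E P τ r.1).map fun r' => (r'.1, r.2 :: r'.2)
    have hrhs : ((sampleTable P sp n L).bind fun κ =>
        (drawSteps P sp n (o :: os) (override κ s.ids)).bind fun τ => execSteps E P τ s)
        = (sampleTable P sp n L).bind fun κ => (idgen P sp n).bind fun id =>
          G (override κ s.ids o.label) id (Function.update (override κ s.ids) o.label id) := by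
      simp only [drawSteps, PMF.bind_bind, PMF.bind_map, Function.comp_def, execSteps, G]
      congr 1
      funext κ
      congr 1
      funext id
      rw [PMF.bind_comm]
    have hstep : ∀ x id, ((execStep E P s (o, x, id)).bind fun r =>
        (execOps E P os r.1).map fun r' => (r'.1, r.2 :: r'.2))
        = (sampleTable P sp n L).bind fun κ => G x id (override κ (changeTable id s.ids o)) := by
      intro x id
      rw [PMF.bind_comm]
      refine PMF.bind_congr _ fun r hr => ?_
      have hids := ids_of_mem_support_execStep hr
      rw [ih (fun o ho => hL o (by simp [ho])) hos r.1 fun l => by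
        rw [hids]
        exact mem_changeTable hd₁ hs id l, hids]
      simp only [PMF.map_bind]
    rw [hrhs]
    rw [execOps_cons]
    cases o with
    | insert l blk =>
      have hexec : exec E P s (.insert l blk) = (idgen P sp n).bind fun x =>
          (idgen P sp n).bind fun id => execStep E P s (.insert l blk, x, id) := rfl
      simp only [hexec, PMF.bind_bind, hstep]
      have hl : s.ids[l]? = none := by
        rw [← Option.not_isSome_iff_eq_none, ← Std.ExtTreeMap.mem_iff_isSome_getElem?, hs]
        exact hlab.1
      have hov : ∀ κ, override κ s.ids l = κ l := fun κ => by rw [override, hl]; rfl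
      have h := sampleTable_swap (P := P) (sp := sp) (n := n) ho fun x κ =>
        (idgen P sp n).bind fun id => G x id (Function.update (override κ s.ids) l id)
      simp only [Op.label, override_update, PMF.bind_const] at h
      simp only [Op.label, hov, h, changeTable, override_insert]
      congr 1
      funext x
      rw [PMF.bind_comm]
    | remove l =>
      obtain ⟨x, hx⟩ := (mem_iff_getElem? _ _).1 ((hs l).2 hlab.1)
      have hexec : exec E P s (.remove l) = execStep E P s (.remove l, x, 0) := by
        simp only [exec, hx]
        rfl
      have hov : ∀ κ, override κ s.ids l = x := fun κ => by rw [override, hx]; rfl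
      simp only [hexec, hstep, Op.label, hov, changeTable]
      have h := sampleTable_swap (P := P) (sp := sp) (n := n) ho fun _ κ =>
        G x 0 (override κ (s.ids.erase l))
      simp only [Op.label, override_erase, PMF.bind_const] at h
      exact h.symm
    | update l f =>
      obtain ⟨x, hx⟩ := (mem_iff_getElem? _ _).1 ((hs l).2 hlab.1)
      have hexec : exec E P s (.update l f) = (idgen P sp n).bind fun id =>
          execStep E P s (.update l f, x, id) := by
        simp only [exec, hx]
        rfl
      have hov : ∀ κ, override κ s.ids l = x := fun κ => by rw [override, hx]; rfl
      simp only [hexec, PMF.bind_bind, hstep, Op.label, hov, changeTable, override_insert]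
      rw [PMF.bind_comm]

/-! ### Identifiers without collisions -/

/-- The identifiers in the final table and the used identifiers are all different. -/
def Distinct (L : List ℕ) (y : ℕ → ℕ) (xs : List ℕ) : Prop :=
  Set.InjOn y {l | l ∈ L} ∧ xs.Nodup ∧ ∀ x ∈ xs, x ∉ L.map y

/-- How the stored data `d`, the table `κ`, the blocks `C` by identifier and the table `ids` of
the identifiers in use correspond. -/
structure Corresponds (L : List ℕ) (d : Blocks) (κ : ℕ → ℕ) (C : ℕ → Option (List Bool))
    (ids : Std.ExtTreeMap ℕ ℕ) : Prop where
  mem : ∀ l ∈ d, l ∈ L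
  table : ∀ l, ids[l]? = d[l]?.map fun _ => κ l
  content : ∀ l B, d[l]? = some B → C (κ l) = some B
  exists_label : ∀ id, C id ≠ none → ∃ l ∈ d, κ l = id

/-- Without collisions, each earlier table is injective, and its entries are among those that are
drawn. -/
theorem tableBefore_distinct {L : List ℕ} {y : ℕ → ℕ} {os : List Op} {xs : List ℕ}
    (hlen : os.length = xs.length) (h : Distinct L y xs) :
    Set.InjOn (tableBefore os xs y) {l | l ∈ L} ∧
      ∀ l ∈ L, tableBefore os xs y l ∈ xs ∨ tableBefore os xs y l ∈ L.map y := by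
  induction os generalizing xs with
  | nil =>
    obtain rfl : xs = [] := List.length_eq_zero_iff.1 hlen.symm
    exact ⟨h.1, fun l hl => .inr (List.mem_map_of_mem hl)⟩
  | cons o os ih =>
    cases xs with
    | nil => simp at hlen
    | cons x xs =>
      obtain ⟨hy, hnd, hdis⟩ := h
      rw [List.nodup_cons] at hnd
      obtain ⟨h1, h2⟩ := ih (Nat.succ.inj hlen)
        ⟨hy, hnd.2, fun x hx => hdis x (List.mem_cons_of_mem _ hx)⟩
      have hx : ∀ l ∈ L, tableBefore os xs y l ≠ x := fun l hl he => by
        rcases h2 l hl with h | h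
        · exact hnd.1 (he ▸ h)
        · exact hdis x (by simp) (he ▸ h)
      rw [tableBefore]
      constructor
      · intro a ha b hb hab
        by_cases ha' : a = o.label <;> by_cases hb' : b = o.label
        · rw [ha', hb']
        · rw [ha', Function.update_self, Function.update_of_ne hb'] at hab
          exact absurd hab.symm (hx b hb)
        · rw [hb', Function.update_self, Function.update_of_ne ha'] at hab
          exact absurd hab (hx a ha)
        · rw [Function.update_of_ne ha', Function.update_of_ne hb'] at hab
          exact h1 ha hb hab
      · intro l hl
        by_cases hl' : l = o.label
        · rw [hl', Function.update_self]
          exact .inl (by simp)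
        · rw [Function.update_of_ne hl']
          exact (h2 l hl).imp_left fun h => List.mem_cons_of_mem _ h

/-- An operation whose identifiers do not collide is valid and keeps the correspondence. -/
theorem Corresponds.step {L : List ℕ} {d d' : Blocks} {κ : ℕ → ℕ} {C : ℕ → Option (List Bool)}
    {ids : Std.ExtTreeMap ℕ ℕ} {o : Op} {x : ℕ}
    (h : Corresponds L d (Function.update κ o.label x) C ids)
    (ho : effect d o = some d') (hL : o.label ∈ L) (hκ : Set.InjOn κ {l | l ∈ L})
    (hx : ∀ l ∈ L, κ l ≠ x) :
    StepValid C (o, x, κ o.label) ∧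
      Corresponds L d' κ (changeContents x (κ o.label) C o) (changeTable (κ o.label) ids o) := by
  have hlab := effect_label ho
  have hnew : C (κ o.label) = none := by
    by_contra hne
    obtain ⟨l, hl, he⟩ := h.exists_label _ hne
    by_cases hlo : l = o.label
    · rw [hlo, Function.update_self] at he
      exact hx _ hL he.symm
    · rw [Function.update_of_ne hlo] at he
      exact hlo (hκ (h.mem l hl) hL he)
  have hxne := hx _ hL
  -- a stored block under another label keeps its identifier
  have hother : ∀ l, l ≠ o.label → l ∈ d → κ l ≠ κ o.label ∧ κ l ≠ x := fun l hl hd =>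
    ⟨fun he => hl (hκ (h.mem l hd) hL he), hx l (h.mem l hd)⟩
  have hcont : ∀ l, l ≠ o.label → ∀ B, d[l]? = some B → C (κ l) = some B := fun l hl B hB => by
    have := h.content l B hB
    rwa [Function.update_of_ne hl] at this
  have htab : ∀ l, l ≠ o.label → ids[l]? = d[l]?.map fun _ => κ l := fun l hl => by
    have := h.table l
    rwa [Function.update_of_ne hl] at this
  have hex : ∀ id, C id ≠ none → id ≠ x → ∃ l ∈ d, l ≠ o.label ∧ κ l = id := fun id hid hidx => by
    obtain ⟨l, hl, he⟩ := h.exists_label id hid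
    by_cases hlo : l = o.label
    · rw [hlo, Function.update_self] at he
      exact absurd he.symm hidx
    · rw [Function.update_of_ne hlo] at he
      exact ⟨l, hl, hlo, he⟩
  have hstored : o.label ∈ d → ∃ B, d[o.label]? = some B ∧ C x = some B := fun hd => by
    obtain ⟨B, hB⟩ := (mem_iff_getElem? _ _).1 hd
    have := h.content _ B hB
    rw [Function.update_self] at this
    exact ⟨B, hB, this⟩
  cases o with
  | insert l blk =>
    simp only [Op.label] at *
    obtain ⟨hld, rfl⟩ := hlab
    refine ⟨⟨hnew, trivial⟩, fun m hm => ?_, fun m => ?_, fun m B hB => ?_, fun id hid => ?_⟩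
    · rcases (mem_insert_iff _ _ _ _).1 hm with rfl | hm
      · exact hL
      · exact h.mem m hm
    · rw [changeTable, getElem?_insert_eq, getElem?_insert_eq]
      split_ifs with hml
      · rw [hml]; rfl
      · exact htab m hml
    · rw [getElem?_insert_eq] at hB
      rw [changeContents]
      split_ifs at hB with hml
      · rw [hml, Function.update_self, hB]
      · rw [Function.update_of_ne (hother m hml ((mem_iff_getElem? _ _).2 ⟨B, hB⟩)).1]
        exact hcont m hml B hB
    · rw [changeContents] at hid
      by_cases hidl : id = κ l
      · exact ⟨l, (mem_insert_iff _ _ _ _).2 (.inl rfl), hidl.symm⟩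
      · rw [Function.update_of_ne hidl] at hid
        obtain ⟨m, hm, he⟩ := h.exists_label id hid
        have hml : m ≠ l := by
          rintro rfl
          exact hld hm
        rw [Function.update_of_ne hml] at he
        exact ⟨m, (mem_insert_iff _ _ _ _).2 (.inr hm), he⟩
  | remove l =>
    simp only [Op.label] at *
    obtain ⟨hld, rfl⟩ := hlab
    obtain ⟨B₀, hB₀, hCx⟩ := hstored hld
    refine ⟨⟨hnew, by simp [hCx]⟩, fun m hm => h.mem m ((mem_erase_iff _ _ _).1 hm).2, fun m => ?_,
      fun m B hB => ?_, fun id hid => ?_⟩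
    · rw [changeTable, getElem?_erase_eq, getElem?_erase_eq]
      split_ifs with hml
      · rfl
      · exact htab m hml
    · rw [getElem?_erase_eq] at hB
      rw [changeContents]
      split_ifs at hB with hml
      rw [Function.update_of_ne (hother m hml ((mem_iff_getElem? _ _).2 ⟨B, hB⟩)).2]
      exact hcont m hml B hB
    · rw [changeContents] at hid
      by_cases hidx : id = x
      · rw [hidx, Function.update_self] at hid
        exact absurd rfl hid
      · rw [Function.update_of_ne hidx] at hid
        obtain ⟨m, hm, hml, he⟩ := hex id hid hidx
        exact ⟨m, (mem_erase_iff _ _ _).2 ⟨hml, hm⟩, he⟩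
  | update l f =>
    simp only [Op.label] at *
    obtain ⟨hld, rfl⟩ := hlab
    obtain ⟨B₀, hB₀, hCx⟩ := hstored hld
    refine ⟨⟨hnew, by simp [hCx]⟩, fun m hm => ?_, fun m => ?_, fun m B hB => ?_, fun id hid => ?_⟩
    · rcases (mem_insert_iff _ _ _ _).1 hm with rfl | hm
      · exact hL
      · exact h.mem m hm
    · rw [changeTable, getElem?_insert_eq, getElem?_insert_eq]
      split_ifs with hml
      · rw [hml]; rfl
      · exact htab m hml
    · rw [getElem?_insert_eq] at hB
      rw [changeContents]
      split_ifs at hB with hml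
      · rw [hml, Function.update_self, ← hB, hCx, Std.ExtTreeMap.getD_eq_getD_getElem?, hB₀]
      · have hmo := hother m hml ((mem_iff_getElem? _ _).2 ⟨B, hB⟩)
        rw [Function.update_of_ne hmo.1, Function.update_of_ne hmo.2]
        exact hcont m hml B hB
    · rw [changeContents] at hid
      by_cases hidl : id = κ l
      · exact ⟨l, (mem_insert_iff _ _ _ _).2 (.inl rfl), hidl.symm⟩
      rw [Function.update_of_ne hidl] at hid
      by_cases hidx : id = x
      · rw [hidx, Function.update_self] at hid
        exact absurd rfl hid
      · rw [Function.update_of_ne hidx] at hid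
        obtain ⟨m, hm, hml, he⟩ := hex id hid hidx
        exact ⟨m, (mem_insert_iff _ _ _ _).2 (.inr hm), he⟩

theorem Corresponds.run {L : List ℕ} {d d' : Blocks} {C : ℕ → Option (List Bool)}
    {ids : Std.ExtTreeMap ℕ ℕ} {os : List Op} {xs : List ℕ} {y : ℕ → ℕ}
    (h : Corresponds L d (tableBefore os xs y) C ids) (hlen : os.length = xs.length)
    (hos : os.foldlM effect d = some d') (hL : ∀ o ∈ os, o.label ∈ L) (hd : Distinct L y xs) :
    StepsValid (schedule os xs y) C ∧
      Corresponds L d' y (runContents (schedule os xs y) C)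
        ((schedule os xs y).foldl (fun ids σ => changeTable σ.2.2 ids σ.1) ids) := by
  induction os generalizing xs d C ids with
  | nil =>
    obtain rfl : d = d' := by simpa using hos
    exact ⟨trivial, h⟩
  | cons o os ih =>
    cases xs with
    | nil => simp at hlen
    | cons x xs =>
      rw [List.foldlM_cons] at hos
      obtain ⟨d₁, hd₁, hos⟩ := Option.bind_eq_some_iff.1 hos
      obtain ⟨hy, hnd, hdis⟩ := hd
      rw [List.nodup_cons] at hnd
      have hd' : Distinct L y xs :=
        ⟨hy, hnd.2, fun x hx => hdis x (List.mem_cons_of_mem _ hx)⟩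
      obtain ⟨h1, h2⟩ := tableBefore_distinct (Nat.succ.inj hlen) hd' (os := os)
      obtain ⟨hv, hc⟩ := Corresponds.step (κ := tableBefore os xs y) h hd₁ (hL o (by simp)) h1
        fun l hl he => by
          rcases h2 l hl with h | h
          · exact hnd.1 (he ▸ h)
          · exact hdis x (by simp) (he ▸ h)
      obtain ⟨hv', hc'⟩ := ih hc (Nat.succ.inj hlen) hos (fun o ho => hL o (by simp [ho])) hd'
      exact ⟨⟨hv, hv'⟩, hc'⟩

/-- The stored data and the table of identifiers determine the rest. -/
theorem Corresponds.unique {L : List ℕ} {d : Blocks} {κ : ℕ → ℕ} {C C' : ℕ → Option (List Bool)}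
    {ids ids' : Std.ExtTreeMap ℕ ℕ} (h : Corresponds L d κ C ids) (h' : Corresponds L d κ C' ids') :
    C = C' ∧ ids = ids' := by
  refine ⟨funext fun id => ?_, Std.ExtTreeMap.ext_getElem? fun l => by rw [h.table, h'.table]⟩
  by_cases hex : ∃ l ∈ d, κ l = id
  · obtain ⟨l, hl, rfl⟩ := hex
    obtain ⟨B, hB⟩ := (mem_iff_getElem? _ _).1 hl
    rw [h.content l B hB, h'.content l B hB]
  · have h1 : C id = none := by
      by_contra hne
      exact hex (h.exists_label id hne)
    have h2 : C' id = none := by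
      by_contra hne
      exact hex (h'.exists_label id hne)
    rw [h1, h2]

theorem corresponds_empty (L : List ℕ) (κ : ℕ → ℕ) :
    Corresponds L ∅ κ (fun _ => none) ∅ where
  mem := by simp
  table := by simp
  content := by simp
  exists_label := by simp

end VORAM

namespace VORAM

variable {P : Params} {sp n : ℕ}

/-! ### Probabilities of the bad events -/

open Classical in
/-- The indicator of an event. -/
def ind (p : Prop) : ℝ≥0∞ := if p then 1 else 0

theorem ind_of_true {p : Prop} (h : p) : ind p = 1 := if_pos h

theorem ind_of_false {p : Prop} (h : ¬p) : ind p = 0 := if_neg h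

theorem ind_mono {p q : Prop} (h : p → q) : ind p ≤ ind q := by
  by_cases hp : p
  · rw [ind_of_true hp, ind_of_true (h hp)]
  · rw [ind_of_false hp]; exact zero_le

theorem ind_le_add {p q r : Prop} (h : p → q ∨ r) : ind p ≤ ind q + ind r := by
  by_cases hp : p
  · rw [ind_of_true hp]
    rcases h hp with h | h
    · rw [ind_of_true h]; exact le_self_add
    · rw [ind_of_true h]; exact le_add_self
  · rw [ind_of_false hp]; exact zero_le

theorem ind_exists_le_sum {ι : Type} (s : Finset ι) (p : ι → Prop) :
    ind (∃ i ∈ s, p i) ≤ ∑ i ∈ s, ind (p i) := by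
  by_cases h : ∃ i ∈ s, p i
  · obtain ⟨i, hi, hp⟩ := h
    rw [ind_of_true ⟨i, hi, hp⟩, ← ind_of_true hp]
    exact Finset.single_le_sum (f := fun i => ind (p i)) (fun _ _ => zero_le) hi
  · rw [ind_of_false h]; exact zero_le

theorem mean_finset_sum {α ι : Type} (p : PMF α) (s : Finset ι) (f : ι → α → ℝ≥0∞) :
    (p.mean fun a => ∑ i ∈ s, f i a) = ∑ i ∈ s, p.mean (f i) := by
  classical
  induction s using Finset.induction_on with
  | empty => simp [PMF.mean]
  | insert i s hi ih => simp only [Finset.sum_insert hi, PMF.mean_add, ih]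

theorem mean_map {α β : Type} (p : PMF α) (g : α → β) (f : β → ℝ≥0∞) :
    (p.map g).mean f = p.mean fun a => f (g a) := by
  rw [← PMF.bind_pure_comp, PMF.mean_bind]
  simp [PMF.mean_pure]

theorem mean_idgen (f : ℕ → ℝ≥0∞) :
    (idgen P sp n).mean f = ((2 : ℝ≥0∞) ^ idBits P sp n)⁻¹ *
      ∑ r ∈ Finset.range (2 ^ idBits P sp n), f (2 ^ idBits P sp n + r) := by
  rw [idgen, mean_map, PMF.mean, tsum_fintype, Finset.mul_sum, Finset.sum_range]
  simp [PMF.uniformOfFintype_apply]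

theorem isId_of_mem_support_idgen {id : ℕ} (h : id ∈ (idgen P sp n).support) :
    IsId (idBits P sp n) id := by
  rw [idgen, PMF.mem_support_map_iff] at h
  obtain ⟨r, -, rfl⟩ := h
  refine ⟨Nat.le_add_right _ _, ?_⟩
  have := r.2
  rw [pow_succ]
  omega

theorem mean_idgen_mem_le (A : List ℕ) :
    (idgen P sp n).mean (fun id => ind (id ∈ A)) ≤ A.length * ((2 : ℝ≥0∞) ^ idBits P sp n)⁻¹ := by
  have h1 : ∀ a, (idgen P sp n).mean (fun id => ind (id = a)) ≤ ((2 : ℝ≥0∞) ^ idBits P sp n)⁻¹ := by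
    intro a
    rw [mean_idgen]
    refine (mul_le_mul_right ?_ _).trans (mul_one _).le
    by_cases ha : 2 ^ idBits P sp n ≤ a
    · refine (Finset.sum_le_sum (g := fun r => if r = a - 2 ^ idBits P sp n then 1 else 0)
        fun r _ => ?_).trans ?_
      · by_cases hr : 2 ^ idBits P sp n + r = a
        · rw [ind_of_true hr, if_pos (by omega)]
        · rw [ind_of_false hr]; exact zero_le
      · rw [Finset.sum_ite_eq']
        split_ifs <;> simp
    · rw [Finset.sum_eq_zero fun r _ => ind_of_false (by omega)]
      exact zero_le
  induction A with
  | nil => simp [ind, PMF.mean]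
  | cons a A ih =>
    calc (idgen P sp n).mean (fun id => ind (id ∈ a :: A))
        ≤ (idgen P sp n).mean fun id => ind (id = a) + ind (id ∈ A) :=
          PMF.mean_mono _ fun id _ => ind_le_add (by simp)
      _ ≤ ((2 : ℝ≥0∞) ^ idBits P sp n)⁻¹ + A.length * ((2 : ℝ≥0∞) ^ idBits P sp n)⁻¹ := by
          rw [PMF.mean_add]
          exact add_le_add (h1 a) ih
      _ = _ := by
          rw [List.length_cons]
          push_cast
          ring

theorem mean_sampleTable_not_injOn_le {L : List ℕ} (hL : L.Nodup) :
    (sampleTable P sp n L).mean (fun κ => ind (¬Set.InjOn κ {l | l ∈ L}))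
      ≤ L.length * L.length * ((2 : ℝ≥0∞) ^ idBits P sp n)⁻¹ := by
  induction L with
  | nil => simp [sampleTable, PMF.mean_pure, ind]
  | cons l L ih =>
    rw [List.nodup_cons] at hL
    have hstep : ∀ κ : ℕ → ℕ, ∀ id, ind (¬Set.InjOn (Function.update κ l id) {m | m ∈ l :: L})
        ≤ ind (¬Set.InjOn κ {l | l ∈ L}) + ind (id ∈ L.map κ) := fun κ id => by
      refine ind_le_add fun h => ?_
      by_contra hcon
      simp only [not_or, not_not, List.mem_map, not_exists, not_and] at hcon
      refine h fun a ha b hb hab => ?_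
      by_cases hal : a = l <;> by_cases hbl : b = l
      · rw [hal, hbl]
      · rw [hal, Function.update_self, Function.update_of_ne hbl] at hab
        exact absurd hab.symm (hcon.2 b (by simpa [hbl] using hb))
      · rw [hbl, Function.update_self, Function.update_of_ne hal] at hab
        exact absurd hab (hcon.2 a (by simpa [hal] using ha))
      · rw [Function.update_of_ne hal, Function.update_of_ne hbl] at hab
        exact hcon.1 (by simpa [hal] using ha) (by simpa [hbl] using hb) hab
    rw [sampleTable, PMF.mean_bind]
    simp only [mean_map]
    calc (sampleTable P sp n L).mean (fun κ => (idgen P sp n).mean fun id =>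
          ind (¬Set.InjOn (Function.update κ l id) {m | m ∈ l :: L}))
        ≤ (sampleTable P sp n L).mean fun κ => ind (¬Set.InjOn κ {l | l ∈ L}) +
            L.length * ((2 : ℝ≥0∞) ^ idBits P sp n)⁻¹ := by
          refine PMF.mean_mono _ fun κ _ => (PMF.mean_mono _ fun id _ => hstep κ id).trans ?_
          rw [PMF.mean_add, PMF.mean_const]
          gcongr
          simpa using mean_idgen_mem_le (P := P) (sp := sp) (n := n) (L.map κ)
      _ ≤ L.length * L.length * ((2 : ℝ≥0∞) ^ idBits P sp n)⁻¹ +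
            L.length * ((2 : ℝ≥0∞) ^ idBits P sp n)⁻¹ := by
          rw [PMF.mean_add, PMF.mean_const]
          gcongr
          exact ih hL.2
      _ ≤ _ := by
          rw [← add_mul]
          gcongr
          rw [List.length_cons]
          norm_cast
          nlinarith

theorem mean_sampleList_collision_le (k : ℕ) (A : List ℕ) :
    (sampleList P sp n k).mean (fun xs => ind (¬(xs.Nodup ∧ ∀ x ∈ xs, x ∉ A)))
      ≤ k * (A.length + k) * ((2 : ℝ≥0∞) ^ idBits P sp n)⁻¹ := by
  induction k generalizing A with
  | zero => simp [sampleList, PMF.mean_pure, ind]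
  | succ k ih =>
    rw [sampleList, PMF.mean_bind]
    simp only [mean_map]
    calc (idgen P sp n).mean (fun x => (sampleList P sp n k).mean fun xs =>
          ind (¬((x :: xs).Nodup ∧ ∀ x' ∈ x :: xs, x' ∉ A)))
        ≤ (idgen P sp n).mean fun x => ind (x ∈ A) +
            k * ((A.length + 1 : ℕ) + k) * ((2 : ℝ≥0∞) ^ idBits P sp n)⁻¹ := by
          refine PMF.mean_mono _ fun x _ => (PMF.mean_mono (g := fun xs => ind (x ∈ A) +
            ind (¬(xs.Nodup ∧ ∀ x' ∈ xs, x' ∉ x :: A))) _ fun xs _ => ?_).trans ?_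
          · refine ind_le_add fun h => ?_
            by_contra hcon
            simp only [not_or, not_not] at hcon
            obtain ⟨hxA, hnd, hdis⟩ := hcon
            refine h ⟨List.nodup_cons.2 ⟨fun hx => hdis x hx (by simp), hnd⟩, fun x' hx' => ?_⟩
            rcases List.mem_cons.1 hx' with rfl | hx'
            · exact hxA
            · exact fun h => hdis x' hx' (List.mem_cons_of_mem _ h)
          · rw [PMF.mean_add, PMF.mean_const]
            gcongr
            exact ih (x :: A)
      _ ≤ A.length * ((2 : ℝ≥0∞) ^ idBits P sp n)⁻¹ +
            k * ((A.length + 1 : ℕ) + k) * ((2 : ℝ≥0∞) ^ idBits P sp n)⁻¹ := by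
          rw [PMF.mean_add, PMF.mean_const]
          gcongr
          exact mean_idgen_mem_le A
      _ ≤ _ := by
          rw [← add_mul]
          gcongr
          norm_cast
          nlinarith

/-- The leaf of a random identifier differs from a given leaf with probability at most
`1 - 2 ^ (-height)`. -/
theorem mean_idgen_leaf_ne_le {u : ℕ} (hu : 2 ^ height n ≤ u) (hu' : u < 2 ^ (height n + 1)) :
    (idgen P sp n).mean (fun id => ind (loc P sp n id (height n) ≠ u))
      ≤ 1 - ((2 : ℝ≥0∞) ^ height n)⁻¹ := by
  set b := idBits P sp n with hb
  set T := height n with hTdef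
  have hT : T ≤ b := height_le_idBits P sp n
  have heq : ((2 : ℝ≥0∞) ^ T)⁻¹ ≤ (idgen P sp n).mean fun id => ind (loc P sp n id T = u) := by
    rw [mean_idgen, ← hb]
    have hsub : (Finset.range (2 ^ (b - T))).image (fun i => (u - 2 ^ T) * 2 ^ (b - T) + i)
        ⊆ Finset.range (2 ^ b) := by
      intro r hr
      simp only [Finset.mem_image, Finset.mem_range] at hr ⊢
      obtain ⟨i, hi, rfl⟩ := hr
      have h1 : 2 ^ b = 2 ^ T * 2 ^ (b - T) := by rw [← pow_add]; congr 1; omega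
      have h2 : u - 2 ^ T + 1 ≤ 2 ^ T := by rw [pow_succ] at hu'; omega
      have h3 := Nat.mul_le_mul_right (2 ^ (b - T)) h2
      rw [add_mul, one_mul] at h3
      omega
    have hsum : ((2 ^ (b - T) : ℕ) : ℝ≥0∞) ≤ ∑ r ∈ Finset.range (2 ^ b),
        ind (loc P sp n (2 ^ b + r) T = u) := by
      refine le_trans ?_ (Finset.sum_le_sum_of_subset hsub)
      rw [Finset.sum_image fun i _ j _ h => by simpa using h]
      rw [Finset.sum_congr rfl fun i hi => ind_of_true ?_]
      · simp
      · rw [Finset.mem_range] at hi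
        have h1 : 2 ^ b = 2 ^ T * 2 ^ (b - T) := by rw [← pow_add]; congr 1; omega
        rw [loc, ← hb, h1, ← add_assoc, ← add_mul, Nat.add_sub_cancel' hu, mul_comm,
          Nat.mul_add_div (by positivity), Nat.div_eq_of_lt hi, add_zero]
    refine le_trans ?_ (mul_le_mul_right hsum _)
    rw [show b = T + (b - T) by omega, pow_add, ENNReal.mul_inv (by simp) (by simp), mul_assoc]
    simp only [Nat.add_sub_cancel_left]
    push_cast
    rw [ENNReal.inv_mul_cancel (by simp) (by simp), mul_one]
  refine ENNReal.le_sub_of_add_le_right (by simp) ?_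
  calc _ ≤ (idgen P sp n).mean (fun id => ind (loc P sp n id T ≠ u)) +
        (idgen P sp n).mean (fun id => ind (loc P sp n id T = u)) := by gcongr
    _ = (idgen P sp n).mean fun _ => 1 := by
      rw [← PMF.mean_add]
      congr 1
      funext id
      by_cases h : loc P sp n id T = u
      · rw [ind_of_true h, ind_of_false (by simp [h]), zero_add]
      · rw [ind_of_true h, ind_of_false h, add_zero]
    _ ≤ 1 := (PMF.mean_const _ _).le

theorem mean_sampleList_leaf_ne_le {u : ℕ} (hu : 2 ^ height n ≤ u) (hu' : u < 2 ^ (height n + 1))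
    (k : ℕ) :
    (sampleList P sp n k).mean (fun xs => ind (∀ x ∈ xs, loc P sp n x (height n) ≠ u))
      ≤ (1 - ((2 : ℝ≥0∞) ^ height n)⁻¹) ^ k := by
  induction k with
  | zero => simp [sampleList, PMF.mean_pure, ind]
  | succ k ih =>
    rw [sampleList, PMF.mean_bind]
    simp only [mean_map]
    calc (idgen P sp n).mean (fun x => (sampleList P sp n k).mean fun xs =>
          ind (∀ x' ∈ x :: xs, loc P sp n x' (height n) ≠ u))
        ≤ (idgen P sp n).mean fun x => ind (loc P sp n x (height n) ≠ u) *
            (1 - ((2 : ℝ≥0∞) ^ height n)⁻¹) ^ k := by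
          refine PMF.mean_mono _ fun x _ => ?_
          by_cases hx : loc P sp n x (height n) ≠ u
          · rw [ind_of_true hx, one_mul]
            exact (PMF.mean_mono _ fun xs _ => ind_mono fun h x' hx' =>
              h x' (List.mem_cons_of_mem _ hx')).trans ih
          · rw [ind_of_false hx, zero_mul]
            refine (PMF.mean_mono (g := fun _ => 0) _ fun xs _ => ?_).trans (PMF.mean_const _ _).le
            rw [ind_of_false fun h => hx (h x (by simp))]
      _ ≤ (1 - ((2 : ℝ≥0∞) ^ height n)⁻¹) * (1 - ((2 : ℝ≥0∞) ^ height n)⁻¹) ^ k := by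
          simp only [PMF.mean, ← mul_assoc, ENNReal.tsum_mul_right]
          gcongr
          exact mean_idgen_leaf_ne_le hu hu'
      _ = _ := (pow_succ' _ _).symm

theorem mean_sampleList_drop (a k : ℕ) (f : List ℕ → ℝ≥0∞) :
    (sampleList P sp n (a + k)).mean (fun xs => f (xs.drop a)) = (sampleList P sp n k).mean f := by
  induction a with
  | zero => simp
  | succ a ih =>
    rw [show a + 1 + k = a + k + 1 by ring, sampleList, PMF.mean_bind]
    simp only [mean_map, List.drop_succ_cons, ih, PMF.mean_const]

/-- With `2 ^ T (T + m)` random leaves, all `2 ^ T` leaves are visited with probability at least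
`1 - 2 ^ (-m)`. -/
theorem coupon_bound (T m k : ℕ) (hk : 2 ^ T * (T + m) ≤ k) :
    (2 : ℝ≥0∞) ^ T * (1 - ((2 : ℝ≥0∞) ^ T)⁻¹) ^ k ≤ (2⁻¹ : ℝ≥0∞) ^ m := by
  have h1 : (1 - ((2 : ℝ≥0∞) ^ T)⁻¹) ^ (2 ^ T) ≤ 2⁻¹ := by
    have hr : (1 - 1 / ((2 ^ T : ℕ) : ℝ)) ^ (2 ^ T) ≤ 1 / 2 := by
      refine (Real.one_sub_div_pow_le_exp_neg (n := 2 ^ T) (t := 1) ?_).trans ?_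
      · exact_mod_cast Nat.one_le_two_pow
      · rw [Real.exp_neg, ← one_div]
        refine one_div_le_one_div_of_le (by norm_num) ?_
        have := Real.add_one_le_exp (1 : ℝ)
        linarith
    have hnn : (0 : ℝ) ≤ 1 - 1 / ((2 ^ T : ℕ) : ℝ) := by
      rw [sub_nonneg, div_le_one (by positivity)]
      exact_mod_cast Nat.one_le_two_pow
    have e : (1 - ((2 : ℝ≥0∞) ^ T)⁻¹) = ENNReal.ofReal (1 - 1 / ((2 ^ T : ℕ) : ℝ)) := by
      rw [ENNReal.ofReal_sub _ (by positivity), ENNReal.ofReal_one, one_div,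
        ENNReal.ofReal_inv_of_pos (by positivity), ENNReal.ofReal_natCast]
      push_cast
      rfl
    rw [e, ← ENNReal.ofReal_pow hnn]
    refine (ENNReal.ofReal_le_ofReal hr).trans ?_
    rw [one_div, ENNReal.ofReal_inv_of_pos (by norm_num)]
    simp
  calc (2 : ℝ≥0∞) ^ T * (1 - ((2 : ℝ≥0∞) ^ T)⁻¹) ^ k
      ≤ (2 : ℝ≥0∞) ^ T * (1 - ((2 : ℝ≥0∞) ^ T)⁻¹) ^ (2 ^ T * (T + m)) := by
        refine mul_le_mul_right ?_ _
        exact pow_le_pow_right_of_le_one' tsub_le_self hk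
    _ ≤ (2 : ℝ≥0∞) ^ T * (2⁻¹) ^ (T + m) := by
        rw [pow_mul]
        gcongr
    _ = _ := by
        rw [pow_add, ← mul_assoc, ← mul_pow, ENNReal.mul_inv_cancel (by simp) (by simp), one_pow,
          one_mul]

variable (P sp n) in
/-- Some leaf is on no path of the given identifiers. -/
def MissesLeaf (xs : List ℕ) : Prop :=
  ∃ u ∈ Finset.Ico (2 ^ height n) (2 ^ (height n + 1)),
    ∀ x ∈ xs, loc P sp n x (height n) ≠ u

theorem mean_missesLeaf_le (a k m : ℕ) (hk : 2 ^ height n * (height n + m) ≤ k) :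
    (sampleList P sp n (a + k)).mean (fun xs => ind (MissesLeaf P sp n (xs.drop a)))
      ≤ (2⁻¹ : ℝ≥0∞) ^ m := by
  rw [mean_sampleList_drop a k fun xs => ind (MissesLeaf P sp n xs)]
  calc (sampleList P sp n k).mean (fun xs => ind (MissesLeaf P sp n xs))
      ≤ (sampleList P sp n k).mean fun xs =>
          ∑ u ∈ Finset.Ico (2 ^ height n) (2 ^ (height n + 1)),
            ind (∀ x ∈ xs, loc P sp n x (height n) ≠ u) :=
        PMF.mean_mono _ fun xs _ => ind_exists_le_sum _ _
    _ ≤ ∑ u ∈ Finset.Ico (2 ^ height n) (2 ^ (height n + 1)),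
          (1 - ((2 : ℝ≥0∞) ^ height n)⁻¹) ^ k := by
        rw [mean_finset_sum]
        refine Finset.sum_le_sum fun u hu => ?_
        rw [Finset.mem_Ico] at hu
        exact mean_sampleList_leaf_ne_le hu.1 hu.2 k
    _ ≤ _ := by
        rw [Finset.sum_const, Nat.card_Ico, pow_succ, mul_two, Nat.add_sub_cancel, nsmul_eq_mul]
        push_cast
        exact coupon_bound _ _ _ hk

/-- The probability of a collision among the identifiers. -/
theorem mean_not_distinct_le {L : List ℕ} (hL : L.Nodup) (k : ℕ) :
    (sampleTable P sp n L).mean (fun y => (sampleList P sp n k).mean fun xs =>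
        ind (¬Distinct L y xs))
      ≤ ((L.length + k) ^ 2 : ℕ) * ((2 : ℝ≥0∞) ^ idBits P sp n)⁻¹ := by
  calc (sampleTable P sp n L).mean (fun y => (sampleList P sp n k).mean fun xs =>
        ind (¬Distinct L y xs))
      ≤ (sampleTable P sp n L).mean fun y => ind (¬Set.InjOn y {l | l ∈ L}) +
          k * (L.length + k) * ((2 : ℝ≥0∞) ^ idBits P sp n)⁻¹ := by
        refine PMF.mean_mono _ fun y _ => (PMF.mean_mono (g := fun xs =>
          ind (¬Set.InjOn y {l | l ∈ L}) + ind (¬(xs.Nodup ∧ ∀ x ∈ xs, x ∉ L.map y))) _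
          fun xs _ => ind_le_add fun h => ?_).trans ?_
        · by_contra hcon
          simp only [not_or, not_not] at hcon
          exact h ⟨hcon.1, hcon.2⟩
        · rw [PMF.mean_add, PMF.mean_const]
          gcongr
          simpa using mean_sampleList_collision_le (P := P) (sp := sp) (n := n) k (L.map y)
    _ ≤ L.length * L.length * ((2 : ℝ≥0∞) ^ idBits P sp n)⁻¹ +
          k * (L.length + k) * ((2 : ℝ≥0∞) ^ idBits P sp n)⁻¹ := by
        rw [PMF.mean_add, PMF.mean_const]
        gcongr
        exact mean_sampleTable_not_injOn_le hL
    _ ≤ _ := by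
        rw [← add_mul]
        gcongr
        norm_cast
        nlinarith

theorem isId_of_mem_support_sampleTable {L : List ℕ} {y : ℕ → ℕ}
    (hy : y ∈ (sampleTable P sp n L).support) {l : ℕ} (hl : l ∈ L) :
    IsId (idBits P sp n) (y l) := by
  induction L generalizing y with
  | nil => simp at hl
  | cons m L ih =>
    simp only [sampleTable, PMF.mem_support_bind_iff, PMF.mem_support_map_iff] at hy
    obtain ⟨κ, hκ, id, hid, rfl⟩ := hy
    by_cases hlm : l = m
    · rw [hlm, Function.update_self]
      exact isId_of_mem_support_idgen hid
    · rw [Function.update_of_ne hlm]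
      exact ih hκ (by simpa [hlm] using hl)

theorem of_mem_support_sampleList {k : ℕ} {xs : List ℕ}
    (hxs : xs ∈ (sampleList P sp n k).support) :
    xs.length = k ∧ ∀ x ∈ xs, IsId (idBits P sp n) x := by
  induction k generalizing xs with
  | zero =>
    simp only [sampleList, PMF.support_pure, Set.mem_singleton_iff] at hxs
    simp [hxs]
  | succ k ih =>
    simp only [sampleList, PMF.mem_support_bind_iff, PMF.mem_support_map_iff] at hxs
    obtain ⟨x, hx, xs', hxs', rfl⟩ := hxs
    obtain ⟨h1, h2⟩ := ih hxs'
    refine ⟨by simp [h1], fun x' hx' => ?_⟩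
    rcases List.mem_cons.1 hx' with rfl | hx'
    · exact isId_of_mem_support_idgen hx
    · exact h2 x' hx'

end VORAM

namespace VORAM

variable {E : SymEnc} {P : Params} {sp n : ℕ}

/-! ### The initial state -/

/-- The initial ciphertexts decrypt to empty buckets with the keys of their children, and with
zeros instead of keys at the leaves. -/
theorem dec_of_mem_support_writeEmpty {keys : ℕ → Key sp} {vs : List ℕ} {ps : ℕ → List Bool}
    {r : (ℕ → List Bool) × List Access} (hr : r ∈ (writeEmpty E P n keys vs ps).support) (v : ℕ) :
    (v ∉ vs → r.1 v = ps v) ∧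
    (v ∈ vs → E.dec sp (keys v) (r.1 v) = Bucket.bits P n
      (if v < 2 ^ height n then ⟨keys (2 * v), keys (2 * v + 1), []⟩
        else ⟨fun _ => false, fun _ => false, []⟩)) := by
  induction vs generalizing ps r with
  | nil =>
    simp only [writeEmpty, PMF.support_pure, Set.mem_singleton_iff] at hr
    simp [hr]
  | cons u vs ih =>
    have hw : writeEmpty E P n keys (u :: vs) ps = (E.enc sp (keys u) (Bucket.bits P n
        (if u < 2 ^ height n then ⟨keys (2 * u), keys (2 * u + 1), []⟩
          else ⟨fun _ => false, fun _ => false, []⟩))).bind fun c =>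
        (writeEmpty E P n keys vs (Function.update ps u c)).map fun r =>
          (r.1, Access.write u c :: r.2) := rfl
    simp only [hw, PMF.mem_support_bind_iff, PMF.mem_support_map_iff] at hr
    obtain ⟨c, hc, r', hr', rfl⟩ := hr
    obtain ⟨h1, h2⟩ := ih hr'
    constructor
    · intro hv
      simp only [List.mem_cons, not_or] at hv
      simp only [h1 hv.2, Function.update_of_ne hv.1]
    · intro hv
      by_cases hvs : v ∈ vs
      · exact h2 hvs
      · obtain rfl : v = u := by simpa [hvs] using hv
        simp only [h1 hvs, Function.update_self]
        exact E.correct _ _ _ _ hc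

/-- The placement of the data at the beginning: no blocks anywhere. -/
def emptyPlacement : Placement := ⟨∅, fun _ => []⟩

theorem represents_of_mem_support_start (hZ : 2 * sp ≤ P.Z sp n) {x : State sp n × List Access}
    (hx : x ∈ (start E P sp n).support) :
    x.1.ids = ∅ ∧ ∃ K : ℕ → Key sp, Represents E P x.1 K emptyPlacement := by
  let keyOf : (Fin (2 ^ (height n + 1)) → Key sp) → ℕ → Key sp := fun keys v =>
    if h : v < 2 ^ (height n + 1) then keys ⟨v, h⟩ else fun _ => false
  have hs : start E P sp n = (PMF.uniformOfFintype (Fin (2 ^ (height n + 1)) → Key sp)).bind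
      fun keys => (writeEmpty E P n (keyOf keys) (List.range' 1 (2 ^ (height n + 1) - 1))
        (fun _ => [])).map fun r => (⟨keyOf keys 1, ∅, ∅, r.1⟩, r.2) := rfl
  simp only [hs, PMF.mem_support_bind_iff, PMF.mem_support_map_iff] at hx
  obtain ⟨keys, -, r, hr, rfl⟩ := hx
  have hout : ∀ v, 2 ^ (height n + 1) ≤ v → keyOf keys v = fun _ => false := fun v hv =>
    dif_neg (by omega)
  refine ⟨rfl, keyOf keys, rfl, rfl, fun v hv1 hv2 _ => ?_, hout⟩
  have h := (dec_of_mem_support_writeEmpty hr v).2 (by rw [List.mem_range'_1]; omega)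
  simp only at h ⊢
  rw [h]
  split_ifs with hv
  · exact parse_bits hZ (fits_nil P sp n)
  · rw [parse_bits hZ (fits_nil P sp n), hout _ (by rw [pow_succ]; omega),
      hout _ (by rw [pow_succ]; omega)]
    rfl

theorem consistent_empty : Consistent P sp n emptyPlacement.stash emptyPlacement.buckets
    fun _ => none where
  makesUp := fun id => by simp [emptyPlacement, pathPieces, pieces, MakesUp]
  onPath := fun id t v _ _ _ h => absurd rfl h
  proper := fun id h => absurd rfl h

theorem placementOk_empty (b : ℕ) : PlacementOk b emptyPlacement :=
  ⟨fun id h => by simp [emptyPlacement] at h, fun v p h => by simp [emptyPlacement] at h⟩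

/-! ### Comparison of two executions -/

theorem accesses_congr {τ τ' : List Step}
    (h : τ.map (fun σ => σ.2.1) = τ'.map fun σ => σ.2.1) (cs : List (List Bool)) :
    accesses P sp n τ cs = accesses P sp n τ' cs := by
  induction τ generalizing τ' cs with
  | nil =>
    obtain rfl : τ' = [] := by simpa using h.symm
    rfl
  | cons σ τ ih =>
    cases τ' with
    | nil => simp at h
    | cons σ' τ' =>
      simp only [List.map_cons, List.cons.injEq] at h
      simp only [accesses, stepAccess, h.1, ih h.2]

theorem map_fst_runWrites_congr {τ τ' : List Step}
    (h : τ.map (fun σ => σ.2.1) = τ'.map fun σ => σ.2.1) (pl pl' : Placement) :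
    (runWrites P sp n τ pl).map Prod.fst = (runWrites P sp n τ' pl').map Prod.fst := by
  have e : ∀ τ : List Step, (τ.flatMap fun σ => pathUp P sp n σ.2.1 (height n + 1))
      = (τ.map fun σ => σ.2.1).flatMap fun x => pathUp P sp n x (height n + 1) := fun τ => by
    rw [List.flatMap_map]
  rw [map_fst_runWrites, map_fst_runWrites, e, e, h]

theorem stepsOk_schedule {L : List ℕ} {b : ℕ} {y : ℕ → ℕ} {os : List Op} {xs : List ℕ}
    (hL : ∀ o ∈ os, o.label ∈ L) (hy : ∀ l ∈ L, IsId b (y l)) (hxs : ∀ x ∈ xs, IsId b x) :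
    StepsOk b (schedule os xs y) ∧ ∀ l ∈ L, IsId b (tableBefore os xs y l) := by
  induction os generalizing xs with
  | nil => exact ⟨by simp [StepsOk, schedule], hy⟩
  | cons o os ih =>
    cases xs with
    | nil => exact ⟨by simp [StepsOk, schedule], hy⟩
    | cons x xs =>
      obtain ⟨h1, h2⟩ := ih (xs := xs) (fun o ho => hL o (by simp [ho]))
        fun x hx => hxs x (by simp [hx])
      have hx := hxs x (by simp)
      constructor
      · intro σ hσ
        rcases List.mem_cons.1 hσ with rfl | hσ
        · exact ⟨hx, h2 _ (hL o (by simp))⟩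
        · exact h1 σ hσ
      · intro l hl
        rw [tableBefore]
        by_cases hlo : l = o.label
        · rw [hlo, Function.update_self]
          exact hx
        · rw [Function.update_of_ne hlo]
          exact h2 l hl

/-- Executing operations amounts to drawing the identifiers `xs` that will be used and the final
table `y` independently of the operations, and then executing the resulting schedule. -/
theorem execOps_eq_schedule {L : List ℕ} (os : List Op) (hL : ∀ o ∈ os, o.label ∈ L) {d : Blocks}
    (hos : os.foldlM effect ∅ = some d) (s : State sp n) (hs : s.ids = ∅) :
    execOps E P os s = (sampleTable P sp n L).bind fun y =>
      (sampleList P sp n os.length).bind fun xs => execSteps E P (schedule os xs y) s := by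
  rw [execOps_eq os hL hos s (by simp [hs])]
  have h : ∀ κ, override κ s.ids = κ := fun κ => by
    funext l
    simp [override, hs]
  simp only [h]
  exact drawSteps_eq os hL fun _ τ => execSteps E P τ s

/-- For identifiers without collisions, and if the common final operations visit all leaves, the
two executions lead to the same placement and the same table. -/
theorem final_eq {L : List ℕ} {os os' : List Op} {d : Blocks} {xs : List ℕ} {y : ℕ → ℕ} {a : ℕ}
    (hL : ∀ o ∈ os, o.label ∈ L) (hL' : ∀ o ∈ os', o.label ∈ L)
    (hos : os.foldlM effect ∅ = some d) (hos' : os'.foldlM effect ∅ = some d)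
    (hlen : os.length = xs.length) (hlen' : os'.length = xs.length)
    (hdrop : os.drop a = os'.drop a)
    (hy : ∀ l ∈ L, IsId (idBits P sp n) (y l)) (hxs : ∀ x ∈ xs, IsId (idBits P sp n) x)
    (hd : Distinct L y xs) (hleaf : ¬MissesLeaf P sp n (xs.drop a)) :
    let pl := runPlacement P sp n (schedule os xs y) emptyPlacement
    let pl' := runPlacement P sp n (schedule os' xs y) emptyPlacement
    (∀ v, 1 ≤ v → v < 2 ^ (height n + 1) → pl.buckets v = pl'.buckets v) ∧
    pl.stash = pl'.stash ∧
    (schedule os xs y).foldl (fun ids σ => changeTable σ.2.2 ids σ.1) ∅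
      = (schedule os' xs y).foldl (fun ids σ => changeTable σ.2.2 ids σ.1) ∅ := by
  -- without collisions both executions are valid and end with the same stored blocks
  obtain ⟨hv, hc⟩ := (corresponds_empty L _).run hlen hos hL hd
  obtain ⟨hv', hc'⟩ := (corresponds_empty L _).run hlen' hos' hL' hd
  obtain ⟨hC, hids⟩ := hc.unique hc'
  -- the common final operations have the same schedule, as this depends only on what follows
  have hsplit : ∀ os : List Op, os.length = xs.length → schedule os xs y
      = schedule (os.take a) (xs.take a) (tableBefore (os.drop a) (xs.drop a) y) ++
        schedule (os.drop a) (xs.drop a) y := fun os h => by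
    rw [← schedule_append (by simp [h]), List.take_append_drop, List.take_append_drop]
  have hsteps := (stepsOk_schedule hL hy hxs).1
  have hsteps' := (stepsOk_schedule hL' hy hxs).1
  rw [hsplit os hlen] at hv hC hsteps
  rw [hsplit os' hlen', ← hdrop] at hv' hC hsteps'
  have hτ := map_path_schedule (os := os.drop a) (xs := xs.drop a) (by simp [hlen]) y
  suffices key : (∀ v, 1 ≤ v → v < 2 ^ (height n + 1) →
      (runPlacement P sp n (schedule os xs y) emptyPlacement).buckets v
        = (runPlacement P sp n (schedule os' xs y) emptyPlacement).buckets v) ∧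
      (runPlacement P sp n (schedule os xs y) emptyPlacement).stash
        = (runPlacement P sp n (schedule os' xs y) emptyPlacement).stash from
    ⟨key.1, key.2, hids⟩
  clear hc hc' hids
  rw [hsplit os hlen, hsplit os' hlen', ← hdrop]
  clear hsplit
  generalize schedule (os.take a) (xs.take a) _ = τ₀ at *
  generalize schedule (os'.take a) (xs.take a) _ = τ₀' at *
  generalize schedule (os.drop a) (xs.drop a) y = τ at *
  rw [stepsValid_append] at hv hv'
  simp only [runContents, runPlacement, List.foldl_append] at hC ⊢
  refine runPlacement_eq (consistent_empty.run (fun σ hσ => hsteps σ (by simp [hσ])) hv.1)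
    (consistent_empty.run (fun σ hσ => hsteps' σ (by simp [hσ])) hv'.1)
    (fun σ hσ => hsteps σ (by simp [hσ])) hv.2 hv'.2 (fun u hu1 hu2 => ?_) hC
  by_contra hne
  refine hleaf ⟨u, by simp [hu1, hu2], fun x hx he => hne ?_⟩
  rw [← hτ, List.mem_map] at hx
  obtain ⟨σ, hσ, rfl⟩ := hx
  exact ⟨σ, hσ, he.symm⟩

/-- The contents of the erasable memory, written as a sequence of strings. -/
def memoryStrings (k : Key sp) (stash : Blocks) (ids : Std.ExtTreeMap ℕ ℕ) : List (List Bool) :=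
  emStrings (n := n) (⟨k, stash, ids, fun _ => []⟩ : State sp n)

/-- What the guesser does with the outcome of the execution. -/
def guess (C : Circuit) (st : List Bool) (accs : List (List Access)) (k : Key sp) (stash : Blocks)
    (ids : Std.ExtTreeMap ℕ ℕ) : PMF Bool :=
  C.run (st :: (accessStrings accs ++ memoryStrings (n := n) k stash ids))

/-- As a function of one ciphertext, the guess is computed by a circuit that is not larger. -/
theorem exists_guess_eq (C : Circuit) (st : List Bool) (τ : List Step) (k : Key sp)
    (stash : Blocks) (ids : Std.ExtTreeMap ℕ ℕ) (pre post : List (List Bool)) :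
    ∃ C' : Circuit, C'.length ≤ C.length ∧ ∀ c,
      guess (n := n) C st (accesses P sp n τ (pre ++ c :: post)) k stash ids = C'.run [c] := by
  have hslot : OneSlot fun c => st :: (accessStrings (accesses P sp n τ (pre ++ c :: post)) ++
      memoryStrings (n := n) k stash ids) := by
    simp only [accessStrings, length_accesses]
    exact (((oneSlot_accesses τ pre post).append_left [_]).append_right _).append_left [st]
  obtain ⟨C', hC', h⟩ := C.exists_run_eq hslot
  exact ⟨C', hC'.le, h⟩

/-- The view of the guesser in terms of encrypted writes. -/
theorem guess_execSteps_eq (hZ : 2 * sp ≤ P.Z sp n) (C : Circuit) (st : List Bool)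
    {τ : List Step} (hτ : StepsOk (idBits P sp n) τ) {s : State sp n} {K : ℕ → Key sp}
    (h : Represents E P s K emptyPlacement) (hids : s.ids = ∅) :
    ((execSteps E P τ s).bind fun r => C.run (st :: (accessStrings r.2 ++ emStrings r.1)))
      = (play E P n (runWrites P sp n τ emptyPlacement) K).bind fun r =>
        guess (n := n) C st (accesses P sp n τ r.1) (r.2 1)
          (runPlacement P sp n τ emptyPlacement).stash
          (τ.foldl (fun ids σ => changeTable σ.2.2 ids σ.1) ∅) := by
  have h1 := congrArg (fun p => PMF.bind p fun q => guess (n := n) C st q.1 q.2.1 q.2.2.1 q.2.2.2)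
    (execSteps_eq hZ τ hτ h (placementOk_empty _))
  simp only [PMF.bind_map, Function.comp_def, hids] at h1
  exact h1

/-- The encryption step of the comparison, for fixed identifiers. -/
theorem guess_close {ε : ℝ≥0∞} {S : ℕ} (hZ : 2 * sp ≤ P.Z sp n)
    (hε : ∀ (m₀ m₁ : List Bool) (C : Circuit), m₀.length = P.Z sp n → m₁.length = P.Z sp n →
      C.length ≤ S → ((E.fresh sp m₀).bind fun c => C.run [c]) true
        ≤ ((E.fresh sp m₁).bind fun c => C.run [c]) true + ε)
    {C : Circuit} (hC : C.length ≤ S) (st : List Bool) {τ τ' : List Step}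
    (hτ : StepsOk (idBits P sp n) τ) (hτ' : StepsOk (idBits P sp n) τ')
    (hpaths : τ.map (fun σ => σ.2.1) = τ'.map fun σ => σ.2.1)
    {s : State sp n} {K : ℕ → Key sp} (h : Represents E P s K emptyPlacement) (hids : s.ids = ∅)
    (hbk : ∀ v, 1 ≤ v → v < 2 ^ (height n + 1) →
      (runPlacement P sp n τ emptyPlacement).buckets v
        = (runPlacement P sp n τ' emptyPlacement).buckets v)
    (hstash : (runPlacement P sp n τ emptyPlacement).stash
        = (runPlacement P sp n τ' emptyPlacement).stash)
    (htable : τ.foldl (fun ids σ => changeTable σ.2.2 ids σ.1) ∅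
        = τ'.foldl (fun ids σ => changeTable σ.2.2 ids σ.1) ∅) :
    ((execSteps E P τ s).bind fun r => C.run (st :: (accessStrings r.2 ++ emStrings r.1))) true
      ≤ ((execSteps E P τ' s).bind fun r =>
          C.run (st :: (accessStrings r.2 ++ emStrings r.1))) true
        + 2 * (τ.length * (height n + 1) : ℕ) * ε := by
  have hT := height_le_idBits P sp n
  rw [guess_execSteps_eq hZ C st hτ h hids, guess_execSteps_eq hZ C st hτ' h hids]
  simp only [accesses_congr hpaths, hstash, htable]
  set D : List (List Bool) × (ℕ → Key sp) → PMF Bool := fun r =>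
    guess (n := n) C st (accesses P sp n τ' r.1) (r.2 1)
      (runPlacement P sp n τ' emptyPlacement).stash
      (τ'.foldl (fun ids σ => changeTable σ.2.2 ids σ.1) ∅)
  have hD : ∀ pre post K', ∃ C : Circuit, C.length ≤ S ∧
      ∀ c, D (pre ++ c :: post, K') = C.run [c] := fun pre post K' => by
    obtain ⟨C', hC', h⟩ := exists_guess_eq (P := P) (n := n) C st τ' (K' 1)
      (runPlacement P sp n τ' emptyPlacement).stash
      (τ'.foldl (fun ids σ => changeTable σ.2.2 ids σ.1) ∅) pre post
    exact ⟨C', hC'.trans hC, h⟩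
  obtain ⟨hfit, hup⟩ := runWrites_ok τ hτ (placementOk_empty _)
  obtain ⟨hfit', hup'⟩ := runWrites_ok τ' hτ' (placementOk_empty _)
  have h1 := (play_bind_close hZ hε _ hup hfit K D hD).1
  have h2 := (play_bind_close hZ hε _ hup' hfit' K D hD).2
  have hnodes := map_fst_runWrites_congr (P := P) (sp := sp) (n := n) hpaths
    emptyPlacement emptyPlacement
  have hhid : playHidden E P n (runWrites P sp n τ emptyPlacement) K
      = playHidden E P n (runWrites P sp n τ' emptyPlacement) K := by
    refine playHidden_congr hnodes (bk := emptyPlacement.buckets) (bk' := emptyPlacement.buckets)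
      (fun v hv => ?_) K
    rw [applyWrites_runWrites, applyWrites_runWrites]
    rw [map_fst_runWrites, List.mem_flatMap] at hv
    obtain ⟨σ, hσ, hv⟩ := hv
    obtain ⟨t, ht, rfl⟩ := mem_pathUp.1 hv
    have hb := loc_bounds (t := t) (by omega) (hτ σ hσ).1
    exact hbk _ (Nat.one_le_two_pow.trans hb.1)
      (hb.2.trans_le (Nat.pow_le_pow_right (by norm_num) (by omega)))
  rw [length_runWrites] at h1 h2
  rw [← hhid, ← List.length_map (as := τ') (fun σ => σ.2.1), ← hpaths, List.length_map] at h2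
  refine (h1.trans (add_le_add_left h2 _)).trans_eq ?_
  ring

/-- For a fixed initial state and fixed operations, the guesser hardly distinguishes the two
sequences of operations. -/
theorem execOps_close {ε : ℝ≥0∞} {S ℓ : ℕ} (hZ : 2 * sp ≤ P.Z sp n)
    (hε : ∀ (m₀ m₁ : List Bool) (C : Circuit), m₀.length = P.Z sp n → m₁.length = P.Z sp n →
      C.length ≤ S → ((E.fresh sp m₀).bind fun c => C.run [c]) true
        ≤ ((E.fresh sp m₁).bind fun c => C.run [c]) true + ε)
    (hℓ : 2 ^ height n * (height n + sp) ≤ ℓ)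
    {C : Circuit} (hC : C.length ≤ S) (st : List Bool) {s : State sp n} {K : ℕ → Key sp}
    (h : Represents E P s K emptyPlacement) (hids : s.ids = ∅) {os os' : List Op} {d : Blocks}
    (hlen : os.length = os'.length) (hos : os.foldlM effect ∅ = some d)
    (hos' : os'.foldlM effect ∅ = some d)
    (hdrop : os.drop (os.length - ℓ) = os'.drop (os'.length - ℓ)) :
    ((execOps E P os s).bind fun r => C.run (st :: (accessStrings r.2 ++ emStrings r.1))) true
      ≤ ((execOps E P os' s).bind fun r =>
          C.run (st :: (accessStrings r.2 ++ emStrings r.1))) true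
        + 2 * (os.length * (height n + 1) : ℕ) * ε
        + (((3 * os.length) ^ 2 : ℕ) * (2⁻¹ : ℝ≥0∞) ^ P.γ sp + (2⁻¹ : ℝ≥0∞) ^ sp) := by
  -- sequences shorter than `ℓ` are equal
  by_cases hshort : os.length < ℓ
  · obtain rfl : os = os' := by
      rw [← hlen, Nat.sub_eq_zero_of_le hshort.le] at hdrop
      simpa using hdrop
    rw [add_assoc]
    exact le_self_add
  obtain ⟨a, ha⟩ : ∃ a, os.length = a + ℓ := ⟨os.length - ℓ, by omega⟩
  rw [← hlen, ha, Nat.add_sub_cancel] at hdrop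
  obtain ⟨L, hLdef⟩ : ∃ L, L = ((os ++ os').map Op.label).dedup := ⟨_, rfl⟩
  have hLnd : L.Nodup := hLdef ▸ List.nodup_dedup _
  have hLlen : L.length ≤ 2 * os.length := by
    rw [hLdef]
    refine (List.dedup_sublist _).length_le.trans ?_
    simp only [List.length_map, List.length_append]
    omega
  have hL : ∀ o ∈ os, o.label ∈ L := fun o ho =>
    hLdef ▸ List.mem_dedup.2 (List.mem_map_of_mem (List.mem_append_left _ ho))
  have hL' : ∀ o ∈ os', o.label ∈ L := fun o ho =>
    hLdef ▸ List.mem_dedup.2 (List.mem_map_of_mem (List.mem_append_right _ ho))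
  rw [execOps_eq_schedule os hL hos s hids, execOps_eq_schedule os' hL' hos' s hids, ← hlen]
  simp only [PMF.bind_bind]
  have hbad : (sampleTable P sp n L).mean (fun y => (sampleList P sp n os.length).mean fun xs =>
      ind (¬Distinct L y xs) + ind (MissesLeaf P sp n (xs.drop a)))
      ≤ ((3 * os.length) ^ 2 : ℕ) * (2⁻¹ : ℝ≥0∞) ^ P.γ sp + (2⁻¹ : ℝ≥0∞) ^ sp := by
    simp only [PMF.mean_add]
    refine add_le_add ((mean_not_distinct_le hLnd _).trans ?_) ?_
    · gcongr
      · omega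
      · rw [ENNReal.inv_pow]
        refine pow_le_pow_right_of_le_one' ?_ ?_
        · simp
        · rw [idBits]; omega
    · rw [PMF.mean_const, ha]
      exact mean_missesLeaf_le a ℓ sp hℓ
  refine (PMF.bind_true_le _ (fun y => (sampleList P sp n os.length).mean fun xs =>
      ind (¬Distinct L y xs) + ind (MissesLeaf P sp n (xs.drop a)))
    fun y hy => PMF.bind_true_le _ (fun xs => ind (¬Distinct L y xs) +
      ind (MissesLeaf P sp n (xs.drop a))) fun xs hxs => ?_).trans (add_le_add_right hbad _)
  obtain ⟨hxlen, hxid⟩ := of_mem_support_sampleList hxs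
  have hyid : ∀ l ∈ L, IsId (idBits P sp n) (y l) := fun l hl =>
    isId_of_mem_support_sampleTable hy hl
  by_cases hd : Distinct L y xs
  swap
  · rw [ind_of_true hd]
    exact (PMF.coe_le_one _ _).trans (le_add_left le_self_add)
  by_cases hleaf : MissesLeaf P sp n (xs.drop a)
  · rw [ind_of_true hleaf]
    exact (PMF.coe_le_one _ _).trans (le_add_left le_add_self)
  obtain ⟨hbk, hstash, htable⟩ := final_eq (P := P) (sp := sp) (n := n) hL hL' hos hos' hxlen.symm
    (hlen.symm.trans hxlen.symm) hdrop hyid hxid hd hleaf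
  have hpath := map_path_schedule hxlen.symm y
  have hpath' := map_path_schedule (hlen.symm.trans hxlen.symm) y
  have hclose := guess_close hZ hε hC st (stepsOk_schedule hL hyid hxid).1
    (stepsOk_schedule hL' hyid hxid).1 (hpath.trans hpath'.symm) h hids hbk hstash htable
  rw [← List.length_map (fun σ : Step => σ.2.1), hpath, hxlen] at hclose
  exact hclose.trans le_self_add

end VORAM

/-! ### History independence -/

theorem ENNReal.toReal_le_add_of_le {p q : ℝ≥0∞} {d : ℝ} (hd : 0 ≤ d) (hq : q ≠ ⊤)
    (h : p ≤ q + ENNReal.ofReal d) : p.toReal ≤ q.toReal + d := by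
  have := ENNReal.toReal_mono (by simp [hq]) h
  rwa [ENNReal.toReal_add hq ENNReal.ofReal_ne_top, ENNReal.toReal_ofReal hd] at this

theorem le_add_ofReal_of_abs_toReal_sub_le {p q : ℝ≥0∞} {d : ℝ} (hp : p ≠ ⊤) (hq : q ≠ ⊤)
    (h : |p.toReal - q.toReal| ≤ d) : p ≤ q + ENNReal.ofReal d := by
  rw [← ENNReal.ofReal_toReal hp, ← ENNReal.ofReal_toReal hq,
    ← ENNReal.ofReal_add ENNReal.toReal_nonneg ((abs_nonneg _).trans h)]
  refine ENNReal.ofReal_le_ofReal ?_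
  have := (abs_le.1 h).2
  linarith

theorem two_pow_height_le {n : ℕ} (hn : 1 ≤ n) : 2 ^ VORAM.height n ≤ 2 * n := by
  rw [VORAM.height]
  rcases Nat.lt_or_ge 1 n with h | h
  · have h1 := Nat.pow_pred_clog_lt_self (b := 2) (by norm_num) h
    have h2 := Nat.clog_pos (b := 2) (by norm_num) h
    obtain ⟨k, hk⟩ : ∃ k, Nat.clog 2 n = k + 1 := ⟨Nat.clog 2 n - 1, by omega⟩
    rw [hk] at h1 ⊢
    rw [pow_succ]
    simp only [Nat.pred_eq_sub_one, Nat.add_sub_cancel] at h1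
    omega
  · obtain rfl : n = 1 := by omega
    simp

theorem height_le_log (n : ℕ) (hn : 1 ≤ n) : (VORAM.height n : ℝ) ≤ 3 * Real.log n := by
  rw [VORAM.height]
  rcases Nat.lt_or_ge 1 n with h | h
  · have h1 := Nat.pow_pred_clog_lt_self (b := 2) (by norm_num) h
    have h2 := Nat.clog_pos (b := 2) (by norm_num) h
    obtain ⟨k, hk⟩ : ∃ k, Nat.clog 2 n = k + 1 := ⟨Nat.clog 2 n - 1, by omega⟩
    rw [hk] at h1 ⊢
    simp only [Nat.pred_eq_sub_one, Nat.add_sub_cancel] at h1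
    have h3 : (k : ℝ) * Real.log 2 ≤ Real.log n := by
      rw [← Real.log_pow]
      exact Real.log_le_log (by positivity) (by exact_mod_cast h1.le)
    have h4 : Real.log 2 ≤ Real.log n := Real.log_le_log (by norm_num) (by exact_mod_cast h)
    have h5 := Real.log_two_gt_d9
    push_cast
    nlinarith
  · obtain rfl : n = 1 := by omega
    simp

theorem mainTheorem7 :
    ∃ ℓ : ℕ → ℕ → ℕ,
      (∃ C : ℝ, ∀ sp n : ℕ, (ℓ sp n : ℝ) ≤ C * (n * Real.log n + sp * n)) ∧
      ∀ (E : SymEnc) (P : VORAM.Params),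
        E.Indistinguishable →
        (∀ n : ℕ → ℕ, PolyBounded n → PolyBounded fun sp => P.Z sp (n sp)) →
        (∀ sp n : ℕ, 2 * sp ≤ P.Z sp n) →
        (Negligible fun sp => (1 / 2 : ℝ) ^ P.γ sp) →
        HistoryIndependent (vORAM E P) ℓ := by
  -- `2 * n` bounds the number of leaves; in that many rounds of `height n + sp` operations all leaves
  -- are visited except with probability `2 ^ (-sp)`
  refine ⟨fun sp n => 2 * n * (VORAM.height n + sp), ⟨6, fun sp n => ?_⟩, ?_⟩
  · rcases Nat.eq_zero_or_pos n with rfl | hn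
    · simp
    · have h1 := height_le_log n hn
      have h2 : (0 : ℝ) ≤ sp * n := by positivity
      have h3 : (n : ℝ) * VORAM.height n ≤ n * (3 * Real.log n) :=
        mul_le_mul_of_nonneg_left h1 (Nat.cast_nonneg n)
      push_cast
      nlinarith
  intro E P hE hZpoly hZ hγ n hn hn1 A hA hadm
  obtain ⟨hguess, q, hq, hqb⟩ := hA
  obtain ⟨ε, hεneg, hε0, hε⟩ := hE.uniform (hZpoly n hn) hguess
  have hT : PolyBounded fun sp => VORAM.height (n sp) + 1 :=
    (hn.add (polyBounded_const 1)).mono fun sp =>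
      Nat.add_le_add_right (Nat.clog_le_of_le_pow (Nat.lt_two_pow_self).le) 1
  -- the three terms: replaced ciphertexts in both executions, collisions, and unvisited leaves
  set δ : ℕ → ℝ := fun sp => (2 * (q sp * (VORAM.height (n sp) + 1)) : ℕ) * ε sp +
    ((((3 * q sp) * (3 * q sp) : ℕ) : ℝ) * (1 / 2 : ℝ) ^ P.γ sp + (1 / 2 : ℝ) ^ sp) with hδ
  have hδneg : Negligible δ :=
    (hεneg.polyBounded_mul ((polyBounded_const 2).mul (hq.mul hT)) hε0).add
      ((hγ.polyBounded_mul (((polyBounded_const 3).mul hq).mul ((polyBounded_const 3).mul hq))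
        fun sp => by positivity).add negligible_half_pow)
  have hδ0 : ∀ sp, 0 ≤ δ sp := fun sp => by
    have := hε0 sp
    positivity
  refine Negligible.mono hδneg (fun sp => abs_nonneg _) fun sp => ?_
  have hclose : ∀ o, A.Outputs n sp o → ∀ (s : VORAM.State sp (n sp)) (K : ℕ → Key sp),
      VORAM.Represents E P s K VORAM.emptyPlacement → s.ids = ∅ →
      ∀ os os' : List VORAM.Op, (os = o.1 ∧ os' = o.2.1 ∨ os = o.2.1 ∧ os' = o.1) →
      ((VORAM.execOps E P os s).bind fun r =>
        (A.guesser sp).run (o.2.2 :: (accessStrings r.2 ++ VORAM.emStrings r.1))) true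
      ≤ ((VORAM.execOps E P os' s).bind fun r =>
        (A.guesser sp).run (o.2.2 :: (accessStrings r.2 ++ VORAM.emStrings r.1))) true
        + ENNReal.ofReal (δ sp) := by
    intro o ho s K hs hids os os' hor
    obtain ⟨hlen, ⟨d, hd, hd', -⟩, hdrop⟩ := hadm sp o ho
    obtain ⟨hb, hb'⟩ := hqb sp o ho
    have hprop : os.length = os'.length ∧ os.foldlM VORAM.effect ∅ = some d ∧
        os'.foldlM VORAM.effect ∅ = some d ∧ os.length ≤ q sp ∧
        os.drop (os.length - 2 * n sp * (VORAM.height (n sp) + sp))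
          = os'.drop (os'.length - 2 * n sp * (VORAM.height (n sp) + sp)) := by
      rcases hor with ⟨rfl, rfl⟩ | ⟨rfl, rfl⟩
      · exact ⟨hlen, hd, hd', hb, hdrop⟩
      · exact ⟨hlen.symm, hd', hd, hb', hdrop.symm⟩
    obtain ⟨h1, h2, h3, h4, h5⟩ := hprop
    refine (VORAM.execOps_close (S := (A.guesser sp).length) (ε := ENNReal.ofReal (ε sp))
      (hZ sp (n sp)) (fun m₀ m₁ C hm₀ hm₁ hC => ?_)
      (Nat.mul_le_mul_right _ (two_pow_height_le (hn1 sp))) le_rfl o.2.2 hs hids h1 h2 h3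
      h5).trans ?_
    · exact le_add_ofReal_of_abs_toReal_sub_le (PMF.apply_ne_top _ _) (PMF.apply_ne_top _ _)
        (hε sp m₀ m₁ C hm₀ hm₁ hC)
    · rw [add_assoc]
      refine add_le_add_right ?_ _
      have hhalf : ∀ k : ℕ, (2⁻¹ : ENNReal) ^ k = ENNReal.ofReal ((1 / 2 : ℝ) ^ k) := fun k => by
        rw [ENNReal.ofReal_pow (by norm_num), one_div, ENNReal.ofReal_inv_of_pos (by norm_num)]
        simp
      have hε' := hε0 sp
      rw [hδ, ENNReal.ofReal_add (by positivity) (by positivity),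
        ENNReal.ofReal_add (by positivity) (by positivity), ENNReal.ofReal_mul (by positivity),
        ENNReal.ofReal_mul (by positivity), ENNReal.ofReal_natCast, ENNReal.ofReal_natCast,
        hhalf, hhalf]
      gcongr
      · rw [Nat.cast_mul]
        push_cast
        gcongr
      · rw [← pow_two]
        gcongr
  have hexp : ∀ b, A.experiment sp (n sp) b = (VORAM.start E P sp (n sp)).bind fun x =>
      (A.chooser sp x.2).bind fun o =>
        (VORAM.execOps E P (if b then o.2.1 else o.1) x.1).bind fun r =>
          (A.guesser sp).run (o.2.2 :: (accessStrings r.2 ++ VORAM.emStrings r.1)) := fun b => rfl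
  have hle : ∀ b, A.experiment sp (n sp) b true
      ≤ A.experiment sp (n sp) (!b) true + ENNReal.ofReal (δ sp) := fun b => by
    rw [hexp, hexp]
    refine PMF.bind_true_le' _ fun x hx => PMF.bind_true_le' _ fun o ho => ?_
    obtain ⟨hids, K, hK⟩ := VORAM.represents_of_mem_support_start (hZ sp (n sp)) hx
    refine hclose o ⟨x, hx, ho⟩ x.1 K hK hids _ _ ?_
    cases b
    · exact .inl ⟨rfl, rfl⟩
    · exact .inr ⟨rfl, rfl⟩
  rw [Adversary.advantage, abs_le]
  have h0 := ENNReal.toReal_le_add_of_le (hδ0 sp) (PMF.apply_ne_top _ _) (hle false)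
  have h1 := ENNReal.toReal_le_add_of_le (hδ0 sp) (PMF.apply_ne_top _ _) (hle true)
  simp only [Bool.not_false, Bool.not_true] at h0 h1
  constructor <;> linarith

end
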